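/- **Model.** Let $(E,\nu)$ be a standard Borel space with a $\sigma$-finite measure, let $\gamma(u,s),\varepsilon(u,s),\lambda(u,s,y)\ge 0$ be jointly measurable ($u\in E$, $s\in\mathbb R$, $y\in E\times\mathbb R$), $p\in[0,1]$, $q=1-p$. Put $a(y,t)=\int_E\lambda(u,t,y)\,\nu(du)$, $\varepsilon(t)=\int_E\varepsilon(u,t)\,\nu(du)$, and assume that $\int_E\gamma(u,\cdot)\,\nu(du)$ and $\varepsilon(\cdot)$ are integrable on $(0,t]$ and that, for every $y=(v,r)$ with $r\ge0$, $a(y,\cdot)$ is integrable on $(r,t]$, for all $t$. On a probability space $(\Omega,P)$ quakes are observed at times $0=\tau_0<\tau_1<\tau_2<\cdots$ (finitely many in bounded intervals; $\tau_k=\infty$ if there are fewer than $k$ quakes) with marks $u_k\in E$; write $y_k=(u_k,\tau_k)$. Each quake is, unobservably, a single quake or a cluster quake. $D_t\in\{0,1\}$ says whether a cluster is active, and $D_0=0$. A cluster quake occurring when $D=0$ initiates a cluster ($D$ becomes $1$) and is its mother quake; a cluster quake occurring when $D=1$ ends the cluster ($D$ becomes $0$) with probability $p$, independently of the past, and otherwise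 $D$ stays $1$. With respect to the joint history of all quakes, their types and $D$, single quakes have intensity $\gamma(u,s)\,\nu(du)\,ds$ and cluster quakes have intensity $\lambda(u,s,y)\,\nu(du)\,ds$ when a cluster with mother quake $y$ is active just before $s$, and $\varepsilon(u,s)\,\nu(du)\,ds$ when no cluster is active just before $s$. Let $\eta_t=\sum\delta_{(c_i,t_i)}$ and $h_t=\sum\delta_{(D_{t_i},t_i)}$, summed over the cluster quakes $(c_i,t_i)$ with $t_i\le t$, let $\alpha(h_t,\eta_t)=D_t$, and let $\theta_0(y)(h_t,\eta_t)$ be the indicator that $y$ is the mother quake of the cluster active at time $t$ ($0$ if none is active). Let $\mathcal F^O_t$ be generated by the times and marks of the quakes up to $t$. A *filter* is an $(\mathcal F^O_t)$-adapted process $(\pi_t)_{t\ge0}$ of probability measures on the space of pairs $(h,\eta)$ (finite histories) such that, with $\pi(f,t)=\int f\,d\pi_t$, $\pi(f,t)=E[f(h_t,\eta_t)\mid\mathcal F_t^O]$ a.s. for all $t\ge 0$ and all measurable $f$ with $f(h_t,\eta_t)$ integrable, and such that almost surely $t\mapsto\pi_t(B)$ is right-continuous for all measurable $B$. **Theorem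 3.2.** A filter exists, and for every filter, almost surely, the following holds for all functions $f$ of $(h,\eta)$ (all of which are $\pi_t$-integrable for all $t\ge0$) and all $k\ge0$ with $\tau_k<\infty$. First, $\pi(f,0)=f(0,0)$, where $(0,0)$ is the empty history. (i) For $\tau_k\le t<\tau_{k+1}$ and $1\le i\le k$, $$\pi(\theta_0(y_i)\alpha f,t)=\pi(\theta_0(y_i)\alpha f,\tau_k)\,e^{-\int_{\tau_k}^t (a(y_i,s)-\varepsilon(s))\,ds}\,b_k(t),$$ $$b_k(t)=\Big(\sum_{j=1}^k\pi(\theta_0(y_j)\alpha,\tau_k)e^{-\int_{\tau_k}^t (a(y_j,s)-\varepsilon(s))\,ds}+1-\sum_{j=1}^k\pi(\theta_0(y_j)\alpha,\tau_k)\Big)^{-1}.$$ (ii) On $[\tau_k,\tau_{k+1})$, $\pi(f,\cdot)$ satisfies $$\frac{d\pi(f,t)}{dt}=-\sum_{i=1}^k\pi(\theta_0(y_i)\alpha f,t)[a(y_i,t)-\varepsilon(t)]+\pi(f,t)\sum_{i=1}^k\pi(\theta_0(y_i)\alpha,t)[a(y_i,t)-\varepsilon(t)]\qquad(3.4)$$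 in integrated form for all $t$ (the right-hand side being integrable on $[\tau_k,t]$), in differential form for almost every $t$, and in differential form at every $t$ at which $a(y_1,\cdot),\dots,a(y_k,\cdot)$ and $\varepsilon(\cdot)$ are continuous (at $t=\tau_k$: right-continuous, with the right derivative). (iii) If $\tau_{k+1}<\infty$, the left limits $\pi(g,\tau_{k+1}-)=\lim_{t\uparrow\tau_{k+1}}\pi(g,t)$ exist for all $g$. Write $\gamma_{k+1}=\gamma(u_{k+1},\tau_{k+1})$, $\varepsilon_{k+1}=\varepsilon(u_{k+1},\tau_{k+1})$, $\lambda_{k+1,j}=\lambda(u_{k+1},\tau_{k+1},y_j)$, $d_{k+1}=\sum_{j=1}^k(\lambda_{k+1,j}-\varepsilon_{k+1})\pi(\theta_0(y_j)\alpha,\tau_{k+1}-)+\varepsilon_{k+1}+\gamma_{k+1}$, and for $D\in\{0,1\}$ let $f_D(h,\eta)=f(h+\delta_{(D,\tau_{k+1})},\eta+\delta_{y_{k+1}})$. Then $d_{k+1}>0$ and $$\pi(\theta_0(y_i)\alpha f,\tau_{k+1})=\frac{\gamma_{k+1}\,\pi(\theta_0(y_i)\alpha f,\tau_{k+1}-)+q\lambda_{k+1,i}\,\pi(f_1\theta_0(y_i)\alpha,\tau_{k+1}-)}{d_{k+1}},\quad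 1\le i\le k,$$ $$\pi(\theta_0(y_{k+1})\alpha f,\tau_{k+1})=\frac{\varepsilon_{k+1}\,\pi(f_1(1-\alpha),\tau_{k+1}-)}{d_{k+1}},$$ $$\pi(f,\tau_{k+1})=\frac{\gamma_{k+1}\,\pi(f,\tau_{k+1}-)+\varepsilon_{k+1}\,\pi(f_1(1-\alpha),\tau_{k+1}-)+\sum_{j=1}^k\lambda_{k+1,j}\,\pi([pf_0+qf_1]\theta_0(y_j)\alpha,\tau_{k+1}-)}{d_{k+1}}.$$ (iv) These equations determine the filter from the observed path: almost surely, any family $V(f,t)$ of real numbers that satisfies, for all $f$ and $k$, the initial condition and (i)–(iii) (with $V$ in place of $\pi$, with the existence of the left limits and $d_{k+1}>0$) equals $\pi(f,t)$ for all $f$ and all $t\ge0$. -/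

import Mathlib

open MeasureTheory Filter Topology Set
open scoped NNReal ENNReal

/-! ### Cluster histories -/

/-- The type of an observed quake: either a single quake (a point of `N`), or a cluster quake
(a point of `C`) together with the value `D` of the cluster indicator right after it
(`true`: the cluster is active). -/
inductive QuakeKind : Type
  | single : QuakeKind
  | cluster (D : Bool) : QuakeKind

instance QuakeKind.instMeasurableSpace : MeasurableSpace QuakeKind := ⊤

/-- Finite sequences carry the σ-algebra of the disjoint union of the powers of `X`. -/
instance listMeasurableSpace {X : Type*} [MeasurableSpace X] : MeasurableSpace (List X) :=
  MeasurableSpace.comap (List.equivSigmaTuple (α := X)) inferInstance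

/-- A value of the pair `(h, η)` of counting measures `h = ∑ δ_(D_{t_i}, t_i)` and
`η = ∑ δ_(c_i, t_i)`, both summed over the cluster quakes so far: the finite list of the triples
`(c_i, t_i, D_{t_i})` of mark, time and value of `D` right after the quake, the most recent one
first.  The occurrence times are distinct, so the list and the pair determine each other, and
adding `δ_(d, s)` to `h` and `δ_(v, s)` to `η` at a time `s` after all `t_i` is putting `(v, s, d)`
in front of the list. -/
abbrev ClusterHistory (E : Type*) : Type _ := List (E × ℝ × Bool)

namespace ClusterHistory

variable {E : Type*}

/-- The current value of the cluster indicator `D`; no cluster is active at time `0`. -/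
def active : ClusterHistory E → Bool
  | [] => false
  | (_, _, d) :: _ => d

/-- The mother quake `(mark, time)` of the currently active cluster, if there is one: the quake
that initiated it, that is, the cluster quake that came when no cluster was active. -/
def mother : ClusterHistory E → Option (E × ℝ)
  | [] => none
  | (v, s, d) :: l => if d then (if active l then mother l else some (v, s)) else none

/-- `α(h, η) = 1_{D = 1}`. -/
noncomputable def alpha (l : ClusterHistory E) : ℝ := if active l then 1 else 0

/-- `θ₀(y)`: the indicator that `y` is the mother quake of the currently active cluster
(`0` if no cluster is active). -/
noncomputable def theta (y : E × ℝ) : ClusterHistory E → ℝ :=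
  Set.indicator {l | mother l = some y} 1

end ClusterHistory

/-! ### The model -/

/-- The parameters of the mother-quake model on the mark space `E` with reference measure `ν`:
the intensity `γ(u, s)` of the single quakes, the intensity `ε(u, s)` with which clusters are
initiated, the intensity `λ(u, s, y)` of offspring of the mother quake `y = (mark, time)` and the
probability `p` that an offspring quake ends its cluster. -/
structure MotherQuakeRates (E : Type*) [MeasurableSpace E] (ν : Measure E) where
  γ : E → ℝ → ℝ≥0
  ε : E → ℝ → ℝ≥0
  lam : E → ℝ → E × ℝ → ℝ≥0
  p : ℝ≥0
  p_le_one : p ≤ 1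
  measurable_γ : Measurable fun x : E × ℝ => γ x.1 x.2
  measurable_ε : Measurable fun x : E × ℝ => ε x.1 x.2
  measurable_lam : Measurable fun x : E × ℝ × (E × ℝ) => lam x.1 x.2.1 x.2.2
  γ_finite : ∀ t : ℝ, ∫⁻ s in Ioc 0 t, ∫⁻ u, γ u s ∂ν ≠ ∞
  ε_finite : ∀ t : ℝ, ∫⁻ s in Ioc 0 t, ∫⁻ u, ε u s ∂ν ≠ ∞
  lam_finite : ∀ y : E × ℝ, 0 ≤ y.2 → ∀ t : ℝ, ∫⁻ s in Ioc y.2 t, ∫⁻ u, lam u s y ∂ν ≠ ∞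

namespace MotherQuakeRates

variable {E : Type*} [MeasurableSpace E] {ν : Measure E} (R : MotherQuakeRates E ν)

/-- The cluster intensity
`λ(u, s, D, η) = D ∑_i λ(u, s, y_i) θ₀(y_i) + (1 - D) ε(u, s)`:
at most one `θ₀(y_i)` is non-zero, and one is exactly when a cluster is active. -/
def clusterRate (l : ClusterHistory E) (u : E) (s : ℝ) : ℝ≥0 :=
  match l.mother with
  | some y => R.lam u s y
  | none => R.ε u s

/-- The probability that `D` has the value `D'` right after a cluster quake, if it had the value
`D` right before: a new cluster becomes active, an active one dies with probability `p`. -/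
def transition (D D' : Bool) : ℝ≥0 :=
  match D, D' with
  | false, true => 1
  | false, false => 0
  | true, true => 1 - R.p
  | true, false => R.p

/-- The intensity of quakes of each kind with mark `u` at time `s`, given the cluster history `l`
before `s`. -/
def rate (l : ClusterHistory E) (u : E) (s : ℝ) : QuakeKind → ℝ≥0
  | QuakeKind.single => R.γ u s
  | QuakeKind.cluster D' => R.clusterRate l u s * R.transition l.active D'

/-- `a(y, t) = ∫ λ(u, t, y) ν(du)`. -/
noncomputable def a (y : E × ℝ) (t : ℝ) : ℝ := ∫ u, (R.lam u t y : ℝ) ∂ν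

/-- `ε(t) = ∫ ε(u, t) ν(du)`. -/
noncomputable def epsTotal (t : ℝ) : ℝ := ∫ u, (R.ε u t : ℝ) ∂ν

end MotherQuakeRates

/-- The filtration generated by a marked point process with times `T 1 < T 2 < ⋯` and marks
`X 1, X 2, …`: the σ-algebra at time `t` is generated by the events `{T n ≤ s, X n ∈ A}` with
`s ≤ t`. -/
def pointFiltration {Ω M : Type*} [mΩ : MeasurableSpace Ω] [MeasurableSpace M]
    (T : ℕ → Ω → EReal) (X : ℕ → Ω → M) (hT : ∀ n, Measurable (T n))
    (hX : ∀ n, Measurable (X n)) : Filtration ℝ≥0 mΩ where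
  seq t := MeasurableSpace.generateFrom
    {G | ∃ (n : ℕ) (s : ℝ≥0) (A : Set M), 1 ≤ n ∧ s ≤ t ∧ MeasurableSet A ∧
      G = {ω | T n ω ≤ ((s : ℝ) : EReal) ∧ X n ω ∈ A}}
  mono' := by
    intro s t hst
    refine MeasurableSpace.generateFrom_mono ?_
    rintro G ⟨n, r, A, hn, hr, hA, rfl⟩
    exact ⟨n, r, A, hn, hr.trans hst, hA, rfl⟩
  le' := by
    intro t
    refine MeasurableSpace.generateFrom_le ?_
    rintro G ⟨n, r, A, hn, hr, hA, rfl⟩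
    exact (measurableSet_le (hT n) measurable_const).inter (hX n hA)

/-- A marked point process of quakes on `Ω`.  Quake `n ≥ 1` happens at time `T n > 0` (`⊤` if there
are fewer than `n` quakes), has the observable mark `mark n` and the hidden kind `kind n`;
`T 0 = 0` is a convention, and `mark 0`, `kind 0` have no meaning.  The observed point process `O`
consists of all quakes, `N` of the single quakes and `C` of the cluster quakes. -/
structure QuakeProcess (E Ω : Type*) [MeasurableSpace E] [MeasurableSpace Ω] where
  T : ℕ → Ω → EReal
  mark : ℕ → Ω → E
  kind : ℕ → Ω → QuakeKind
  measurable_T : ∀ n, Measurable (T n)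
  measurable_mark : ∀ n, Measurable (mark n)
  measurable_kind : ∀ n, Measurable (kind n)
  T_zero : ∀ ω, T 0 ω = 0
  T_le : ∀ n ω, T n ω ≤ T (n + 1) ω
  T_lt : ∀ n ω, T n ω ≠ ⊤ → T n ω < T (n + 1) ω
  /-- there are finitely many quakes in bounded time intervals -/
  T_unbounded : ∀ ω (t : ℝ), ∃ n, (t : EReal) < T n ω

namespace QuakeProcess

variable {E Ω : Type*} [MeasurableSpace E] [mΩ : MeasurableSpace Ω] (X : QuakeProcess E Ω)

/-- The cluster history after the first `n` quakes. -/
noncomputable def clusterHist (ω : Ω) : ℕ → ClusterHistory E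
  | 0 => []
  | n + 1 =>
    match X.kind (n + 1) ω with
    | QuakeKind.single => clusterHist ω n
    | QuakeKind.cluster D => (X.mark (n + 1) ω, (X.T (n + 1) ω).toReal, D) :: clusterHist ω n

/-- `(h_t, η_t)`: the cluster history at time `t`. -/
noncomputable def hist (t : ℝ) (ω : Ω) : ClusterHistory E :=
  X.clusterHist ω (Set.ncard {n : ℕ | 1 ≤ n ∧ X.T n ω ≤ (t : EReal)})

/-- `(h_{t-}, η_{t-})`: the cluster history just before time `t`. -/
noncomputable def histBefore (t : ℝ) (ω : Ω) : ClusterHistory E :=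
  X.clusterHist ω (Set.ncard {n : ℕ | 1 ≤ n ∧ X.T n ω < (t : EReal)})

/-- The history `ℱ_t` of all quakes and their kinds. -/
def fullFiltration : Filtration ℝ≥0 mΩ :=
  pointFiltration X.T (fun n ω => (X.mark n ω, X.kind n ω)) X.measurable_T
    fun n => (X.measurable_mark n).prodMk (X.measurable_kind n)

/-- The observed history `ℱ^O_t`, generated by the times and marks of all quakes. -/
def obsFiltration : Filtration ℝ≥0 mΩ :=
  pointFiltration X.T X.mark X.measurable_T X.measurable_mark

end QuakeProcess

/-- The law of the mother-quake model, through stochastic intensities with respect to the joint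
history `ℱ` of all quakes and their kinds: single quakes with mark in `du` come at time `s` with
intensity `γ(u, s) ν(du)`, cluster quakes with intensity `λ(u, s, D_{s-}, η_{s-}) ν(du)`, and at a
cluster quake `D` moves by `transition`, independently of the past.  As usual, `rate` is the
intensity if for every predictable `H ≥ 0`, indexed by mark and kind, the expected sum of `H` over
the points is the expected integral of `H * rate`.  (The intensity of `N` given the joint history is
deterministic, so `N` is a Poisson random measure with mean measure `γ(u, s) ν(du) ds`.) -/
def IsMotherQuakeModel {E Ω : Type*} [MeasurableSpace E] [MeasurableSpace Ω] {ν : Measure E}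
    (R : MotherQuakeRates E ν) (P : Measure Ω) (X : QuakeProcess E Ω) : Prop :=
  ∀ H : (ℝ≥0 × Ω) × (E × QuakeKind) → ℝ≥0∞,
    Measurable[X.fullFiltration.predictable.prod inferInstance] H →
    ∫⁻ ω, ∑' n : ℕ, (if X.T (n + 1) ω = ⊤ then 0 else
        H (((X.T (n + 1) ω).toReal.toNNReal, ω), (X.mark (n + 1) ω, X.kind (n + 1) ω))) ∂P
      = ∫⁻ ω, ∫⁻ s in Ioi (0 : ℝ), ∫⁻ u,
          (H ((s.toNNReal, ω), (u, QuakeKind.single))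
              * R.rate (X.histBefore s ω) u s QuakeKind.single
            + H ((s.toNNReal, ω), (u, QuakeKind.cluster true))
              * R.rate (X.histBefore s ω) u s (QuakeKind.cluster true)
            + H ((s.toNNReal, ω), (u, QuakeKind.cluster false))
              * R.rate (X.histBefore s ω) u s (QuakeKind.cluster false)) ∂ν ∂volume ∂P

/-! ### The filter -/

/-- `π` is the filter: `π t` is a regular conditional distribution of `(h_t, η_t)` given the
observations up to time `t`, so that `π(f, t) = ∫ f dπ_t = E[f(h_t, η_t) | ℱ^O_t]`, and its paths
are almost surely right-continuous (which makes it unique up to indistinguishability and gives a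
meaning to its values at the random times `T k`). -/
structure IsMotherQuakeFilter {E Ω : Type*} [MeasurableSpace E] [MeasurableSpace Ω]
    (P : Measure Ω) (X : QuakeProcess E Ω) (π : ℝ → Ω → Measure (ClusterHistory E)) : Prop where
  isProbabilityMeasure : ∀ t, 0 ≤ t → ∀ ω, IsProbabilityMeasure (π t ω)
  adapted : ∀ t : ℝ≥0, Measurable[X.obsFiltration t] (π t)
  condExp_eq : ∀ (t : ℝ≥0) (f : ClusterHistory E → ℝ), Measurable f →
    Integrable (fun ω => f (X.hist t ω)) P →
    (fun ω => ∫ l, f l ∂(π t ω)) =ᵐ[P] P[fun ω => f (X.hist t ω) | X.obsFiltration t]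
  right_continuous : ∀ᵐ ω ∂P, ∀ B : Set (ClusterHistory E), MeasurableSet B → ∀ t : ℝ, 0 ≤ t →
    ContinuousWithinAt (fun s => π s ω B) (Ici t) t

/-! ### The filter equations along one observed path -/

namespace MotherQuakeRates

open ClusterHistory

variable {E : Type*} [MeasurableSpace E] {ν : Measure E} (R : MotherQuakeRates E ν)

/-- `exp (- ∫_r^t (a(y, s) - ε(s)) ds)`. -/
noncomputable def decay (y : E × ℝ) (r t : ℝ) : ℝ :=
  Real.exp (-∫ s in r..t, (R.a y s - R.epsTotal s))

/-- `b_k(t)`, where `r = τ_k`, `y 1, …, y k` are the observations up to `r` and `Φ f = π(f, τ_k)`. -/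
noncomputable def b (y : ℕ → E × ℝ) (k : ℕ) (Φ : (ClusterHistory E → ℝ) → ℝ) (r t : ℝ) : ℝ :=
  1 / (∑ j ∈ Finset.Icc 1 k, Φ (fun l => theta (y j) l * alpha l) * R.decay (y j) r t
    + 1 - ∑ j ∈ Finset.Icc 1 k, Φ (fun l => theta (y j) l * alpha l))

/-- The right-hand side of the differential equation for `π(f, t)`; here `Φ f = π(f, t)`. -/
noncomputable def odeRhs (y : ℕ → E × ℝ) (k : ℕ) (Φ : (ClusterHistory E → ℝ) → ℝ)
    (f : ClusterHistory E → ℝ) (t : ℝ) : ℝ :=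
  -∑ i ∈ Finset.Icc 1 k, Φ (fun l => theta (y i) l * alpha l * f l) * (R.a (y i) t - R.epsTotal t)
    + Φ f * ∑ i ∈ Finset.Icc 1 k,
        Φ (fun l => theta (y i) l * alpha l) * (R.a (y i) t - R.epsTotal t)

/-- `d_{k+1}`, where `Φ f = π(f, τ_{k+1}-)`. -/
noncomputable def d (y : ℕ → E × ℝ) (k : ℕ) (Φ : (ClusterHistory E → ℝ) → ℝ) : ℝ :=
  ∑ j ∈ Finset.Icc 1 k, ((R.lam (y (k + 1)).1 (y (k + 1)).2 (y j) : ℝ)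
      - R.ε (y (k + 1)).1 (y (k + 1)).2) * Φ (fun l => theta (y j) l * alpha l)
    + R.ε (y (k + 1)).1 (y (k + 1)).2 + R.γ (y (k + 1)).1 (y (k + 1)).2

/-- The equations between two observations: `y 1, …, y k` are the observations so far,
`r = τ_k`, `r' = τ_{k+1}` (possibly `⊤`), and `V t f` stands for `π(f, t)`. -/
structure EvolutionEquations (y : ℕ → E × ℝ) (k : ℕ) (r : ℝ) (r' : EReal)
    (V : ℝ → (ClusterHistory E → ℝ) → ℝ) (f : ClusterHistory E → ℝ) : Prop where
  /-- `π(θ₀(y_i) α f, t)` evolves by the explicit factor. -/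
  cluster_eq : ∀ t : ℝ, r ≤ t → (t : EReal) < r' → ∀ i ∈ Finset.Icc 1 k,
    V t (fun l => theta (y i) l * alpha l * f l)
      = V r (fun l => theta (y i) l * alpha l * f l) * R.decay (y i) r t * R.b y k (V r) r t
  /-- The differential equation for `π(f, t)` in integrated form. -/
  ode_integrable : ∀ t : ℝ, r ≤ t → (t : EReal) < r' →
    IntervalIntegrable (fun s => R.odeRhs y k (V s) f s) volume r t
  ode_integral : ∀ t : ℝ, r ≤ t → (t : EReal) < r' →
    V t f = V r f + ∫ s in r..t, R.odeRhs y k (V s) f s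
  /-- It holds in differential form at almost every time. -/
  ode_ae : ∀ᵐ t : ℝ, r < t → (t : EReal) < r' →
    HasDerivAt (fun s => V s f) (R.odeRhs y k (V t) f t) t
  /-- It holds in differential form wherever its coefficients are continuous (at `τ_k`: from the
  right). -/
  ode_of_continuous : ∀ t : ℝ, r ≤ t → (t : EReal) < r' →
    (∀ i ∈ Finset.Icc 1 k, ContinuousWithinAt (R.a (y i)) (Ici r) t) →
    ContinuousWithinAt R.epsTotal (Ici r) t →
    HasDerivWithinAt (fun s => V s f) (R.odeRhs y k (V t) f t) (Ici r) t

/-- The equations at the observation `y (k + 1)`: `Φ f` is `π(f, τ_{k+1}-)`, `Ψ f` is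
`π(f, τ_{k+1})`.  Prolonging the history by `(u, s, true)` or `(u, s, false)`, where
`(u, s) = y (k + 1)`, gives `f(1, · + δ_{y_{k+1}})` and `f(0, · + δ_{y_{k+1}})`. -/
structure JumpEquations (y : ℕ → E × ℝ) (k : ℕ) (Φ Ψ : (ClusterHistory E → ℝ) → ℝ)
    (f : ClusterHistory E → ℝ) : Prop where
  old_mother : ∀ i ∈ Finset.Icc 1 k,
    Ψ (fun l => theta (y i) l * alpha l * f l)
      = (Φ (fun l => theta (y i) l * alpha l * f l) * R.γ (y (k + 1)).1 (y (k + 1)).2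
          + (1 - R.p) * R.lam (y (k + 1)).1 (y (k + 1)).2 (y i)
            * Φ (fun l => f (((y (k + 1)).1, (y (k + 1)).2, true) :: l)
                * (theta (y i) l * alpha l))) / R.d y k Φ
  new_mother :
    Ψ (fun l => theta (y (k + 1)) l * alpha l * f l)
      = Φ (fun l => f (((y (k + 1)).1, (y (k + 1)).2, true) :: l) * (1 - alpha l))
          * R.ε (y (k + 1)).1 (y (k + 1)).2 / R.d y k Φ
  total :
    Ψ f = (Φ f * R.γ (y (k + 1)).1 (y (k + 1)).2
          + Φ (fun l => f (((y (k + 1)).1, (y (k + 1)).2, true) :: l) * (1 - alpha l))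
            * R.ε (y (k + 1)).1 (y (k + 1)).2) / R.d y k Φ
        + (∑ j ∈ Finset.Icc 1 k, R.lam (y (k + 1)).1 (y (k + 1)).2 (y j)
            * Φ (fun l => (R.p * f (((y (k + 1)).1, (y (k + 1)).2, false) :: l)
                + (1 - R.p) * f (((y (k + 1)).1, (y (k + 1)).2, true) :: l))
                * (theta (y j) l * alpha l))) / R.d y k Φ

/-- All filter equations along an observed path with times `T k` and marks `u k`:
`V t f` stands for `π(f, t)`. -/
structure FilterEquations (T : ℕ → EReal) (u : ℕ → E)
    (V : ℝ → (ClusterHistory E → ℝ) → ℝ) : Prop where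
  /-- No cluster quake has happened at time `0`. -/
  initial : ∀ f, V 0 f = f []
  evolution : ∀ (k : ℕ) (r : ℝ), T k = r → ∀ f,
    R.EvolutionEquations (fun i => (u i, (T i).toReal)) k r (T (k + 1)) V f
  /-- The left limits `π(f, τ_{k+1}-)` exist, `d_{k+1}` is positive, and the jump equations hold. -/
  jump : ∀ (k : ℕ) (r : ℝ), T (k + 1) = r →
    ∃ Φ : (ClusterHistory E → ℝ) → ℝ,
      (∀ f, Tendsto (fun t => V t f) (𝓝[<] r) (𝓝 (Φ f))) ∧
      0 < R.d (fun i => (u i, (T i).toReal)) k Φ ∧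
      ∀ f, R.JumpEquations (fun i => (u i, (T i).toReal)) k Φ (V r) f

end MotherQuakeRates

/-! ### Measurability of lists -/

section ListMeasurable

variable {X : Type*} [MeasurableSpace X]

/-- A list as its length together with an infinite sequence that extends it. -/
def listCode (x₀ : X) (l : List X) : ℕ × (ℕ → X) := (l.length, fun i => l.getD i x₀)

lemma measurable_equivSigmaTuple : Measurable (List.equivSigmaTuple (α := X)) :=
  comap_measurable _

lemma measurableSet_sigma {ι : Type*} {β : ι → Type*} [∀ i, MeasurableSpace (β i)]
    {S : Set (Sigma β)} (h : ∀ i, MeasurableSet (Sigma.mk i ⁻¹' S)) : MeasurableSet S := by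
  change MeasurableSet[⨅ a, _] S
  rw [MeasurableSpace.measurableSet_iInf]
  exact h

lemma measurable_sigmaMk' {ι : Type*} {β : ι → Type*} [∀ i, MeasurableSpace (β i)] (i : ι) :
    Measurable (Sigma.mk i : β i → Sigma β) := by
  intro S hS
  change MeasurableSet[⨅ a, _] S at hS
  rw [MeasurableSpace.measurableSet_iInf] at hS
  exact hS i

lemma measurable_listCode (x₀ : X) : Measurable (listCode x₀) := by
  refine Measurable.prodMk ?_ (measurable_pi_iff.2 fun i => ?_)
  · have : Measurable (fun q : Σ n, Fin n → X => q.1) := fun S _ =>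
      measurableSet_sigma fun i => by
        by_cases h : i ∈ S <;> simp [Set.preimage, h]
    exact this.comp measurable_equivSigmaTuple
  · have : Measurable (fun q : Σ n, Fin n → X => if h : i < q.1 then q.2 ⟨i, h⟩ else x₀) := by
      intro S hS
      refine measurableSet_sigma fun n => ?_
      have : Measurable fun f : Fin n → X => if h : i < n then f ⟨i, h⟩ else x₀ := by
        by_cases h : i < n
        · simpa [h] using measurable_pi_apply _
        · simp [h]
      exact this hS
    convert this.comp measurable_equivSigmaTuple using 1
    funext l
    by_cases h : i < l.length
    · simp [List.equivSigmaTuple, h]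
    · simp [List.equivSigmaTuple, h]

lemma listMeasurableSpace_eq_comap (x₀ : X) :
    (listMeasurableSpace : MeasurableSpace (List X)) =
      MeasurableSpace.comap (listCode x₀) inferInstance := by
  refine le_antisymm ?_ (measurable_listCode x₀).comap_le
  rintro _ ⟨S, hS, rfl⟩
  refine ⟨{q | (⟨q.1, fun i => q.2 i⟩ : Σ n, Fin n → X) ∈ S}, ?_, ?_⟩
  · have : Measurable fun q : ℕ × (ℕ → X) => (⟨q.1, fun i => q.2 i⟩ : Σ n, Fin n → X) := by
      refine measurable_from_prod_countable_right fun n => ?_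
      exact (measurable_sigmaMk' (β := fun n => Fin n → X) n).comp (by fun_prop)
    exact this hS
  · ext l
    have : (⟨l.length, fun i : Fin l.length => l.getD i x₀⟩ : Σ n, Fin n → X)
        = List.equivSigmaTuple l := by
      simp only [List.equivSigmaTuple, Equiv.coe_fn_mk]
      congr 1
      funext i
      simp
    change (⟨l.length, fun i : Fin l.length => l.getD i x₀⟩ : Σ n, Fin n → X) ∈ S ↔ _
    rw [this]; rfl

lemma measurable_list_cons : Measurable fun q : X × List X => q.1 :: q.2 := by
  rcases isEmpty_or_nonempty X with h | ⟨⟨x₀⟩⟩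
  · exact measurable_of_empty _
  · rw [listMeasurableSpace_eq_comap x₀, measurable_comap_iff, ← listMeasurableSpace_eq_comap x₀]
    have hc := measurable_listCode x₀
    refine Measurable.prodMk ?_ (measurable_pi_iff.2 fun i => ?_)
    · have : Measurable fun l : List X => l.length := hc.fst
      exact (measurable_from_top (f := fun n : ℕ => n + 1)).comp (this.comp measurable_snd)
    · cases i with
      | zero => simpa using measurable_fst
      | succ i => exact ((measurable_pi_iff.1 hc.snd) i).comp measurable_snd

lemma Measurable.list_cons {α : Type*} [MeasurableSpace α] {f : α → X} {g : α → List X}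
    (hf : Measurable f) (hg : Measurable g) : Measurable fun a => f a :: g a :=
  measurable_list_cons.comp (hf.prodMk hg)

instance List.instMeasurableSingletonClass [MeasurableSingletonClass X] :
    MeasurableSingletonClass (List X) where
  measurableSet_singleton l := by
    refine ⟨{List.equivSigmaTuple l}, measurableSet_sigma fun n => ?_, ?_⟩
    · refine Set.Subsingleton.measurableSet ?_
      intro f hf g hg
      have := hf.trans hg.symm
      simpa using this
    · ext m
      simp

instance List.instCountablyGenerated [StandardBorelSpace X] :
    MeasurableSpace.CountablyGenerated (List X) := by
  rcases isEmpty_or_nonempty X with h | ⟨⟨x₀⟩⟩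
  · infer_instance
  · rw [listMeasurableSpace_eq_comap x₀]
    exact MeasurableSpace.CountablyGenerated.comap _

end ListMeasurable

/-! ### Absolutely continuous functions -/

section AbsolutelyContinuous

lemma AbsolutelyContinuousOnInterval.lipschitzOnWith_comp {f Φ : ℝ → ℝ} {a b : ℝ} {s : Set ℝ}
    {K : ℝ≥0} (hf : AbsolutelyContinuousOnInterval f a b) (hΦ : LipschitzOnWith K Φ s)
    (hs : MapsTo f (uIcc a b) s) : AbsolutelyContinuousOnInterval (fun x => Φ (f x)) a b := by
  rw [absolutelyContinuousOnInterval_iff] at hf ⊢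
  intro ε hε
  obtain ⟨δ, hδ, h⟩ := hf (ε / (K + 1)) (by positivity)
  refine ⟨δ, hδ, fun I hI hI' => ?_⟩
  have hsum := h I hI hI'
  calc
    _ ≤ ∑ i ∈ Finset.range I.1, K * dist (f (I.2 i).1) (f (I.2 i).2) := by
      refine Finset.sum_le_sum fun i hi => ?_
      have := hI.1 i hi
      exact hΦ.dist_le_mul _ (hs this.1) _ (hs this.2)
    _ = K * ∑ i ∈ Finset.range I.1, dist (f (I.2 i).1) (f (I.2 i).2) := by
      rw [Finset.mul_sum]
    _ ≤ K * (ε / (K + 1)) := by gcongr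
    _ < ε := by
      rw [mul_div_assoc', div_lt_iff₀ (by positivity)]
      nlinarith

lemma AbsolutelyContinuousOnInterval.contDiffOn_comp {f Φ : ℝ → ℝ} {a b c d : ℝ}
    (hf : AbsolutelyContinuousOnInterval f a b) (hΦ : ContDiffOn ℝ 1 Φ (Icc c d))
    (hs : MapsTo f (uIcc a b) (Icc c d)) :
    AbsolutelyContinuousOnInterval (fun x => Φ (f x)) a b := by
  obtain ⟨K, hK⟩ := hΦ.exists_lipschitzOnWith (by decide) (convex_Icc _ _) isCompact_Icc
  exact hf.lipschitzOnWith_comp hK hs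

lemma AbsolutelyContinuousOnInterval.exp {f : ℝ → ℝ} {a b : ℝ}
    (hf : AbsolutelyContinuousOnInterval f a b) :
    AbsolutelyContinuousOnInterval (fun x => Real.exp (f x)) a b := by
  obtain ⟨C, hC⟩ := hf.exists_bound
  exact hf.contDiffOn_comp (c := -C) (d := C) Real.contDiff_exp.contDiffOn
    fun x hx => abs_le.1 (hC x hx)

lemma AbsolutelyContinuousOnInterval.inv {f : ℝ → ℝ} {a b : ℝ}
    (hf : AbsolutelyContinuousOnInterval f a b) (hpos : ∀ x ∈ uIcc a b, 0 < f x) :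
    AbsolutelyContinuousOnInterval (fun x => (f x)⁻¹) a b := by
  obtain ⟨C, hC⟩ := hf.exists_bound
  obtain ⟨x₀, hx₀, hmin⟩ := isCompact_uIcc.exists_isMinOn nonempty_uIcc hf.continuousOn
  refine hf.contDiffOn_comp (c := f x₀) (d := C) (contDiffOn_id.inv fun x hx => ?_)
    fun x hx => ⟨hmin hx, (abs_le.1 (hC x hx)).2⟩
  exact ((hpos x₀ hx₀).trans_le hx.1).ne'

lemma AbsolutelyContinuousOnInterval.integral_eq_sub_of_ae_hasDerivAt {f g : ℝ → ℝ} {a b : ℝ}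
    (hf : AbsolutelyContinuousOnInterval f a b)
    (hg : ∀ᵐ x, x ∈ uIcc a b → HasDerivAt f (g x) x) :
    IntervalIntegrable g volume a b ∧ ∫ x in a..b, g x = f b - f a := by
  have hae : ∀ᵐ x, x ∈ uIoc a b → deriv f x = g x := by
    filter_upwards [hg] with x hx h
    exact (hx (uIoc_subset_uIcc h)).deriv
  refine ⟨hf.intervalIntegrable_deriv.congr_ae ?_, ?_⟩
  · exact (ae_restrict_iff' measurableSet_uIoc).2 hae
  · rw [← hf.integral_deriv_eq_sub]
    exact intervalIntegral.integral_congr_ae (hae.mono fun x hx h => (hx h).symm)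

/-- If `A` is the indefinite integral of `Λ ≥ 0`, then `1 + ∫ exp(A) Λ = exp(A)`. -/
lemma lintegral_exp_mul_add_one {Λ : ℝ → ℝ≥0∞} (hΛ : Measurable Λ) {r t : ℝ} (hrt : r ≤ t)
    (hfin : ∫⁻ s in Ioc r t, Λ s ≠ ∞) :
    (∫⁻ s in Ioc r t, ENNReal.ofReal (Real.exp (∫⁻ x in Ioc r s, Λ x).toReal) * Λ s) + 1
      = ENNReal.ofReal (Real.exp (∫⁻ x in Ioc r t, Λ x).toReal) := by
  set g : ℝ → ℝ := fun s => (Λ s).toReal with hg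
  have hgm : Measurable g := hΛ.ennreal_toReal
  have hΛae : ∀ᵐ s ∂volume.restrict (Ioc r t), Λ s < ∞ := ae_lt_top hΛ hfin
  have hgi : IntervalIntegrable g volume r t := by
    rw [intervalIntegrable_iff_integrableOn_Ioc_of_le hrt]
    exact integrable_toReal_of_lintegral_ne_top hΛ.aemeasurable hfin
  have hA : ∀ s ∈ Icc r t, (∫⁻ x in Ioc r s, Λ x).toReal = ∫ x in r..s, g x := by
    intro s hs
    rw [intervalIntegral.integral_of_le hs.1, integral_toReal hΛ.aemeasurable]
    exact ae_restrict_of_ae_restrict_of_subset (Ioc_subset_Ioc_right hs.2) hΛae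
  have hac := (hgi.absolutelyContinuousOnInterval_intervalIntegral (c := r) left_mem_uIcc).exp
  have hder : ∀ᵐ x, x ∈ uIcc r t →
      HasDerivAt (fun x => Real.exp (∫ v in r..x, g v)) (Real.exp (∫ v in r..x, g v) * g x) x := by
    filter_upwards [hgi.ae_hasDerivAt_integral] with x hx h
    exact (hx h r left_mem_uIcc).exp
  obtain ⟨hint, hval⟩ := hac.integral_eq_sub_of_ae_hasDerivAt hder
  have hval' : ENNReal.ofReal (∫ x in r..t, Real.exp (∫ v in r..x, g v) * g x)
      = ∫⁻ s in Ioc r t, ENNReal.ofReal (Real.exp (∫⁻ x in Ioc r s, Λ x).toReal) * Λ s := by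
    rw [intervalIntegral.integral_of_le hrt, ofReal_integral_eq_lintegral_ofReal]
    · refine lintegral_congr_ae ?_
      filter_upwards [hΛae, ae_restrict_mem measurableSet_Ioc] with s hs hs'
      rw [ENNReal.ofReal_mul (Real.exp_nonneg _), hA s (Ioc_subset_Icc_self hs'), hg,
        ENNReal.ofReal_toReal hs.ne]
    · exact (intervalIntegrable_iff_integrableOn_Ioc_of_le hrt).1 hint
    · exact ae_of_all _ fun s => mul_nonneg (Real.exp_nonneg _) ENNReal.toReal_nonneg
  rw [← hval', hval, hA t ⟨hrt, le_rfl⟩, intervalIntegral.integral_same, Real.exp_zero,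
    ← ENNReal.ofReal_one, ← ENNReal.ofReal_add _ zero_le_one]
  · simp
  · rw [sub_nonneg, ← Real.exp_zero, Real.exp_le_exp]
    exact intervalIntegral.integral_nonneg hrt fun _ _ => ENNReal.toReal_nonneg

end AbsolutelyContinuous

/-! ### Histories from observed paths and hidden kinds -/

section Kinds

noncomputable instance : DecidableEq QuakeKind := Classical.decEq _

noncomputable instance : Fintype QuakeKind where
  elems := {QuakeKind.single, QuakeKind.cluster true, QuakeKind.cluster false}
  complete k := by rcases k with _ | (_ | _) <;> simp

instance : DiscreteMeasurableSpace QuakeKind := ⟨fun _ => trivial⟩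

lemma QuakeKind.sum_eq {V : Type*} [AddCommMonoid V] (F : QuakeKind → V) :
    ∑ k, F k = F QuakeKind.single + F (QuakeKind.cluster true) + F (QuakeKind.cluster false) := by
  change ∑ k ∈ {QuakeKind.single, QuakeKind.cluster true, QuakeKind.cluster false}, F k = _
  rw [Finset.sum_insert (by simp), Finset.sum_insert (by simp), Finset.sum_singleton, add_assoc]

/-- The possible sequences of kinds of the first `n` quakes, most recent quake first. -/
noncomputable def kindStrings : ℕ → Finset (List QuakeKind)
  | 0 => {[]}
  | n + 1 => (kindStrings n ×ˢ Finset.univ).map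
      ⟨fun q : List QuakeKind × QuakeKind => q.2 :: q.1, by rintro ⟨a, b⟩ ⟨c, d⟩ h; simp_all⟩

lemma mem_kindStrings {n : ℕ} {κ : List QuakeKind} : κ ∈ kindStrings n ↔ κ.length = n := by
  induction n generalizing κ with
  | zero => simp [kindStrings]
  | succ n ih =>
    cases κ with
    | nil => simp [kindStrings]
    | cons k κ =>
      simp only [kindStrings, Finset.mem_map, Finset.mem_product, ih, Finset.mem_univ, and_true,
        Prod.exists, List.length_cons, Nat.add_right_cancel_iff]
      exact ⟨by rintro ⟨a, b, h, h'⟩; cases h'; exact h, fun h => ⟨κ, k, h, rfl⟩⟩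

lemma sum_kindStrings_zero {V : Type*} [AddCommMonoid V] (F : List QuakeKind → V) :
    ∑ κ ∈ kindStrings 0, F κ = F [] := by simp [kindStrings]

lemma sum_kindStrings_succ {V : Type*} [AddCommMonoid V] (n : ℕ) (F : List QuakeKind → V) :
    ∑ κ ∈ kindStrings (n + 1), F κ = ∑ κ ∈ kindStrings n, ∑ k, F (k :: κ) := by
  rw [kindStrings, Finset.sum_map, Finset.sum_product]
  rfl

end Kinds

namespace ClusterHistory

variable {E : Type*}

lemma isSome_mother (l : ClusterHistory E) : (mother l).isSome = active l := by
  induction l with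
  | nil => rfl
  | cons x l ih =>
    obtain ⟨v, s, d⟩ := x
    cases d
    · rfl
    · cases h : active l
      · rw [mother, if_pos rfl, h]; rfl
      · rw [mother, if_pos rfl, if_pos h, ih, h]; rfl

/-- The cluster history of quakes with marks and times `y 1, y 2, …` and the given kinds. -/
def ofKinds (y : ℕ → E × ℝ) : List QuakeKind → ClusterHistory E
  | [] => []
  | QuakeKind.single :: κ => ofKinds y κ
  | QuakeKind.cluster D :: κ => ((y (κ.length + 1)).1, (y (κ.length + 1)).2, D) :: ofKinds y κ

/-- The number of the mother quake of the currently active cluster. -/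
def motherIdx : List QuakeKind → Option ℕ
  | [] => none
  | QuakeKind.single :: κ => motherIdx κ
  | QuakeKind.cluster false :: _ => none
  | QuakeKind.cluster true :: κ => some ((motherIdx κ).getD (κ.length + 1))

lemma mother_ofKinds (y : ℕ → E × ℝ) (κ : List QuakeKind) :
    mother (ofKinds y κ) = (motherIdx κ).map y := by
  induction κ with
  | nil => rfl
  | cons k κ ih =>
    rcases k with _ | (_ | _)
    · exact ih
    · rfl
    · have h := isSome_mother (ofKinds y κ)
      rw [ih] at h
      cases hm : motherIdx κ with
      | none =>
        have h' : active (ofKinds y κ) = false := by simpa [hm] using h.symm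
        simp [ofKinds, mother, motherIdx, h', hm]
      | some i =>
        have h' : active (ofKinds y κ) = true := by simpa [hm] using h.symm
        simp [ofKinds, mother, motherIdx, h', hm, ih]

lemma active_ofKinds (y : ℕ → E × ℝ) (κ : List QuakeKind) :
    active (ofKinds y κ) = (motherIdx κ).isSome := by
  rw [← isSome_mother, mother_ofKinds, Option.isSome_map]

lemma motherIdx_mem {κ : List QuakeKind} {i : ℕ} (h : motherIdx κ = some i) :
    i ∈ Finset.Icc 1 κ.length := by
  induction κ generalizing i with
  | nil => simp [motherIdx] at h
  | cons k κ ih =>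
    rcases k with _ | (_ | _)
    · have := Finset.mem_Icc.1 (ih h)
      simp; lia
    · simp [motherIdx] at h
    · cases hm : motherIdx κ with
      | none => simp [motherIdx, hm] at h; simp; lia
      | some j =>
        have := Finset.mem_Icc.1 (ih hm)
        simp [motherIdx, hm] at h; simp; lia

/-- Two observed paths that cannot be distinguished by their first `n` quakes. -/
def AgreeUpTo (n : ℕ) (y y' : ℕ → E × ℝ) : Prop :=
  (y 0).2 = (y' 0).2 ∧ ∀ i, 1 ≤ i → i ≤ n → y i = y' i

lemma AgreeUpTo.mono {m n : ℕ} {y y' : ℕ → E × ℝ} (h : AgreeUpTo n y y') (hmn : m ≤ n) :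
    AgreeUpTo m y y' := ⟨h.1, fun i hi him => h.2 i hi (him.trans hmn)⟩

lemma AgreeUpTo.time_eq {n i : ℕ} {y y' : ℕ → E × ℝ} (h : AgreeUpTo n y y') (hi : i ≤ n) :
    (y i).2 = (y' i).2 := by
  rcases Nat.eq_zero_or_pos i with rfl | h0
  · exact h.1
  · rw [h.2 i h0 hi]

lemma agreeUpTo_update (n : ℕ) (y : ℕ → E × ℝ) (x : E × ℝ) :
    AgreeUpTo n (Function.update y (n + 1) x) y := by
  refine ⟨by simp, fun i _ hi => ?_⟩
  rw [Function.update_of_ne (by lia)]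

lemma ofKinds_congr {κ : List QuakeKind} {y y' : ℕ → E × ℝ}
    (h : AgreeUpTo κ.length y y') : ofKinds y κ = ofKinds y' κ := by
  induction κ with
  | nil => rfl
  | cons k κ ih =>
    have ih' := ih (h.mono (by simp))
    cases k with
    | single => exact ih'
    | cluster D => simp [ofKinds, ih', h.2 (κ.length + 1) (by lia) (by simp)]

/-- The times of the first `n` quakes are positive and increase. -/
def IncreasingUpTo (n : ℕ) (y : ℕ → E × ℝ) : Prop :=
  (y 0).2 = 0 ∧ ∀ i < n, (y i).2 < (y (i + 1)).2

lemma IncreasingUpTo.mono {m n : ℕ} {y : ℕ → E × ℝ} (h : IncreasingUpTo n y) (hmn : m ≤ n) :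
    IncreasingUpTo m y := ⟨h.1, fun i hi => h.2 i (hi.trans_le hmn)⟩

lemma IncreasingUpTo.lt {n i j : ℕ} {y : ℕ → E × ℝ} (h : IncreasingUpTo n y) (hij : i < j)
    (hj : j ≤ n) : (y i).2 < (y j).2 := by
  induction j, hij using Nat.le_induction with
  | base => exact h.2 i hj
  | succ j hij ih => exact (ih (by lia)).trans (h.2 j hj)

lemma IncreasingUpTo.le {n i j : ℕ} {y : ℕ → E × ℝ} (h : IncreasingUpTo n y) (hij : i ≤ j)
    (hj : j ≤ n) : (y i).2 ≤ (y j).2 := by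
  rcases hij.eq_or_lt with rfl | hij
  · rfl
  · exact (h.lt hij hj).le

lemma IncreasingUpTo.nonneg {n i : ℕ} {y : ℕ → E × ℝ} (h : IncreasingUpTo n y) (hi : i ≤ n) :
    0 ≤ (y i).2 := h.1 ▸ h.le (Nat.zero_le i) hi

lemma IncreasingUpTo.congr {n : ℕ} {y y' : ℕ → E × ℝ} (h : IncreasingUpTo n y)
    (hy : AgreeUpTo n y y') : IncreasingUpTo n y' :=
  ⟨hy.1 ▸ h.1, fun i hi => by
    rw [← hy.time_eq hi.le, ← hy.time_eq (Nat.succ_le_of_lt hi)]; exact h.2 i hi⟩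

lemma measurable_ofKinds [MeasurableSpace E] (κ : List QuakeKind) :
    Measurable fun y : ℕ → E × ℝ => ofKinds y κ := by
  induction κ with
  | nil => exact measurable_const
  | cons k κ ih =>
    cases k with
    | single => exact ih
    | cluster D => exact Measurable.list_cons (by fun_prop) ih

end ClusterHistory

namespace MotherQuakeRates

open ClusterHistory

variable {E : Type*} [MeasurableSpace E] {ν : Measure E} (R : MotherQuakeRates E ν)

lemma sum_rate (l : ClusterHistory E) (u : E) (s : ℝ) :
    ∑ k, R.rate l u s k = R.γ u s + R.clusterRate l u s := by
  rw [QuakeKind.sum_eq]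
  simp only [rate]
  rw [add_assoc, ← mul_add]
  have : R.transition (active l) true + R.transition (active l) false = 1 := by
    cases active l
    · simp [transition]
    · exact tsub_add_cancel_of_le R.p_le_one
  rw [this, mul_one]

lemma clusterRate_ofKinds (y : ℕ → E × ℝ) (κ : List QuakeKind) (u : E) (s : ℝ) :
    R.clusterRate (ofKinds y κ) u s =
      match motherIdx κ with
      | some i => R.lam u s (y i)
      | none => R.ε u s := by
  unfold clusterRate
  rw [mother_ofKinds]
  cases motherIdx κ <;> rfl

lemma measurable_clusterRate (κ : List QuakeKind) :
    Measurable fun x : (ℕ → E × ℝ) × E × ℝ => R.clusterRate (ofKinds x.1 κ) x.2.1 x.2.2 := by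
  simp only [clusterRate_ofKinds]
  cases motherIdx κ with
  | none => exact R.measurable_ε.comp measurable_snd
  | some i =>
    exact R.measurable_lam.comp
      (f := fun x : (ℕ → E × ℝ) × E × ℝ => (x.2.1, x.2.2, x.1 i)) (by fun_prop)

lemma measurable_rate (κ : List QuakeKind) (k : QuakeKind) :
    Measurable fun x : (ℕ → E × ℝ) × E × ℝ => R.rate (ofKinds x.1 κ) x.2.1 x.2.2 k := by
  cases k with
  | single => exact R.measurable_γ.comp measurable_snd
  | cluster D =>
    simp only [rate, active_ofKinds]
    exact (R.measurable_clusterRate κ).mul_const _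

/-- The total intensity of quakes given the kinds of the previous quakes. -/
noncomputable def totalRate (y : ℕ → E × ℝ) (κ : List QuakeKind) (s : ℝ) : ℝ≥0∞ :=
  ∫⁻ u, ∑ k, (R.rate (ofKinds y κ) u s k : ℝ≥0∞) ∂ν

/-- The integral of the total intensity from the last quake to time `t`. -/
noncomputable def cumRate (y : ℕ → E × ℝ) (κ : List QuakeKind) (t : ℝ) : ℝ≥0∞ :=
  ∫⁻ s in Ioc (y κ.length).2 t, R.totalRate y κ s

/-- The probability that no quake occurs from the last quake to time `t`. -/
noncomputable def survival (y : ℕ → E × ℝ) (κ : List QuakeKind) (t : ℝ) : ℝ≥0 :=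
  (Real.exp (-(R.cumRate y κ t).toReal)).toNNReal

/-- The unnormalized conditional probability of the kinds `κ` given the observations `y`. -/
noncomputable def weight (y : ℕ → E × ℝ) : List QuakeKind → ℝ≥0
  | [] => 1
  | k :: κ => weight y κ * (R.survival y κ (y (κ.length + 1)).2
      * R.rate (ofKinds y κ) (y (κ.length + 1)).1 (y (κ.length + 1)).2 k)

lemma survival_pos (y : ℕ → E × ℝ) (κ : List QuakeKind) (t : ℝ) : 0 < R.survival y κ t :=
  Real.toNNReal_pos.2 (Real.exp_pos _)

lemma coe_survival (y : ℕ → E × ℝ) (κ : List QuakeKind) (t : ℝ) :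
    (R.survival y κ t : ℝ) = Real.exp (-(R.cumRate y κ t).toReal) :=
  Real.coe_toNNReal _ (Real.exp_nonneg _)

lemma coe_survival_mul_exp (y : ℕ → E × ℝ) (κ : List QuakeKind) (t : ℝ) :
    (R.survival y κ t : ℝ≥0∞) * ENNReal.ofReal (Real.exp (R.cumRate y κ t).toReal) = 1 := by
  change ENNReal.ofReal _ * _ = _
  rw [← ENNReal.ofReal_mul (Real.exp_nonneg _), ← Real.exp_add]
  simp

lemma totalRate_eq [SFinite ν] (y : ℕ → E × ℝ) (κ : List QuakeKind) (s : ℝ) :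
    R.totalRate y κ s
      = ∫⁻ u, (R.γ u s : ℝ≥0∞) ∂ν + ∫⁻ u, (R.clusterRate (ofKinds y κ) u s : ℝ≥0∞) ∂ν := by
  unfold totalRate
  rw [← lintegral_add_left]
  · refine lintegral_congr fun u => ?_
    exact_mod_cast R.sum_rate (ofKinds y κ) u s
  · exact (R.measurable_γ.comp (f := fun u => (u, s)) (by fun_prop)).coe_nnreal_ennreal

lemma totalRate_congr {κ : List QuakeKind} {y y' : ℕ → E × ℝ} (h : AgreeUpTo κ.length y y')
    (s : ℝ) : R.totalRate y κ s = R.totalRate y' κ s := by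
  simp only [totalRate, ofKinds_congr h]

lemma cumRate_congr {κ : List QuakeKind} {y y' : ℕ → E × ℝ} (h : AgreeUpTo κ.length y y')
    (t : ℝ) : R.cumRate y κ t = R.cumRate y' κ t := by
  simp only [cumRate, R.totalRate_congr h, h.time_eq le_rfl]

lemma survival_congr {κ : List QuakeKind} {y y' : ℕ → E × ℝ} (h : AgreeUpTo κ.length y y')
    (t : ℝ) : R.survival y κ t = R.survival y' κ t := by
  simp only [survival, R.cumRate_congr h]

lemma weight_congr {κ : List QuakeKind} {y y' : ℕ → E × ℝ} (h : AgreeUpTo κ.length y y') :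
    R.weight y κ = R.weight y' κ := by
  induction κ with
  | nil => rfl
  | cons k κ ih =>
    have h' : AgreeUpTo κ.length y y' := h.mono (by simp)
    simp only [weight, ih h', R.survival_congr h', ofKinds_congr h',
      h.2 (κ.length + 1) (by lia) (by simp)]

lemma weight_update (k : QuakeKind) (κ : List QuakeKind) (y : ℕ → E × ℝ) (x : E × ℝ) :
    R.weight (Function.update y (κ.length + 1) x) (k :: κ)
      = R.weight y κ * (R.survival y κ x.2 * R.rate (ofKinds y κ) x.1 x.2 k) := by
  have h := agreeUpTo_update κ.length y x
  simp [weight, R.weight_congr h, R.survival_congr h, ofKinds_congr h]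

lemma measurable_totalRate [SFinite ν] (κ : List QuakeKind) :
    Measurable fun x : (ℕ → E × ℝ) × ℝ => R.totalRate x.1 κ x.2 := by
  unfold totalRate
  refine Measurable.lintegral_prod_right'
    (f := fun z : ((ℕ → E × ℝ) × ℝ) × E =>
      ∑ k, (R.rate (ofKinds z.1.1 κ) z.2 z.1.2 k : ℝ≥0∞)) ?_
  refine Finset.measurable_sum _ fun k _ => ?_
  exact ((R.measurable_rate κ k).comp
    (f := fun z : ((ℕ → E × ℝ) × ℝ) × E => (z.1.1, z.2, z.1.2)) (by fun_prop)).coe_nnreal_ennreal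

lemma measurable_cumRate [SFinite ν] (κ : List QuakeKind) :
    Measurable fun x : (ℕ → E × ℝ) × ℝ => R.cumRate x.1 κ x.2 := by
  have : (fun x : (ℕ → E × ℝ) × ℝ => R.cumRate x.1 κ x.2) = fun x => ∫⁻ s,
      {z : ((ℕ → E × ℝ) × ℝ) × ℝ | (z.1.1 κ.length).2 < z.2 ∧ z.2 ≤ z.1.2}.indicator
        (fun z => R.totalRate z.1.1 κ z.2) (x, s) := by
    funext x
    rw [cumRate, ← lintegral_indicator measurableSet_Ioc]
    rfl
  rw [this]
  refine Measurable.lintegral_prod_right' (Measurable.indicator ?_ ?_)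
  · exact (R.measurable_totalRate κ).comp
      (f := fun z : ((ℕ → E × ℝ) × ℝ) × ℝ => (z.1.1, z.2)) (by fun_prop)
  · have h₁ : Measurable fun z : ((ℕ → E × ℝ) × ℝ) × ℝ => (z.1.1 κ.length).2 := by fun_prop
    have h₂ : Measurable fun z : ((ℕ → E × ℝ) × ℝ) × ℝ => z.1.2 := by fun_prop
    exact (measurableSet_lt h₁ measurable_snd).inter (measurableSet_le measurable_snd h₂)

lemma measurable_survival [SFinite ν] (κ : List QuakeKind) :
    Measurable fun x : (ℕ → E × ℝ) × ℝ => R.survival x.1 κ x.2 :=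
  (Real.measurable_exp.comp (R.measurable_cumRate κ).ennreal_toReal.neg).real_toNNReal

lemma measurable_weight [SFinite ν] (κ : List QuakeKind) :
    Measurable fun y : ℕ → E × ℝ => R.weight y κ := by
  induction κ with
  | nil => exact measurable_const
  | cons k κ ih =>
    refine ih.mul (Measurable.mul ?_ ?_)
    · exact (R.measurable_survival κ).comp
        (f := fun y : ℕ → E × ℝ => (y, (y (κ.length + 1)).2)) (by fun_prop)
    · exact (R.measurable_rate κ k).comp
        (f := fun y : ℕ → E × ℝ => (y, (y (κ.length + 1)).1, (y (κ.length + 1)).2)) (by fun_prop)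

lemma measurable_lintegral_γ [SFinite ν] : Measurable fun s => ∫⁻ u, (R.γ u s : ℝ≥0∞) ∂ν :=
  Measurable.lintegral_prod_left' (f := fun x : E × ℝ => (R.γ x.1 x.2 : ℝ≥0∞))
    R.measurable_γ.coe_nnreal_ennreal

lemma measurable_lintegral_ε [SFinite ν] : Measurable fun s => ∫⁻ u, (R.ε u s : ℝ≥0∞) ∂ν :=
  Measurable.lintegral_prod_left' (f := fun x : E × ℝ => (R.ε x.1 x.2 : ℝ≥0∞))
    R.measurable_ε.coe_nnreal_ennreal

lemma measurable_lintegral_lam [SFinite ν] (x : E × ℝ) :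
    Measurable fun s => ∫⁻ u, (R.lam u s x : ℝ≥0∞) ∂ν :=
  Measurable.lintegral_prod_left' (f := fun z : E × ℝ => (R.lam z.1 z.2 x : ℝ≥0∞))
    (R.measurable_lam.comp (f := fun z : E × ℝ => (z.1, z.2, x)) (by fun_prop)).coe_nnreal_ennreal

lemma lintegral_lam_ne_top {x : E × ℝ} (hx : 0 ≤ x.2) {r : ℝ} (hr : x.2 ≤ r) (t : ℝ) :
    ∫⁻ s in Ioc r t, ∫⁻ u, (R.lam u s x : ℝ≥0∞) ∂ν ≠ ∞ :=
  ne_top_of_le_ne_top (R.lam_finite x hx t)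
    (lintegral_mono_set (Ioc_subset_Ioc_left hr))

lemma lintegral_ε_ne_top {r : ℝ} (hr : 0 ≤ r) (t : ℝ) :
    ∫⁻ s in Ioc r t, ∫⁻ u, (R.ε u s : ℝ≥0∞) ∂ν ≠ ∞ :=
  ne_top_of_le_ne_top (R.ε_finite t) (lintegral_mono_set (Ioc_subset_Ioc_left hr))

lemma lintegral_γ_ne_top {r : ℝ} (hr : 0 ≤ r) (t : ℝ) :
    ∫⁻ s in Ioc r t, ∫⁻ u, (R.γ u s : ℝ≥0∞) ∂ν ≠ ∞ :=
  ne_top_of_le_ne_top (R.γ_finite t) (lintegral_mono_set (Ioc_subset_Ioc_left hr))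

lemma cumRate_eq [SFinite ν] (y : ℕ → E × ℝ) (κ : List QuakeKind) (t : ℝ) :
    R.cumRate y κ t = (∫⁻ s in Ioc (y κ.length).2 t, ∫⁻ u, (R.γ u s : ℝ≥0∞) ∂ν)
      + ∫⁻ s in Ioc (y κ.length).2 t, ∫⁻ u,
          (R.clusterRate (ofKinds y κ) u s : ℝ≥0∞) ∂ν := by
  unfold cumRate
  rw [← lintegral_add_left R.measurable_lintegral_γ]
  exact lintegral_congr fun s => R.totalRate_eq y κ s

lemma cumRate_ne_top [SFinite ν] {y : ℕ → E × ℝ} {κ : List QuakeKind}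
    (hy : IncreasingUpTo κ.length y) (t : ℝ) : R.cumRate y κ t ≠ ∞ := by
  rw [R.cumRate_eq y κ t]
  refine ENNReal.add_ne_top.2 ⟨R.lintegral_γ_ne_top (hy.nonneg le_rfl) t, ?_⟩
  simp only [clusterRate_ofKinds]
  cases h : motherIdx κ with
  | none => exact R.lintegral_ε_ne_top (hy.nonneg le_rfl) t
  | some i =>
    have hi := (Finset.mem_Icc.1 (motherIdx_mem h)).2
    exact R.lintegral_lam_ne_top (hy.nonneg hi) (hy.le hi le_rfl) t

end MotherQuakeRates

/-! ### The observed path and the kinds of the quakes -/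

lemma measurable_comp_countable {α β γ K : Type*} {mα : MeasurableSpace α} [MeasurableSpace β]
    [MeasurableSpace γ] [MeasurableSpace K] [Countable K] [MeasurableSingletonClass K]
    {g : K → β → γ} (hg : ∀ κ, Measurable (g κ)) {κ : α → K} (hκ : Measurable κ) {f : α → β}
    (hf : Measurable f) : Measurable fun a => g (κ a) (f a) :=
  (measurable_from_prod_countable_right (f := fun x : K × β => g x.1 x.2) hg).comp (hκ.prodMk hf)

instance : Countable QuakeKind := Finite.to_countable

namespace QuakeProcess

open ClusterHistory

variable {E Ω : Type*} [MeasurableSpace E] [mΩ : MeasurableSpace Ω] (X : QuakeProcess E Ω)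

lemma T_mono (ω : Ω) : Monotone fun n => X.T n ω := monotone_nat_of_le_succ fun n => X.T_le n ω

lemma T_nonneg (n : ℕ) (ω : Ω) : 0 ≤ X.T n ω := X.T_zero ω ▸ X.T_mono ω (Nat.zero_le n)

lemma T_ne_bot (n : ℕ) (ω : Ω) : X.T n ω ≠ ⊥ :=
  fun h => by have := X.T_nonneg n ω; simp [h] at this

lemma coe_toReal_T {n : ℕ} {ω : Ω} (h : X.T n ω ≠ ⊤) : ((X.T n ω).toReal : EReal) = X.T n ω :=
  EReal.coe_toReal h (X.T_ne_bot n ω)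

lemma T_lt_of_lt {m n : ℕ} (hmn : m < n) {ω : Ω} (h : X.T m ω ≠ ⊤) : X.T m ω < X.T n ω :=
  (X.T_lt m ω h).trans_le (X.T_mono ω hmn)

lemma T_ne_top_of_le {m n : ℕ} (hmn : m ≤ n) {ω : Ω} (h : X.T n ω ≠ ⊤) : X.T m ω ≠ ⊤ :=
  ne_top_of_le_ne_top h (X.T_mono ω hmn)

lemma toReal_T_nonneg (n : ℕ) (ω : Ω) : 0 ≤ (X.T n ω).toReal := EReal.toReal_nonneg (X.T_nonneg n ω)

/-- Marks and times of the quakes. -/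
noncomputable def path (ω : Ω) (n : ℕ) : E × ℝ := (X.mark n ω, (X.T n ω).toReal)

/-- Marks and times of the first `n` quakes. -/
noncomputable def pathUpTo (e₀ : E) (n : ℕ) (ω : Ω) (i : ℕ) : E × ℝ :=
  if 1 ≤ i ∧ i ≤ n then X.path ω i else (e₀, 0)

/-- The kinds of the first `n` quakes, most recent quake first. -/
def kinds (ω : Ω) : ℕ → List QuakeKind
  | 0 => []
  | n + 1 => X.kind (n + 1) ω :: kinds ω n

@[simp] lemma length_kinds (ω : Ω) (n : ℕ) : (X.kinds ω n).length = n := by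
  induction n with
  | zero => rfl
  | succ n ih => simp [kinds, ih]

lemma kinds_mem (ω : Ω) (n : ℕ) : X.kinds ω n ∈ kindStrings n :=
  mem_kindStrings.2 (X.length_kinds ω n)

lemma agreeUpTo_pathUpTo (e₀ : E) (n : ℕ) (ω : Ω) :
    AgreeUpTo n (X.pathUpTo e₀ n ω) (X.path ω) := by
  refine ⟨by simp [pathUpTo, path, X.T_zero], fun i h1 hn => by simp [pathUpTo, h1, hn]⟩

lemma pathUpTo_succ (e₀ : E) (n : ℕ) (ω : Ω) :
    X.pathUpTo e₀ (n + 1) ω = Function.update (X.pathUpTo e₀ n ω) (n + 1)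
      (X.mark (n + 1) ω, (X.T (n + 1) ω).toReal) := by
  funext i
  by_cases hi : i = n + 1
  · subst hi; simp [pathUpTo, path]
  · rw [Function.update_of_ne hi]
    have : i ≤ n + 1 ↔ i ≤ n := by lia
    simp [pathUpTo, this]

lemma clusterHist_eq (ω : Ω) (n : ℕ) :
    X.clusterHist ω n = ofKinds (X.path ω) (X.kinds ω n) := by
  induction n with
  | zero => rfl
  | succ n ih =>
    unfold clusterHist kinds
    cases X.kind (n + 1) ω with
    | single => exact ih
    | cluster D => simp [ofKinds, ih, path]

lemma clusterHist_eq_pathUpTo (e₀ : E) (ω : Ω) (n : ℕ) :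
    X.clusterHist ω n = ofKinds (X.pathUpTo e₀ n ω) (X.kinds ω n) := by
  rw [clusterHist_eq]
  refine (ofKinds_congr ?_).symm
  simpa using X.agreeUpTo_pathUpTo e₀ n ω

lemma increasingUpTo_path {n : ℕ} {ω : Ω} (h : X.T n ω ≠ ⊤) : IncreasingUpTo n (X.path ω) := by
  refine ⟨by simp [path, X.T_zero], fun i hi => ?_⟩
  have h1 := X.T_lt i ω (X.T_ne_top_of_le hi.le h)
  rw [← X.coe_toReal_T (X.T_ne_top_of_le hi.le h),
    ← X.coe_toReal_T (X.T_ne_top_of_le (Nat.succ_le_of_lt hi) h)] at h1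
  exact_mod_cast h1

lemma increasingUpTo_pathUpTo (e₀ : E) {n : ℕ} {ω : Ω} (h : X.T n ω ≠ ⊤) :
    IncreasingUpTo n (X.pathUpTo e₀ n ω) :=
  (X.increasingUpTo_path h).congr
    ⟨(X.agreeUpTo_pathUpTo e₀ n ω).1.symm, fun i h1 h2 => ((X.agreeUpTo_pathUpTo e₀ n ω).2 i h1 h2).symm⟩

lemma pathUpTo_time (e₀ : E) (n : ℕ) (ω : Ω) : (X.pathUpTo e₀ n ω n).2 = (X.T n ω).toReal :=
  (X.agreeUpTo_pathUpTo e₀ n ω).time_eq le_rfl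

lemma ncard_eq {p : EReal → Prop} {n : ℕ} {ω : Ω} (hp : ∀ a b, a ≤ b → p b → p a)
    (h : n = 0 ∨ p (X.T n ω)) (h' : ¬ p (X.T (n + 1) ω)) :
    Set.ncard {m : ℕ | 1 ≤ m ∧ p (X.T m ω)} = n := by
  have : {m : ℕ | 1 ≤ m ∧ p (X.T m ω)} = ((Finset.Icc 1 n : Finset ℕ) : Set ℕ) := by
    ext m
    simp only [mem_ofPred_eq, Finset.coe_Icc, mem_Icc]
    refine and_congr_right fun hm => ⟨fun hpm => ?_, fun hmn => ?_⟩
    · by_contra hlt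
      exact h' (hp _ _ (X.T_mono ω (by lia)) hpm)
    · rcases h with h | h
      · lia
      · exact hp _ _ (X.T_mono ω hmn) h
  rw [this, Set.ncard_coe_finset]
  simp

lemma histBefore_eq {n : ℕ} {ω : Ω} {s : ℝ} (h : X.T n ω < s) (h' : s ≤ X.T (n + 1) ω) :
    X.histBefore s ω = X.clusterHist ω n := by
  unfold histBefore
  rw [X.ncard_eq (p := fun a => a < (s : EReal)) (fun a b hab hb => hab.trans_lt hb) (Or.inr h)
    (not_lt.2 h')]

lemma hist_eq {n : ℕ} {ω : Ω} {t : ℝ} (h : X.T n ω ≤ t) (h' : t < X.T (n + 1) ω) :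
    X.hist t ω = X.clusterHist ω n := by
  unfold hist
  rw [X.ncard_eq (p := fun a => a ≤ (t : EReal)) (fun a b hab hb => hab.trans hb) (Or.inr h)
    (not_le.2 h')]

lemma exists_T_le_lt (ω : Ω) {t : ℝ} (ht : 0 ≤ t) :
    ∃ n, X.T n ω ≤ t ∧ (t : EReal) < X.T (n + 1) ω := by
  classical
  have hex : ∃ n, (t : EReal) < X.T (n + 1) ω := by
    obtain ⟨n, hn⟩ := X.T_unbounded ω t
    exact ⟨n, hn.trans_le (X.T_le n ω)⟩
  refine ⟨Nat.find hex, ?_, Nat.find_spec hex⟩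
  cases h : Nat.find hex with
  | zero => rw [X.T_zero]; exact_mod_cast ht
  | succ m => exact not_lt.1 (Nat.find_min hex (m := m) (by lia))

lemma T_index_unique {ω : Ω} {t : ℝ} {m n : ℕ} (hm : X.T m ω ≤ t) (hm' : (t : EReal) < X.T (m + 1) ω)
    (hn : X.T n ω ≤ t) (hn' : (t : EReal) < X.T (n + 1) ω) : m = n := by
  by_contra hne
  rcases lt_or_gt_of_ne hne with h | h
  · exact absurd (hm'.trans_le ((X.T_mono ω h).trans hn)) (lt_irrefl _)
  · exact absurd (hn'.trans_le ((X.T_mono ω h).trans hm)) (lt_irrefl _)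

lemma measurable_path : Measurable X.path :=
  measurable_pi_iff.2 fun n => (X.measurable_mark n).prodMk (X.measurable_T n).ereal_toReal

lemma measurable_pathUpTo (e₀ : E) (n : ℕ) : Measurable (X.pathUpTo e₀ n) := by
  refine measurable_pi_iff.2 fun i => ?_
  by_cases h : 1 ≤ i ∧ i ≤ n
  · simpa [pathUpTo, h] using measurable_pi_iff.1 X.measurable_path i
  · simp [pathUpTo, h]

lemma measurable_kinds (n : ℕ) : Measurable fun ω => X.kinds ω n := by
  induction n with
  | zero => exact measurable_const
  | succ n ih => exact Measurable.list_cons (X.measurable_kind (n + 1)) ih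

lemma measurable_clusterHist (n : ℕ) : Measurable fun ω => X.clusterHist ω n := by
  simp only [clusterHist_eq]
  exact measurable_comp_countable (g := fun κ y => ofKinds y κ)
    (fun κ => measurable_ofKinds κ) (X.measurable_kinds n) X.measurable_path

/-! ### Predictability -/

/-- Marks and times of the quakes before time `s`. -/
noncomputable def predPath (e₀ : E) (x : ℝ≥0 × Ω) (i : ℕ) : E × ℝ :=
  if 1 ≤ i ∧ X.T i x.2 < ((x.1 : ℝ) : EReal) then X.path x.2 i else (e₀, 0)

open Classical in
/-- The kinds of those among the first `n` quakes that occur before time `s`. -/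
noncomputable def predKinds : ℕ → ℝ≥0 × Ω → List QuakeKind
  | 0, _ => []
  | n + 1, x => (if X.T (n + 1) x.2 < ((x.1 : ℝ) : EReal) then X.kind (n + 1) x.2
      else QuakeKind.single) :: predKinds n x

lemma predPath_eq (e₀ : E) {n : ℕ} {x : ℝ≥0 × Ω} (h : X.T n x.2 < ((x.1 : ℝ) : EReal))
    (h' : ((x.1 : ℝ) : EReal) ≤ X.T (n + 1) x.2) : X.predPath e₀ x = X.pathUpTo e₀ n x.2 := by
  funext i
  have : X.T i x.2 < ((x.1 : ℝ) : EReal) ↔ i ≤ n := by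
    refine ⟨fun hi => ?_, fun hi => (X.T_mono x.2 hi).trans_lt h⟩
    by_contra hlt
    exact absurd (hi.trans_le (h'.trans (X.T_mono x.2 (show n + 1 ≤ i by lia)))) (lt_irrefl _)
  simp [predPath, pathUpTo, this]

lemma predKinds_eq {n : ℕ} {x : ℝ≥0 × Ω} (h : X.T n x.2 < ((x.1 : ℝ) : EReal)) :
    X.predKinds n x = X.kinds x.2 n := by
  induction n with
  | zero => rfl
  | succ n ih => simp [predKinds, kinds, h, ih ((X.T_le n x.2).trans_lt h)]

end QuakeProcess

section PointFiltration

variable {Ω M : Type*} [mΩ : MeasurableSpace Ω] [MeasurableSpace M]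
  {T : ℕ → Ω → EReal} {X : ℕ → Ω → M} {hT : ∀ n, Measurable (T n)} {hX : ∀ n, Measurable (X n)}

lemma measurableSet_pointFiltration {n : ℕ} (hn : 1 ≤ n) {s t : ℝ≥0} (hst : s ≤ t) {A : Set M}
    (hA : MeasurableSet A) :
    MeasurableSet[pointFiltration T X hT hX t] {ω | T n ω ≤ ((s : ℝ) : EReal) ∧ X n ω ∈ A} :=
  MeasurableSpace.measurableSet_generateFrom ⟨n, s, A, hn, hst, hA, rfl⟩

lemma measurableSet_predictable_point {n : ℕ} (hn : 1 ≤ n) (h0 : ∀ ω, 0 ≤ T n ω) (c : ℝ≥0) {A : Set M}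
    (hA : MeasurableSet A) :
    MeasurableSet[(pointFiltration T X hT hX).predictable]
      {x : ℝ≥0 × Ω | T n x.2 < ((x.1 : ℝ) : EReal) ∧ T n x.2 ≤ ((c : ℝ) : EReal) ∧ X n x.2 ∈ A} := by
  have : {x : ℝ≥0 × Ω | T n x.2 < ((x.1 : ℝ) : EReal) ∧ T n x.2 ≤ ((c : ℝ) : EReal) ∧ X n x.2 ∈ A}
      = ⋃ q : ℚ, Ioi (Real.toNNReal q) ×ˢ
        {ω | T n ω ≤ (((min (Real.toNNReal q) c : ℝ≥0) : ℝ) : EReal) ∧ X n ω ∈ A} := by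
    ext ⟨s, ω⟩
    simp only [mem_ofPred_eq, mem_iUnion, mem_prod, mem_Ioi]
    have hmin : ∀ q : ℚ, T n ω ≤ (((min (Real.toNNReal q) c : ℝ≥0) : ℝ) : EReal) ↔
        T n ω ≤ ((Real.toNNReal q : ℝ) : EReal) ∧ T n ω ≤ ((c : ℝ) : EReal) := by
      intro q
      rw [← le_min_iff]
      rcases le_total (Real.toNNReal q) c with h | h
      · rw [min_eq_left h, min_eq_left (by exact_mod_cast h)]
      · rw [min_eq_right h, min_eq_right (by exact_mod_cast h)]
    constructor
    · rintro ⟨h1, h2, h3⟩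
      obtain ⟨q, hq1, hq2⟩ := EReal.lt_iff_exists_rat_btwn.1 h1
      have hq0 : (0 : ℝ) ≤ q := by
        have := (h0 ω).trans hq1.le
        exact_mod_cast this
      refine ⟨q, ?_, (hmin q).2 ⟨?_, h2⟩, h3⟩
      · rw [← NNReal.coe_lt_coe, Real.coe_toNNReal _ hq0]
        exact_mod_cast hq2
      · rw [Real.coe_toNNReal _ hq0]
        exact_mod_cast hq1.le
    · rintro ⟨q, hq, h, h3⟩
      refine ⟨((hmin q).1 h).1.trans_lt ?_, ((hmin q).1 h).2, h3⟩
      exact_mod_cast hq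
  rw [this]
  refine MeasurableSet.iUnion fun q => measurableSet_predictable_Ioi_prod ?_
  exact measurableSet_pointFiltration hn (min_le_left _ _) hA

lemma measurableSet_predictable_point' {n : ℕ} (hn : 1 ≤ n) (h0 : ∀ ω, 0 ≤ T n ω) {A : Set M}
    (hA : MeasurableSet A) :
    MeasurableSet[(pointFiltration T X hT hX).predictable]
      {x : ℝ≥0 × Ω | T n x.2 < ((x.1 : ℝ) : EReal) ∧ X n x.2 ∈ A} := by
  have : {x : ℝ≥0 × Ω | T n x.2 < ((x.1 : ℝ) : EReal) ∧ X n x.2 ∈ A} = ⋃ c : ℕ,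
      {x : ℝ≥0 × Ω | T n x.2 < ((x.1 : ℝ) : EReal) ∧ T n x.2 ≤ (((c : ℝ≥0) : ℝ) : EReal)
        ∧ X n x.2 ∈ A} := by
    ext ⟨s, ω⟩
    simp only [mem_ofPred_eq, mem_iUnion]
    refine ⟨fun h => ?_, fun ⟨c, h⟩ => ⟨h.1, h.2.2⟩⟩
    obtain ⟨c, hc⟩ := exists_nat_ge s
    refine ⟨c, h.1, h.1.le.trans ?_, h.2⟩
    exact_mod_cast hc
  rw [this]
  exact MeasurableSet.iUnion fun c => measurableSet_predictable_point hn h0 c hA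

lemma measurable_predictable_fst (𝓕 : Filtration ℝ≥0 mΩ) :
    Measurable[𝓕.predictable] (Prod.fst : ℝ≥0 × Ω → ℝ≥0) := by
  let _ := 𝓕.predictable
  refine measurable_of_Ioi fun c => ?_
  have : (Prod.fst ⁻¹' Ioi c : Set (ℝ≥0 × Ω)) = Ioi c ×ˢ univ := by ext; simp
  rw [this]
  exact measurableSet_predictable_Ioi_prod MeasurableSet.univ

open Classical in
lemma measurable_ite_of_inter {α β : Type*} {mα : MeasurableSpace α} [MeasurableSpace β]
    {D : Set α} {f : α → β} (b : β) (hD : MeasurableSet D)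
    (hf : ∀ A, MeasurableSet A → MeasurableSet (D ∩ f ⁻¹' A)) :
    Measurable fun a => if a ∈ D then f a else b := by
  intro A hA
  have : (fun a => if a ∈ D then f a else b) ⁻¹' A = (D ∩ f ⁻¹' A) ∪ (Dᶜ ∩ {_a | b ∈ A}) := by
    ext a
    by_cases h : a ∈ D <;> simp [h]
  rw [this]
  exact (hf A hA).union (hD.compl.inter (MeasurableSet.const _))

open Classical in
/-- A point of a marked point process is a measurable function on an event on which it has
already been observed. -/
lemma measurable_ite_point {α E : Type*} {mα : MeasurableSpace α} [MeasurableSpace E]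
    {D : Set α} {m : α → E} {τ : α → EReal} (e₀ : E) (hD : MeasurableSet D)
    (hm : ∀ A, MeasurableSet A → MeasurableSet (D ∩ m ⁻¹' A))
    (hτ : ∀ c : ℝ≥0, MeasurableSet (D ∩ {a | τ a ≤ ((c : ℝ) : EReal)}))
    (h0 : ∀ a, 0 ≤ τ a) (htop : ∀ a ∈ D, τ a ≠ ⊤) :
    Measurable fun a => if a ∈ D then (m a, (τ a).toReal) else (e₀, 0) := by
  have h1 := measurable_ite_of_inter e₀ hD hm
  have h2 : Measurable fun a => if a ∈ D then (τ a).toReal.toNNReal else 0 := by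
    refine measurable_of_Iic fun c => ?_
    convert (hτ c).union hD.compl using 1
    ext a
    by_cases ha : a ∈ D
    · have : τ a ≤ ((c : ℝ) : EReal) ↔ (τ a).toReal ≤ c := by
        conv_lhs => rw [← EReal.coe_toReal (htop a ha) (fun h => by have := h0 a; simp [h] at this)]
        exact EReal.coe_le_coe_iff
      simp [ha, this, Real.toNNReal_le_iff_le_coe]
    · simp [ha]
  convert h1.prodMk h2.coe_nnreal_real using 1
  funext a
  by_cases ha : a ∈ D
  · simp [ha, Real.coe_toNNReal _ (EReal.toReal_nonneg (h0 a))]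
  · simp [ha]

end PointFiltration

namespace QuakeProcess

open ClusterHistory

variable {E Ω : Type*} [MeasurableSpace E] [mΩ : MeasurableSpace Ω] (X : QuakeProcess E Ω)

lemma measurableSet_T_lt_predictable (n : ℕ) :
    MeasurableSet[X.fullFiltration.predictable]
      {x : ℝ≥0 × Ω | X.T n x.2 < ((x.1 : ℝ) : EReal)} := by
  rcases Nat.eq_zero_or_pos n with rfl | hn
  · have : {x : ℝ≥0 × Ω | X.T 0 x.2 < ((x.1 : ℝ) : EReal)} = Prod.fst ⁻¹' Ioi 0 := by
      ext x
      simp [X.T_zero]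
    rw [this]
    exact measurable_predictable_fst _ measurableSet_Ioi
  · have := measurableSet_predictable_point' (hT := X.measurable_T)
      (hX := fun n => (X.measurable_mark n).prodMk (X.measurable_kind n)) hn (X.T_nonneg n)
      MeasurableSet.univ
    simp only [mem_univ, and_true] at this
    exact this

lemma measurable_predPath (e₀ : E) : Measurable[X.fullFiltration.predictable] (X.predPath e₀) := by
  classical
  let _ := X.fullFiltration.predictable
  refine measurable_pi_iff.2 fun i => ?_
  by_cases hi : 1 ≤ i
  swap
  · simp only [predPath, hi, false_and, if_false]
    exact measurable_const
  convert measurable_ite_point (D := {x : ℝ≥0 × Ω | X.T i x.2 < ((x.1 : ℝ) : EReal)})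
    (m := fun x => X.mark i x.2) (τ := fun x => X.T i x.2) e₀ (X.measurableSet_T_lt_predictable i)
    (fun A hA => ?_) (fun c => ?_) (fun x => X.T_nonneg i x.2)
    (fun x hx => (hx.trans_le le_top).ne) using 1
  · funext x
    by_cases hx : X.T i x.2 < ((x.1 : ℝ) : EReal) <;> simp [predPath, path, hi, hx]
  · have := measurableSet_predictable_point' (hT := X.measurable_T)
      (hX := fun n => (X.measurable_mark n).prodMk (X.measurable_kind n)) hi (X.T_nonneg i)
      (hA.prod MeasurableSet.univ)
    convert this using 1
    · rfl
    · ext x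
      simp
  · have := measurableSet_predictable_point (hT := X.measurable_T)
      (hX := fun n => (X.measurable_mark n).prodMk (X.measurable_kind n)) hi (X.T_nonneg i) c
      MeasurableSet.univ
    convert this using 1
    · rfl
    · ext x
      simp

lemma measurable_predKinds (n : ℕ) :
    Measurable[X.fullFiltration.predictable] (X.predKinds n) := by
  classical
  let _ := X.fullFiltration.predictable
  induction n with
  | zero => exact measurable_const
  | succ n ih =>
    refine Measurable.list_cons ?_ ih
    have h := measurable_ite_of_inter (D := {x : ℝ≥0 × Ω | X.T (n + 1) x.2 < ((x.1 : ℝ) : EReal)})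
      (f := fun x => X.kind (n + 1) x.2) QuakeKind.single
      (X.measurableSet_T_lt_predictable (n + 1)) fun A hA => ?_
    · convert h
      rfl
    · have := measurableSet_predictable_point' (hT := X.measurable_T)
        (hX := fun n => (X.measurable_mark n).prodMk (X.measurable_kind n))
        (show 1 ≤ n + 1 by lia) (X.T_nonneg (n + 1)) (MeasurableSet.univ.prod hA)
      convert this using 1
      · rfl
      · ext x
        simp

end QuakeProcess

/-! ### The law of the next quake -/

namespace IsMotherQuakeModel

open ClusterHistory

variable {E Ω : Type*} [MeasurableSpace E] [MeasurableSpace Ω] {ν : Measure E}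
  {R : MotherQuakeRates E ν} {P : Measure Ω} {X : QuakeProcess E Ω}

lemma measurable_predictable_integrand (X : QuakeProcess E Ω) (e₀ : E) (n : ℕ)
    {g : List QuakeKind → (ℕ → E × ℝ) → ℝ → E → QuakeKind → ℝ≥0∞}
    (hg : ∀ κ k, Measurable fun x : (ℕ → E × ℝ) × ℝ × E => g κ x.1 x.2.1 x.2.2 k) :
    Measurable[X.fullFiltration.predictable.prod inferInstance]
      ({x : (ℝ≥0 × Ω) × (E × QuakeKind) | X.T n x.1.2 < ((x.1.1 : ℝ) : EReal)
          ∧ ((x.1.1 : ℝ) : EReal) ≤ X.T (n + 1) x.1.2}.indicator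
        fun x => g (X.predKinds n x.1) (X.predPath e₀ x.1) x.1.1 x.2.1 x.2.2) := by
  have key : ∀ {α : Type _} {mα : MeasurableSpace α} {D : Set α} {κ : α → List QuakeKind}
      {y : α → ℕ → E × ℝ} {s : α → ℝ≥0}, MeasurableSet D → Measurable κ → Measurable y →
      Measurable s → Measurable ({x : α × (E × QuakeKind) | x.1 ∈ D}.indicator
        fun x => g (κ x.1) (y x.1) (s x.1) x.2.1 x.2.2) := by
    intro α mα D κ y s hD hκ hy hs
    refine Measurable.indicator ?_ (measurable_fst hD)
    exact measurable_comp_countable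
      (g := fun (z : List QuakeKind × QuakeKind) (x : (ℕ → E × ℝ) × ℝ × E) =>
        g z.1 x.1 x.2.1 x.2.2 z.2) (fun z => hg z.1 z.2)
      (κ := fun x : α × (E × QuakeKind) => (κ x.1, x.2.2))
      (f := fun x : α × (E × QuakeKind) => (y x.1, (s x.1 : ℝ), x.2.1)) (by fun_prop) (by fun_prop)
  refine key (D := {x : ℝ≥0 × Ω | X.T n x.2 < ((x.1 : ℝ) : EReal)
          ∧ ((x.1 : ℝ) : EReal) ≤ X.T (n + 1) x.2}) ?_ (X.measurable_predKinds n)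
    (X.measurable_predPath e₀) (measurable_predictable_fst _)
  let _ := X.fullFiltration.predictable
  have h := (X.measurableSet_T_lt_predictable n).inter
    (X.measurableSet_T_lt_predictable (n + 1)).compl
  convert h using 1
  ext x
  simp

lemma lintegral_next_quake (hX : IsMotherQuakeModel R P X) (e₀ : E) (n : ℕ)
    {g : List QuakeKind → (ℕ → E × ℝ) → ℝ → E → QuakeKind → ℝ≥0∞}
    (hg : ∀ κ k, Measurable fun x : (ℕ → E × ℝ) × ℝ × E => g κ x.1 x.2.1 x.2.2 k) :
    ∫⁻ ω, {ω | X.T (n + 1) ω ≠ ⊤}.indicator (fun ω => g (X.kinds ω n) (X.pathUpTo e₀ n ω)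
        (X.T (n + 1) ω).toReal (X.mark (n + 1) ω) (X.kind (n + 1) ω)) ω ∂P
      = ∫⁻ ω, ∫⁻ s in Ioi (0 : ℝ), ∫⁻ u,
          {s : ℝ | X.T n ω ≤ (s : EReal) ∧ (s : EReal) < X.T (n + 1) ω}.indicator (fun s => ∑ k,
            g (X.kinds ω n) (X.pathUpTo e₀ n ω) s u k
              * R.rate (ofKinds (X.pathUpTo e₀ n ω) (X.kinds ω n)) u s k) s ∂ν ∂volume ∂P := by
  have h := hX _ (measurable_predictable_integrand X e₀ n hg)
  convert h using 1
  · refine lintegral_congr fun ω => ?_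
    rw [tsum_eq_single n]
    · by_cases htop : X.T (n + 1) ω = ⊤
      · simp [htop]
      · have hlt : X.T n ω < X.T (n + 1) ω := X.T_lt n ω (X.T_ne_top_of_le n.le_succ htop)
        have hco : ((((X.T (n + 1) ω).toReal.toNNReal : ℝ≥0) : ℝ) : EReal) = X.T (n + 1) ω := by
          rw [Real.coe_toNNReal _ (X.toReal_T_nonneg _ _), X.coe_toReal_T htop]
        rw [if_neg htop, indicator_of_mem (by exact htop), indicator_of_mem]
        · rw [X.predKinds_eq (by simpa only [hco] using hlt),
            X.predPath_eq (n := n) e₀ (by simpa only [hco] using hlt) (by simp only [hco, le_refl]),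
            Real.coe_toNNReal _ (X.toReal_T_nonneg _ _)]
        · simp only [mem_ofPred_eq, hco, hlt, le_refl, and_self]
    · intro m hm
      split_ifs with htop
      · rfl
      · have hco : ((((X.T (m + 1) ω).toReal.toNNReal : ℝ≥0) : ℝ) : EReal) = X.T (m + 1) ω := by
          rw [Real.coe_toNNReal _ (X.toReal_T_nonneg _ _), X.coe_toReal_T htop]
        refine indicator_of_notMem ?_ _
        simp only [mem_ofPred_eq, hco, not_and, not_le]
        intro h1
        have hnm : n ≤ m := by
          by_contra hlt
          exact absurd (h1.trans_le (X.T_mono ω (show m + 1 ≤ n by lia))) (lt_irrefl _)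
        exact X.T_lt_of_lt (show n + 1 < m + 1 by lia)
          (X.T_ne_top_of_le (show n + 1 ≤ m + 1 by lia) htop)
  · refine lintegral_congr fun ω => lintegral_congr_ae ?_
    have h1 : ∀ᵐ s : ℝ ∂volume.restrict (Ioi 0), s ≠ (X.T n ω).toReal :=
      ae_restrict_of_ae (by simp [ae_iff])
    have h2 : ∀ᵐ s : ℝ ∂volume.restrict (Ioi 0), s ≠ (X.T (n + 1) ω).toReal :=
      ae_restrict_of_ae (by simp [ae_iff])
    filter_upwards [h1, h2, ae_restrict_mem measurableSet_Ioi] with s hs1 hs2 hs0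
    have hco : (((s.toNNReal : ℝ≥0) : ℝ)) = s := Real.coe_toNNReal _ (le_of_lt hs0)
    have hiff : (X.T n ω ≤ (s : EReal) ∧ (s : EReal) < X.T (n + 1) ω) ↔
        (X.T n ω < (s : EReal) ∧ (s : EReal) ≤ X.T (n + 1) ω) := by
      have e1 : X.T n ω ≠ (s : EReal) := fun h => hs1 (by rw [h]; simp)
      have e2 : (s : EReal) ≠ X.T (n + 1) ω := fun h => hs2 (by rw [← h]; simp)
      rw [lt_iff_le_and_ne, lt_iff_le_and_ne]
      tauto
    refine lintegral_congr fun u => ?_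
    by_cases hmem : X.T n ω < (s : EReal) ∧ (s : EReal) ≤ X.T (n + 1) ω
    · have hk := X.predKinds_eq (n := n) (x := (s.toNNReal, ω)) (by simpa only [hco] using hmem.1)
      have hp := X.predPath_eq (n := n) (x := (s.toNNReal, ω)) e₀ (by simpa only [hco] using hmem.1)
        (by simpa only [hco] using hmem.2)
      have hh := X.histBefore_eq hmem.1 hmem.2
      rw [indicator_of_mem (by exact hiff.2 hmem), indicator_of_mem (by simpa only [mem_ofPred_eq, hco] using hmem),
        indicator_of_mem (by simpa only [mem_ofPred_eq, hco] using hmem),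
        indicator_of_mem (by simpa only [mem_ofPred_eq, hco] using hmem)]
      simp only [hk, hp, hh, hco, X.clusterHist_eq_pathUpTo e₀, QuakeKind.sum_eq]
    · rw [indicator_of_notMem (by exact fun h => hmem (hiff.1 h)),
        indicator_of_notMem (by simpa only [mem_ofPred_eq, hco] using hmem),
        indicator_of_notMem (by simpa only [mem_ofPred_eq, hco] using hmem),
        indicator_of_notMem (by simpa only [mem_ofPred_eq, hco] using hmem)]
      simp

end IsMotherQuakeModel

namespace IsMotherQuakeModel

open ClusterHistory MotherQuakeRates

variable {E Ω : Type*} [MeasurableSpace E] [MeasurableSpace Ω] {ν : Measure E} [SFinite ν]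
  {R : MotherQuakeRates E ν} {P : Measure Ω} {X : QuakeProcess E Ω}

lemma measurableSet_T_le (X : QuakeProcess E Ω) (n : ℕ) (t : ℝ) :
    MeasurableSet {ω | X.T n ω ≤ (t : EReal)} :=
  measurableSet_le (X.measurable_T n) measurable_const

lemma measurableSet_T_le_lt (X : QuakeProcess E Ω) (n : ℕ) (t : ℝ) :
    MeasurableSet {ω | X.T n ω ≤ (t : EReal) ∧ (t : EReal) < X.T (n + 1) ω} :=
  (measurableSet_T_le X n t).inter (measurableSet_lt measurable_const (X.measurable_T (n + 1)))

lemma measurable_comp_kinds (X : QuakeProcess E Ω) (e₀ : E) (n : ℕ)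
    {ψ : List QuakeKind → (ℕ → E × ℝ) → ℝ≥0∞} (hψ : ∀ κ, Measurable (ψ κ)) :
    Measurable fun ω => ψ (X.kinds ω n) (X.pathUpTo e₀ n ω) :=
  measurable_comp_countable hψ (X.measurable_kinds n) (X.measurable_pathUpTo e₀ n)

lemma measurable_survival_left (R : MotherQuakeRates E ν) (κ : List QuakeKind) (t : ℝ) :
    Measurable fun y : ℕ → E × ℝ => (R.survival y κ t : ℝ≥0∞) :=
  ((R.measurable_survival κ).comp (f := fun y => (y, t)) (by fun_prop)).coe_nnreal_ennreal

/-- The identity behind `lintegral_survival` along one path. -/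
lemma lintegral_exp_cumRate_add (e₀ : E) (n : ℕ) (t : ℝ) (c : Ω → ℝ≥0∞) (ω : Ω) :
    (∫⁻ s in Ioi (0 : ℝ), ∫⁻ u,
      {s : ℝ | X.T n ω ≤ (s : EReal) ∧ (s : EReal) < X.T (n + 1) ω}.indicator (fun s => ∑ k,
        (Iic t).indicator (fun s => c ω * ENNReal.ofReal
            (Real.exp (R.cumRate (X.pathUpTo e₀ n ω) (X.kinds ω n) s).toReal)) s
          * R.rate (ofKinds (X.pathUpTo e₀ n ω) (X.kinds ω n)) u s k) s ∂ν ∂volume)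
      + {ω | X.T n ω ≤ (t : EReal)}.indicator c ω
    = {ω | X.T (n + 1) ω ≠ ⊤}.indicator (fun ω => (Iic t).indicator (fun s => c ω * ENNReal.ofReal
        (Real.exp (R.cumRate (X.pathUpTo e₀ n ω) (X.kinds ω n) s).toReal))
          (X.T (n + 1) ω).toReal) ω
      + {ω | X.T n ω ≤ (t : EReal) ∧ (t : EReal) < X.T (n + 1) ω}.indicator (fun ω => c ω *
        ENNReal.ofReal (Real.exp (R.cumRate (X.pathUpTo e₀ n ω) (X.kinds ω n) t).toReal)) ω := by
  set y := X.pathUpTo e₀ n ω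
  set κ := X.kinds ω n
  by_cases ht : X.T n ω ≤ (t : EReal)
  swap
  · have h1 : X.T n ω ≠ ⊤ → t < (X.T n ω).toReal := by
      intro h
      rw [not_le, ← X.coe_toReal_T h] at ht
      exact_mod_cast ht
    have e1 : ω ∉ {ω | X.T n ω ≤ (t : EReal)} := ht
    have e2 : ω ∉ {ω | X.T n ω ≤ (t : EReal) ∧ (t : EReal) < X.T (n + 1) ω} := fun h => ht h.1
    rw [indicator_of_notMem e1, indicator_of_notMem e2]
    have : ∀ s : ℝ, ∀ u, {s : ℝ | X.T n ω ≤ (s : EReal) ∧ (s : EReal) < X.T (n + 1) ω}.indicator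
        (fun s => ∑ k, (Iic t).indicator (fun s => c ω * ENNReal.ofReal
            (Real.exp (R.cumRate y κ s).toReal)) s * (R.rate (ofKinds y κ) u s k : ℝ≥0∞)) s = 0 := by
      intro s u
      refine indicator_apply_eq_zero.2 fun hs => ?_
      have hst : s ∉ Iic t := fun h => ht (hs.1.trans (by exact_mod_cast h))
      simp [indicator_of_notMem hst]
    simp only [this, lintegral_zero, add_zero]
    refine (indicator_apply_eq_zero.2 fun h => indicator_of_notMem ?_ _).symm
    have hn := X.T_ne_top_of_le n.le_succ h
    have hinc := X.increasingUpTo_path (n := n + 1) h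
    have := hinc.2 n n.lt_succ_self
    simp only [QuakeProcess.path] at this
    exact fun hle => absurd ((h1 hn).trans this) (not_lt.2 hle)
  have hn : X.T n ω ≠ ⊤ := (ht.trans_lt (EReal.coe_lt_top t)).ne
  have hyn : (y κ.length).2 = (X.T n ω).toReal := by
    simp only [y, κ, X.length_kinds, X.pathUpTo_time]
  have hinc : IncreasingUpTo κ.length y := by
    simpa only [κ, X.length_kinds] using X.increasingUpTo_pathUpTo e₀ hn
  set r := (X.T n ω).toReal with hr
  have hTr : X.T n ω = (r : EReal) := (X.coe_toReal_T hn).symm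
  have hr0 : 0 ≤ r := X.toReal_T_nonneg n ω
  -- both cases reduce to an integral up to the minimum of `t` and the next quake
  have main : ∀ τ : ℝ, r ≤ τ → (∀ s : ℝ, s ≠ τ →
      (((s : EReal) < X.T (n + 1) ω ∧ s ≤ t) ↔ s ≤ τ)) →
      (∫⁻ s in Ioi (0 : ℝ), ∫⁻ u,
      {s : ℝ | X.T n ω ≤ (s : EReal) ∧ (s : EReal) < X.T (n + 1) ω}.indicator (fun s => ∑ k,
        (Iic t).indicator (fun s => c ω * ENNReal.ofReal
            (Real.exp (R.cumRate y κ s).toReal)) s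
          * R.rate (ofKinds y κ) u s k) s ∂ν ∂volume) + c ω
        = c ω * ENNReal.ofReal (Real.exp (R.cumRate y κ τ).toReal) := by
    intro τ hrτ hτ
    have hmeas : Measurable fun s => R.totalRate y κ s :=
      (R.measurable_totalRate κ).comp (f := fun s => (y, s)) (by fun_prop)
    have hfin := R.cumRate_ne_top hinc τ
    unfold MotherQuakeRates.cumRate at hfin ⊢
    rw [hyn] at hfin ⊢
    have hmain := lintegral_exp_mul_add_one hmeas hrτ hfin
    rw [← hmain, mul_add, mul_one]
    congr 1
    rw [← lintegral_const_mul, ← lintegral_indicator measurableSet_Ioi,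
      ← lintegral_indicator measurableSet_Ioc]
    · refine lintegral_congr_ae ?_
      have h1 : ∀ᵐ s : ℝ, s ≠ r := by simp [ae_iff]
      have h2 : ∀ᵐ s : ℝ, s ≠ τ := by simp [ae_iff]
      filter_upwards [h1, h2] with s hs1 hs2
      by_cases hs : s ∈ Ioc r τ
      · have h3 := (hτ s hs2).2 hs.2
        have h0 : s ∈ Ioi (0 : ℝ) := hr0.trans_lt hs.1
        have h4 : s ∈ {s : ℝ | X.T n ω ≤ (s : EReal) ∧ (s : EReal) < X.T (n + 1) ω} := by
          refine ⟨?_, h3.1⟩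
          rw [hTr]
          exact_mod_cast hs.1.le
        rw [indicator_of_mem hs, indicator_of_mem h0]
        simp only [indicator_of_mem h4, indicator_of_mem (show s ∈ Iic t from h3.2)]
        simp only [← Finset.mul_sum]
        rw [lintegral_const_mul, mul_assoc]
        · rfl
        · refine Finset.measurable_sum _ fun k _ => ?_
          exact ((R.measurable_rate κ k).comp (f := fun u => (y, u, s))
            (by fun_prop)).coe_nnreal_ennreal
      · rw [indicator_of_notMem hs]
        refine indicator_apply_eq_zero.2 fun _ => ?_
        rw [lintegral_eq_zero_iff' ?_]
        rotate_left
        · by_cases h5 : s ∈ {s : ℝ | X.T n ω ≤ (s : EReal) ∧ (s : EReal) < X.T (n + 1) ω}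
          · simp only [indicator_of_mem h5]
            refine (Finset.measurable_sum _ fun k _ => ?_).aemeasurable
            exact (((R.measurable_rate κ k).comp (f := fun u => (y, u, s))
              (by fun_prop)).coe_nnreal_ennreal).const_mul _
          · simp only [indicator_of_notMem h5]
            exact aemeasurable_const
        refine ae_of_all _ fun u => ?_
        refine indicator_apply_eq_zero.2 fun h4 => ?_
        have hst : s ∉ Iic t := by
          intro hst
          have h6 := (hτ s hs2).1 ⟨h4.2, hst⟩
          have h7 := h4.1
          rw [hTr] at h7
          have h8 : r ≤ s := by exact_mod_cast h7
          exact hs ⟨lt_of_le_of_ne h8 (Ne.symm hs1), h6⟩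
        simp [indicator_of_notMem hst]
    · refine Measurable.mul ?_ hmeas
      have hc := (R.measurable_cumRate κ).comp (f := fun s => (y, s)) (by fun_prop)
      have : (fun s => ENNReal.ofReal (Real.exp (∫⁻ x in Ioc r s, R.totalRate y κ x).toReal))
          = fun s => ENNReal.ofReal (Real.exp (R.cumRate y κ s).toReal) := by
        simp only [MotherQuakeRates.cumRate, hyn]
      rw [this]
      exact (Real.measurable_exp.comp hc.ennreal_toReal).ennreal_ofReal
  rw [indicator_of_mem (s := {ω | X.T n ω ≤ (t : EReal)}) (by exact ht)]
  by_cases ht' : (t : EReal) < X.T (n + 1) ω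
  · have e2 : ω ∈ {ω | X.T n ω ≤ (t : EReal) ∧ (t : EReal) < X.T (n + 1) ω} := ⟨ht, ht'⟩
    rw [indicator_of_mem e2, main t]
    · rw [eq_comm]
      convert zero_add _
      refine indicator_apply_eq_zero.2 fun h => indicator_of_notMem ?_ _
      rw [← X.coe_toReal_T h] at ht'
      exact not_le.2 (by exact_mod_cast ht')
    · rw [hTr] at ht
      exact_mod_cast ht
    · intro s _
      refine ⟨fun h => h.2, fun h => ⟨lt_of_le_of_lt ?_ ht', h⟩⟩
      exact_mod_cast h
  · have e2 : ω ∉ {ω | X.T n ω ≤ (t : EReal) ∧ (t : EReal) < X.T (n + 1) ω} := fun h => ht' h.2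
    rw [indicator_of_notMem e2, add_zero]
    have htop : X.T (n + 1) ω ≠ ⊤ := ((not_lt.1 ht').trans_lt (EReal.coe_lt_top t)).ne
    have hco := X.coe_toReal_T htop
    have hle : (X.T (n + 1) ω).toReal ≤ t := by
      rw [not_lt, ← hco] at ht'
      exact_mod_cast ht'
    rw [indicator_of_mem (s := {ω | X.T (n + 1) ω ≠ ⊤}) htop, indicator_of_mem (show _ ∈ Iic t from hle),
      main (X.T (n + 1) ω).toReal]
    · have := X.T_lt n ω hn
      rw [hTr, ← hco] at this
      exact (by exact_mod_cast this : r < _).le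
    · intro s hs
      rw [← hco, EReal.toReal_coe, EReal.coe_lt_coe_iff]
      exact ⟨fun h => h.1.le, fun h => ⟨lt_of_le_of_ne h hs, h.trans hle⟩⟩

lemma lintegral_survival_of_le_one [IsProbabilityMeasure P] (hX : IsMotherQuakeModel R P X)
    (e₀ : E) (n : ℕ) (t : ℝ) {ψ : List QuakeKind → (ℕ → E × ℝ) → ℝ≥0∞}
    (hψ : ∀ κ, Measurable (ψ κ)) (hψ1 : ∀ κ y, ψ κ y ≤ 1) :
    ∫⁻ ω in {ω | X.T n ω ≤ (t : EReal) ∧ (t : EReal) < X.T (n + 1) ω},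
        ψ (X.kinds ω n) (X.pathUpTo e₀ n ω) ∂P
      = ∫⁻ ω in {ω | X.T n ω ≤ (t : EReal)}, ψ (X.kinds ω n) (X.pathUpTo e₀ n ω)
          * R.survival (X.pathUpTo e₀ n ω) (X.kinds ω n) t ∂P := by
  set φ : List QuakeKind → (ℕ → E × ℝ) → ℝ≥0∞ := fun κ y => ψ κ y * R.survival y κ t with hφ
  have hφm : ∀ κ, Measurable (φ κ) := fun κ => (hψ κ).mul (measurable_survival_left R κ t)
  have hcum : ∀ κ, Measurable fun x : (ℕ → E × ℝ) × ℝ =>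
      ENNReal.ofReal (Real.exp (R.cumRate x.1 κ x.2).toReal) := fun κ =>
    (Real.measurable_exp.comp (R.measurable_cumRate κ).ennreal_toReal).ennreal_ofReal
  have hstep := hX.lintegral_next_quake e₀ n (g := fun κ y s _ _ => (Iic t).indicator
    (fun s => φ κ y * ENNReal.ofReal (Real.exp (R.cumRate y κ s).toReal)) s) (fun κ k => by
      refine Measurable.indicator (f := fun x : (ℕ → E × ℝ) × ℝ × E =>
        φ κ x.1 * ENNReal.ofReal (Real.exp (R.cumRate x.1 κ x.2.1).toReal))
        (s := {x : (ℕ → E × ℝ) × ℝ × E | x.2.1 ≤ t}) ?_ ?_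
      · exact ((hφm κ).comp measurable_fst).mul
          ((hcum κ).comp (f := fun x : (ℕ → E × ℝ) × ℝ × E => (x.1, x.2.1)) (by fun_prop))
      · exact measurableSet_le (by fun_prop) measurable_const)
  have hpath := fun ω => lintegral_exp_cumRate_add (R := R) (X := X) e₀ n t
    (fun ω => φ (X.kinds ω n) (X.pathUpTo e₀ n ω)) ω
  have hsum := lintegral_congr (μ := P) hpath
  have hm1 : Measurable ({ω | X.T n ω ≤ (t : EReal)}.indicator
      (fun ω => φ (X.kinds ω n) (X.pathUpTo e₀ n ω))) :=
    (measurable_comp_kinds X e₀ n hφm).indicator (measurableSet_T_le X n t)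
  have hm2 : Measurable ({ω | X.T n ω ≤ (t : EReal) ∧ (t : EReal) < X.T (n + 1) ω}.indicator
      (fun ω => φ (X.kinds ω n) (X.pathUpTo e₀ n ω) * ENNReal.ofReal (Real.exp
        (R.cumRate (X.pathUpTo e₀ n ω) (X.kinds ω n) t).toReal))) := by
    refine (measurable_comp_kinds X e₀ n (ψ := fun κ y => φ κ y *
      ENNReal.ofReal (Real.exp (R.cumRate y κ t).toReal)) fun κ => (hφm κ).mul ?_).indicator
        (measurableSet_T_le_lt X n t)
    exact (hcum κ).comp (f := fun y : ℕ → E × ℝ => (y, t)) (by fun_prop)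
  rw [lintegral_add_right _ hm1, lintegral_add_right _ hm2, ← hstep] at hsum
  have hfin : ∫⁻ ω, {ω | X.T (n + 1) ω ≠ ⊤}.indicator (fun ω => (Iic t).indicator
      (fun s => φ (X.kinds ω n) (X.pathUpTo e₀ n ω) * ENNReal.ofReal (Real.exp
        (R.cumRate (X.pathUpTo e₀ n ω) (X.kinds ω n) s).toReal)) (X.T (n + 1) ω).toReal) ω ∂P
      ≠ ∞ := by
    refine ne_top_of_le_ne_top ENNReal.one_ne_top ((lintegral_mono (g := fun _ => 1) ?_).trans
      (by simp))
    intro ω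
    by_cases htop : ω ∈ {ω | X.T (n + 1) ω ≠ ⊤}
    swap
    · rw [indicator_of_notMem htop]; exact zero_le
    rw [indicator_of_mem htop]
    by_cases hle : (X.T (n + 1) ω).toReal ∈ Iic t
    swap
    · rw [indicator_of_notMem hle]; exact zero_le
    rw [indicator_of_mem hle]
    have hinc : IncreasingUpTo (X.kinds ω n).length (X.pathUpTo e₀ n ω) := by
      simpa only [X.length_kinds] using
        X.increasingUpTo_pathUpTo e₀ (X.T_ne_top_of_le n.le_succ htop)
    rw [hφ, mul_assoc, ← one_mul (1 : ℝ≥0∞)]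
    refine mul_le_mul' (hψ1 _ _) ?_
    rw [← R.coe_survival_mul_exp (X.pathUpTo e₀ n ω) (X.kinds ω n) t]
    refine mul_le_mul' le_rfl (ENNReal.ofReal_le_ofReal (Real.exp_le_exp.2
      (ENNReal.toReal_mono (R.cumRate_ne_top hinc t) ?_)))
    exact lintegral_mono_set (Ioc_subset_Ioc_right hle)
  have hcancel := (ENNReal.add_right_inj hfin).1 hsum
  rw [lintegral_indicator (measurableSet_T_le X n t),
    lintegral_indicator (measurableSet_T_le_lt X n t)] at hcancel
  rw [hcancel]
  refine lintegral_congr fun ω => ?_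
  rw [hφ, mul_assoc, R.coe_survival_mul_exp, mul_one]

/-- Given the first `n` quakes and their kinds, the next quake comes after time `t` with
probability `survival`. -/
lemma lintegral_survival [IsProbabilityMeasure P] (hX : IsMotherQuakeModel R P X)
    (e₀ : E) (n : ℕ) (t : ℝ) {ψ : List QuakeKind → (ℕ → E × ℝ) → ℝ≥0∞}
    (hψ : ∀ κ, Measurable (ψ κ)) :
    ∫⁻ ω in {ω | X.T n ω ≤ (t : EReal) ∧ (t : EReal) < X.T (n + 1) ω},
        ψ (X.kinds ω n) (X.pathUpTo e₀ n ω) ∂P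
      = ∫⁻ ω in {ω | X.T n ω ≤ (t : EReal)}, ψ (X.kinds ω n) (X.pathUpTo e₀ n ω)
          * R.survival (X.pathUpTo e₀ n ω) (X.kinds ω n) t ∂P := by
  have hZ : Measurable fun ω => (X.kinds ω n, X.pathUpTo e₀ n ω) :=
    (X.measurable_kinds n).prodMk (X.measurable_pathUpTo e₀ n)
  have hs : Measurable fun z : List QuakeKind × (ℕ → E × ℝ) => (R.survival z.2 z.1 t : ℝ≥0∞) :=
    measurable_from_prod_countable_right fun κ => measurable_survival_left R κ t
  have hψ' : Measurable fun z : List QuakeKind × (ℕ → E × ℝ) => ψ z.1 z.2 :=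
    measurable_from_prod_countable_right hψ
  have hmeas : (P.restrict {ω | X.T n ω ≤ (t : EReal) ∧ (t : EReal) < X.T (n + 1) ω}).map
        (fun ω => (X.kinds ω n, X.pathUpTo e₀ n ω))
      = ((P.restrict {ω | X.T n ω ≤ (t : EReal)}).map
        (fun ω => (X.kinds ω n, X.pathUpTo e₀ n ω))).withDensity
          fun z => (R.survival z.2 z.1 t : ℝ≥0∞) := by
    ext B hB
    have h := hX.lintegral_survival_of_le_one e₀ n t
      (ψ := fun κ y => B.indicator (fun _ => 1) (κ, y))
      (fun κ => (measurable_const.indicator hB).comp measurable_prodMk_left)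
      (fun κ y => indicator_le_self' (fun _ _ => zero_le) _)
    rw [withDensity_apply _ hB, ← lintegral_indicator hB, lintegral_map (hs.indicator hB) hZ,
      ← lintegral_indicator_one hB, lintegral_map (measurable_one.indicator hB) hZ]
    refine Eq.trans h (lintegral_congr fun ω => ?_)
    by_cases hω : (X.kinds ω n, X.pathUpTo e₀ n ω) ∈ B <;> simp [hω]
  calc
    _ = ∫⁻ z, ψ z.1 z.2 ∂((P.restrict {ω | X.T n ω ≤ (t : EReal)
          ∧ (t : EReal) < X.T (n + 1) ω}).map fun ω => (X.kinds ω n, X.pathUpTo e₀ n ω)) := by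
      rw [lintegral_map hψ' hZ]
    _ = _ := by
      rw [hmeas, lintegral_withDensity_eq_lintegral_mul _ hs hψ', lintegral_map (hs.mul hψ') hZ]
      exact lintegral_congr fun ω => mul_comm _ _

/-- The law of the next quake, given the previous quakes and their kinds. -/
lemma lintegral_next_quake_eq [IsProbabilityMeasure P] (hX : IsMotherQuakeModel R P X)
    (e₀ : E) (n : ℕ) {g : List QuakeKind → (ℕ → E × ℝ) → ℝ → E → QuakeKind → ℝ≥0∞}
    (hg : ∀ κ k, Measurable fun x : (ℕ → E × ℝ) × ℝ × E => g κ x.1 x.2.1 x.2.2 k) :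
    ∫⁻ ω in {ω | X.T (n + 1) ω ≠ ⊤}, g (X.kinds ω n) (X.pathUpTo e₀ n ω)
        (X.T (n + 1) ω).toReal (X.mark (n + 1) ω) (X.kind (n + 1) ω) ∂P
      = ∫⁻ s in Ioi (0 : ℝ), ∫⁻ u, ∫⁻ ω in {ω | X.T n ω ≤ (s : EReal)},
          (∑ k, g (X.kinds ω n) (X.pathUpTo e₀ n ω) s u k
              * R.rate (ofKinds (X.pathUpTo e₀ n ω) (X.kinds ω n)) u s k)
            * R.survival (X.pathUpTo e₀ n ω) (X.kinds ω n) s ∂P ∂ν ∂volume := by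
  have hG : ∀ κ, Measurable fun x : (ℕ → E × ℝ) × ℝ × E =>
      ∑ k, g κ x.1 x.2.1 x.2.2 k * (R.rate (ofKinds x.1 κ) x.2.2 x.2.1 k : ℝ≥0∞) := by
    intro κ
    refine Finset.measurable_sum _ fun k _ => (hg κ k).mul ?_
    exact ((R.measurable_rate κ k).comp (f := fun x : (ℕ → E × ℝ) × ℝ × E => (x.1, x.2.2, x.2.1))
      (by fun_prop)).coe_nnreal_ennreal
  have hF : Measurable fun x : (Ω × ℝ) × E =>
      {s : ℝ | X.T n x.1.1 ≤ (s : EReal) ∧ (s : EReal) < X.T (n + 1) x.1.1}.indicator (fun s => ∑ k,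
            g (X.kinds x.1.1 n) (X.pathUpTo e₀ n x.1.1) s x.2 k
              * (R.rate (ofKinds (X.pathUpTo e₀ n x.1.1) (X.kinds x.1.1 n)) x.2 s k : ℝ≥0∞))
          x.1.2 := by
    refine Measurable.indicator (s := {x : (Ω × ℝ) × E | X.T n x.1.1 ≤ (x.1.2 : EReal)
        ∧ (x.1.2 : EReal) < X.T (n + 1) x.1.1}) (f := fun x : (Ω × ℝ) × E => ∑ k,
            g (X.kinds x.1.1 n) (X.pathUpTo e₀ n x.1.1) x.1.2 x.2 k
              * (R.rate (ofKinds (X.pathUpTo e₀ n x.1.1) (X.kinds x.1.1 n)) x.2 x.1.2 k : ℝ≥0∞))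
          ?_ ?_
    · have h1 := X.measurable_pathUpTo e₀ n
      have h2 := X.measurable_kinds n
      exact measurable_comp_countable hG (κ := fun x : (Ω × ℝ) × E => X.kinds x.1.1 n)
        (f := fun x : (Ω × ℝ) × E => (X.pathUpTo e₀ n x.1.1, x.1.2, x.2))
        (h2.comp (measurable_fst.comp measurable_fst))
        ((h1.comp (measurable_fst.comp measurable_fst)).prodMk
          ((measurable_snd.comp measurable_fst).prodMk measurable_snd))
    · have h1 : Measurable fun x : (Ω × ℝ) × E => (x.1.2 : EReal) :=
        measurable_coe_real_ereal.comp (measurable_snd.comp measurable_fst)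
      exact (measurableSet_le ((X.measurable_T n).comp (measurable_fst.comp measurable_fst)) h1).inter
        (measurableSet_lt h1 ((X.measurable_T (n + 1)).comp (measurable_fst.comp measurable_fst)))
  have hD : MeasurableSet {ω | X.T (n + 1) ω ≠ ⊤} :=
    (X.measurable_T (n + 1) (measurableSet_singleton ⊤)).compl
  rw [← lintegral_indicator hD, hX.lintegral_next_quake e₀ n hg, lintegral_lintegral_swap]
  · refine lintegral_congr fun s => ?_
    rw [lintegral_lintegral_swap]
    · refine lintegral_congr fun u => ?_
      rw [← hX.lintegral_survival e₀ n s (ψ := fun κ y => ∑ k, g κ y s u k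
        * (R.rate (ofKinds y κ) u s k : ℝ≥0∞)) (fun κ => (hG κ).comp (f := fun y => (y, s, u)) (by fun_prop)),
        ← lintegral_indicator (measurableSet_T_le_lt X n s)]
      rfl
    · exact (hF.comp (f := fun x : Ω × E => ((x.1, s), x.2)) (by fun_prop)).aemeasurable
  · exact (Measurable.lintegral_prod_right' hF).aemeasurable

end IsMotherQuakeModel

namespace MotherQuakeRates

open ClusterHistory

variable {E : Type*} [MeasurableSpace E] {ν : Measure E} (R : MotherQuakeRates E ν)

/-- The integral of a function of the kinds of the first `n` quakes against the unnormalized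
conditional distribution of these kinds. -/
noncomputable def bayes (n : ℕ) (y : ℕ → E × ℝ) (f : List QuakeKind → (ℕ → E × ℝ) → ℝ≥0∞) :
    ℝ≥0∞ :=
  ∑ κ ∈ kindStrings n, R.weight y κ * f κ y

lemma measurable_bayes [SFinite ν] (n : ℕ) {f : List QuakeKind → (ℕ → E × ℝ) → ℝ≥0∞}
    (hf : ∀ κ, Measurable (f κ)) : Measurable fun y => R.bayes n y f :=
  Finset.measurable_sum _ fun κ _ => (R.measurable_weight κ).coe_nnreal_ennreal.mul (hf κ)

/-- Weighting with the likelihood of the next quake at time `s` with mark `u`. -/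
noncomputable def likelihoodStep (s : ℝ) (u : E) (f : List QuakeKind → (ℕ → E × ℝ) → ℝ≥0∞)
    (κ : List QuakeKind) (y : ℕ → E × ℝ) : ℝ≥0∞ :=
  R.survival y κ s * ∑ k, R.rate (ofKinds y κ) u s k
    * f (k :: κ) (Function.update y (κ.length + 1) (u, s))

lemma measurable_likelihoodStep [SFinite ν] (s : ℝ) (u : E)
    {f : List QuakeKind → (ℕ → E × ℝ) → ℝ≥0∞} (hf : ∀ κ, Measurable (f κ)) (κ : List QuakeKind) :
    Measurable (R.likelihoodStep s u f κ) := by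
  refine ((R.measurable_survival κ).comp (f := fun y => (y, s))
    (by fun_prop)).coe_nnreal_ennreal.mul (Finset.measurable_sum _ fun k _ => Measurable.mul ?_ ?_)
  · exact ((R.measurable_rate κ k).comp (f := fun y => (y, u, s)) (by fun_prop)).coe_nnreal_ennreal
  · exact (hf _).comp measurable_update_left

lemma bayes_succ_update (n : ℕ) (y : ℕ → E × ℝ) (s : ℝ) (u : E)
    (f : List QuakeKind → (ℕ → E × ℝ) → ℝ≥0∞) :
    R.bayes (n + 1) (Function.update y (n + 1) (u, s)) f = R.bayes n y (R.likelihoodStep s u f) := by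
  unfold bayes
  rw [sum_kindStrings_succ]
  refine Finset.sum_congr rfl fun κ hκ => ?_
  rw [mem_kindStrings] at hκ
  subst hκ
  unfold likelihoodStep
  simp only [Finset.mul_sum]
  refine Finset.sum_congr rfl fun k _ => ?_
  rw [R.weight_update]
  push_cast
  ring

end MotherQuakeRates

namespace IsMotherQuakeModel

open ClusterHistory MotherQuakeRates

variable {E Ω : Type*} [MeasurableSpace E] [MeasurableSpace Ω] {ν : Measure E} [SFinite ν]
  {R : MotherQuakeRates E ν} {P : Measure Ω} {X : QuakeProcess E Ω}

/-- Bayes' formula in symmetric form: `weight`, normalized, is the conditional distribution of the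
kinds of the first `n` quakes given their times and marks. -/
theorem lintegral_mul_bayes [IsProbabilityMeasure P] (hX : IsMotherQuakeModel R P X)
    (e₀ : E) (n : ℕ) {a b : List QuakeKind → (ℕ → E × ℝ) → ℝ≥0∞}
    (ha : ∀ κ, Measurable (a κ)) (hb : ∀ κ, Measurable (b κ)) :
    ∫⁻ ω in {ω | X.T n ω ≠ ⊤}, a (X.kinds ω n) (X.pathUpTo e₀ n ω)
        * R.bayes n (X.pathUpTo e₀ n ω) b ∂P
      = ∫⁻ ω in {ω | X.T n ω ≠ ⊤}, b (X.kinds ω n) (X.pathUpTo e₀ n ω)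
        * R.bayes n (X.pathUpTo e₀ n ω) a ∂P := by
  induction n generalizing a b with
  | zero =>
    refine lintegral_congr fun ω => ?_
    simp only [bayes, sum_kindStrings_zero, weight, QuakeProcess.kinds]
    ring
  | succ n ih =>
    have key : ∀ {a b : List QuakeKind → (ℕ → E × ℝ) → ℝ≥0∞}, (∀ κ, Measurable (a κ)) →
        (∀ κ, Measurable (b κ)) →
        ∫⁻ ω in {ω | X.T (n + 1) ω ≠ ⊤}, a (X.kinds ω (n + 1)) (X.pathUpTo e₀ (n + 1) ω)
          * R.bayes (n + 1) (X.pathUpTo e₀ (n + 1) ω) b ∂P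
        = ∫⁻ s in Ioi (0 : ℝ), ∫⁻ u, ∫⁻ ω in {ω | X.T n ω ≠ ⊤},
            {y : ℕ → E × ℝ | (y n).2 ≤ s}.indicator (R.likelihoodStep s u a (X.kinds ω n))
              (X.pathUpTo e₀ n ω) * R.bayes n (X.pathUpTo e₀ n ω) (fun κ =>
              {y : ℕ → E × ℝ | (y n).2 ≤ s}.indicator (R.likelihoodStep s u b κ)) ∂P ∂ν ∂volume := by
      intro a b ha hb
      have hupd : Measurable fun x : (ℕ → E × ℝ) × ℝ × E =>
          Function.update x.1 (n + 1) (x.2.2, x.2.1) := by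
        refine measurable_pi_iff.2 fun i => ?_
        by_cases hi : i = n + 1
        · subst hi
          simp only [Function.update_self]
          fun_prop
        · simp only [Function.update_of_ne hi]
          fun_prop
      have h := hX.lintegral_next_quake_eq e₀ n (g := fun κ y s u k =>
        a (k :: κ) (Function.update y (n + 1) (u, s))
          * R.bayes (n + 1) (Function.update y (n + 1) (u, s)) b) (fun κ k =>
          ((ha _).comp hupd).mul ((R.measurable_bayes (n + 1) hb).comp hupd))
      simp only [X.pathUpTo_succ, QuakeProcess.kinds]
      rw [h]
      refine lintegral_congr fun s => lintegral_congr fun u => ?_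
      have hD : MeasurableSet {ω | X.T n ω ≠ ⊤} :=
        (X.measurable_T n (measurableSet_singleton ⊤)).compl
      rw [← lintegral_indicator (measurableSet_T_le X n s), ← lintegral_indicator hD]
      refine lintegral_congr fun ω => ?_
      by_cases hle : ω ∈ {ω | X.T n ω ≤ (s : EReal)}
      · have htop : ω ∈ {ω | X.T n ω ≠ ⊤} :=
          ((show X.T n ω ≤ (s : EReal) from hle).trans_lt (EReal.coe_lt_top s)).ne
        have hmem : X.pathUpTo e₀ n ω ∈ {y : ℕ → E × ℝ | (y n).2 ≤ s} := by
          have h1 : X.T n ω ≤ (s : EReal) := hle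
          rw [← X.coe_toReal_T htop] at h1
          simp only [mem_ofPred_eq, X.pathUpTo_time]
          exact_mod_cast h1
        simp only [bayes, indicator_of_mem hle, indicator_of_mem htop, indicator_of_mem hmem]
        have hb' := R.bayes_succ_update n (X.pathUpTo e₀ n ω) s u b
        simp only [bayes] at hb'
        rw [hb']
        generalize ∑ κ ∈ kindStrings n, (R.weight (X.pathUpTo e₀ n ω) κ : ℝ≥0∞)
          * R.likelihoodStep s u b κ (X.pathUpTo e₀ n ω) = B
        simp only [likelihoodStep, X.length_kinds, Finset.sum_mul, Finset.mul_sum]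
        refine Finset.sum_congr rfl fun k _ => ?_
        ring
      · rw [indicator_of_notMem hle]
        refine (indicator_apply_eq_zero.2 fun htop => ?_).symm
        rw [indicator_of_notMem, zero_mul]
        intro hmem
        simp only [mem_ofPred_eq, X.pathUpTo_time] at hmem
        refine hle ?_
        change X.T n ω ≤ s
        rw [← X.coe_toReal_T htop]
        exact_mod_cast hmem
    rw [key ha hb, key hb ha]
    refine lintegral_congr fun s => lintegral_congr fun u => ?_
    have hS : MeasurableSet {y : ℕ → E × ℝ | (y n).2 ≤ s} :=
      measurableSet_le (by fun_prop) measurable_const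
    exact ih (a := fun κ => {y : ℕ → E × ℝ | (y n).2 ≤ s}.indicator (R.likelihoodStep s u a κ))
      (b := fun κ => {y : ℕ → E × ℝ | (y n).2 ≤ s}.indicator (R.likelihoodStep s u b κ))
      (fun κ => (R.measurable_likelihoodStep s u ha κ).indicator hS)
      (fun κ => (R.measurable_likelihoodStep s u hb κ).indicator hS)

/-- Bayes' formula at a fixed time between the quakes `n` and `n + 1`. -/
theorem lintegral_mul_bayes_survival [IsProbabilityMeasure P] (hX : IsMotherQuakeModel R P X)
    (e₀ : E) (n : ℕ) (t : ℝ) {a b : List QuakeKind → (ℕ → E × ℝ) → ℝ≥0∞}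
    (ha : ∀ κ, Measurable (a κ)) (hb : ∀ κ, Measurable (b κ)) :
    ∫⁻ ω in {ω | X.T n ω ≤ (t : EReal) ∧ (t : EReal) < X.T (n + 1) ω},
        a (X.kinds ω n) (X.pathUpTo e₀ n ω)
          * R.bayes n (X.pathUpTo e₀ n ω) (fun κ y => R.survival y κ t * b κ y) ∂P
      = ∫⁻ ω in {ω | X.T n ω ≤ (t : EReal) ∧ (t : EReal) < X.T (n + 1) ω},
        b (X.kinds ω n) (X.pathUpTo e₀ n ω)
          * R.bayes n (X.pathUpTo e₀ n ω) (fun κ y => R.survival y κ t * a κ y) ∂P := by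
  have hsa : ∀ κ, Measurable fun y => (R.survival y κ t : ℝ≥0∞) * a κ y :=
    fun κ => (measurable_survival_left R κ t).mul (ha κ)
  have hsb : ∀ κ, Measurable fun y => (R.survival y κ t : ℝ≥0∞) * b κ y :=
    fun κ => (measurable_survival_left R κ t).mul (hb κ)
  have hS : MeasurableSet {y : ℕ → E × ℝ | (y n).2 ≤ t} :=
    measurableSet_le (by fun_prop) measurable_const
  have hD : MeasurableSet {ω | X.T n ω ≠ ⊤} :=
    (X.measurable_T n (measurableSet_singleton ⊤)).compl
  have key : ∀ {a b : List QuakeKind → (ℕ → E × ℝ) → ℝ≥0∞}, (∀ κ, Measurable (a κ)) →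
      (∀ κ, Measurable (b κ)) →
      ∫⁻ ω in {ω | X.T n ω ≤ (t : EReal) ∧ (t : EReal) < X.T (n + 1) ω},
        a (X.kinds ω n) (X.pathUpTo e₀ n ω)
          * R.bayes n (X.pathUpTo e₀ n ω) b ∂P
      = ∫⁻ ω in {ω | X.T n ω ≠ ⊤}, {y : ℕ → E × ℝ | (y n).2 ≤ t}.indicator
          (fun y => R.survival y (X.kinds ω n) t * a (X.kinds ω n) y) (X.pathUpTo e₀ n ω)
          * R.bayes n (X.pathUpTo e₀ n ω) b ∂P := by
    intro a b ha hb
    rw [hX.lintegral_survival e₀ n t (ψ := fun κ y => a κ y * R.bayes n y b)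
      (fun κ => (ha κ).mul (R.measurable_bayes n hb)),
      ← lintegral_indicator (measurableSet_T_le X n t), ← lintegral_indicator hD]
    refine lintegral_congr fun ω => ?_
    by_cases hle : ω ∈ {ω | X.T n ω ≤ (t : EReal)}
    · have htop : ω ∈ {ω | X.T n ω ≠ ⊤} :=
        ((show X.T n ω ≤ (t : EReal) from hle).trans_lt (EReal.coe_lt_top t)).ne
      have hmem : X.pathUpTo e₀ n ω ∈ {y : ℕ → E × ℝ | (y n).2 ≤ t} := by
        have h1 : X.T n ω ≤ (t : EReal) := hle
        rw [← X.coe_toReal_T htop] at h1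
        simp only [mem_ofPred_eq, X.pathUpTo_time]
        exact_mod_cast h1
      rw [indicator_of_mem hle, indicator_of_mem htop, indicator_of_mem hmem]
      ring
    · rw [indicator_of_notMem hle]
      refine (indicator_apply_eq_zero.2 fun htop => ?_).symm
      rw [indicator_of_notMem, zero_mul]
      intro hmem
      simp only [mem_ofPred_eq, X.pathUpTo_time] at hmem
      refine hle ?_
      change X.T n ω ≤ t
      rw [← X.coe_toReal_T htop]
      exact_mod_cast hmem
  rw [key ha hsb, key hb hsa]
  have hsa' := fun κ => (hsa κ).indicator hS
  have hsb' := fun κ => (hsb κ).indicator hS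
  have h := hX.lintegral_mul_bayes e₀ n hsa' hsb'
  have hpull : ∀ (c d : List QuakeKind → (ℕ → E × ℝ) → ℝ≥0∞) (κ : List QuakeKind)
      (y : ℕ → E × ℝ),
      {y : ℕ → E × ℝ | (y n).2 ≤ t}.indicator (c κ) y * R.bayes n y d
      = {y : ℕ → E × ℝ | (y n).2 ≤ t}.indicator (c κ) y
        * R.bayes n y (fun κ => {y : ℕ → E × ℝ | (y n).2 ≤ t}.indicator (d κ)) := by
    intro c d κ y
    by_cases hy : y ∈ {y : ℕ → E × ℝ | (y n).2 ≤ t}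
    · simp only [bayes, indicator_of_mem hy]
    · simp only [indicator_of_notMem hy, zero_mul]
  rw [lintegral_congr fun ω => hpull (fun κ y => (R.survival y κ t : ℝ≥0∞) * a κ y) _ _ _,
    lintegral_congr fun ω => hpull (fun κ y => (R.survival y κ t : ℝ≥0∞) * b κ y) _ _ _]
  exact h

/-- Almost surely, no quake occurs with a mark and kind of intensity `0`. -/
lemma ae_rate_ne_zero [IsProbabilityMeasure P] (hX : IsMotherQuakeModel R P X) :
    ∀ᵐ ω ∂P, ∀ n, X.T (n + 1) ω ≠ ⊤ → R.rate (ofKinds (X.path ω) (X.kinds ω n))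
      (X.mark (n + 1) ω) (X.T (n + 1) ω).toReal (X.kind (n + 1) ω) ≠ 0 := by
  rcases isEmpty_or_nonempty Ω with hΩ | ⟨⟨ω₀⟩⟩
  · exact ae_of_all _ fun ω => (hΩ.false ω).elim
  have e₀ := X.mark 0 ω₀
  rw [ae_all_iff]
  intro n
  have hset : ∀ κ k, MeasurableSet {x : (ℕ → E × ℝ) × ℝ × E |
      R.rate (ofKinds x.1 κ) x.2.2 x.2.1 k = 0} := fun κ k =>
    ((R.measurable_rate κ k).comp (f := fun x : (ℕ → E × ℝ) × ℝ × E => (x.1, x.2.2, x.2.1))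
      (by fun_prop)) (measurableSet_singleton 0)
  have h := hX.lintegral_next_quake_eq e₀ n (g := fun κ y s u k =>
    {x : (ℕ → E × ℝ) × ℝ × E | R.rate (ofKinds x.1 κ) x.2.2 x.2.1 k = 0}.indicator 1 (y, s, u))
    (fun κ k => measurable_one.indicator (hset κ k))
  have hzero : ∀ κ (y : ℕ → E × ℝ) s u k, {x : (ℕ → E × ℝ) × ℝ × E |
      R.rate (ofKinds x.1 κ) x.2.2 x.2.1 k = 0}.indicator (1 : (ℕ → E × ℝ) × ℝ × E → ℝ≥0∞) (y, s, u)
        * R.rate (ofKinds y κ) u s k = 0 := by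
    intro κ y s u k
    by_cases hr : R.rate (ofKinds y κ) u s k = 0
    · simp [hr]
    · rw [indicator_of_notMem (by exact hr), zero_mul]
  simp only [hzero, Finset.sum_const_zero, zero_mul, lintegral_zero] at h
  have hD : MeasurableSet {ω | X.T (n + 1) ω ≠ ⊤} :=
    (X.measurable_T (n + 1) (measurableSet_singleton ⊤)).compl
  rw [lintegral_eq_zero_iff] at h
  · rw [EventuallyEq, ae_restrict_iff' hD] at h
    filter_upwards [h] with ω hω htop hr
    have h1 := hω htop
    rw [indicator_of_mem] at h1
    · exact one_ne_zero h1
    · have hc := ofKinds_congr (κ := X.kinds ω n) (y := X.pathUpTo e₀ n ω) (y' := X.path ω)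
        (by simpa using X.agreeUpTo_pathUpTo e₀ n ω)
      simpa only [mem_ofPred_eq, hc] using hr
  · refine measurable_comp_countable (g := fun (z : List QuakeKind × QuakeKind)
      (x : (ℕ → E × ℝ) × ℝ × E) => {x : (ℕ → E × ℝ) × ℝ × E |
        R.rate (ofKinds x.1 z.1) x.2.2 x.2.1 z.2 = 0}.indicator (1 : (ℕ → E × ℝ) × ℝ × E → ℝ≥0∞) x)
      (fun z => measurable_one.indicator (hset z.1 z.2))
      (κ := fun ω => (X.kinds ω n, X.kind (n + 1) ω))
      (f := fun ω => (X.pathUpTo e₀ n ω, (X.T (n + 1) ω).toReal, X.mark (n + 1) ω)) ?_ ?_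
    · exact (X.measurable_kinds n).prodMk (X.measurable_kind (n + 1))
    · exact (X.measurable_pathUpTo e₀ n).prodMk ((X.measurable_T (n + 1)).ereal_toReal.prodMk
        (X.measurable_mark (n + 1)))

/-- Almost surely, the actual kinds of the quakes have positive weight. -/
lemma ae_weight_ne_zero [IsProbabilityMeasure P] (hX : IsMotherQuakeModel R P X) :
    ∀ᵐ ω ∂P, ∀ n, X.T n ω ≠ ⊤ → R.weight (X.path ω) (X.kinds ω n) ≠ 0 := by
  filter_upwards [hX.ae_rate_ne_zero] with ω hω n
  induction n with
  | zero => intro _; simp [QuakeProcess.kinds, weight]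
  | succ n ih =>
    intro htop
    have h1 := ih (X.T_ne_top_of_le n.le_succ htop)
    have h2 := hω n htop
    simp only [QuakeProcess.kinds, weight, X.length_kinds]
    exact mul_ne_zero h1 (mul_ne_zero (R.survival_pos _ _ _).ne' h2)

end IsMotherQuakeModel

/-! ### Regular conditional distributions -/

section RegularConditional

variable {Ω Y : Type*} [MeasurableSpace Y] {m m0 : MeasurableSpace Ω}

/-- A random measure that is a conditional distribution on sets is one on integrable functions. -/
lemma integral_ae_eq_condExp_of_setLIntegral {P : Measure Ω} [IsProbabilityMeasure P] (hm : m ≤ m0)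
    {κ : Ω → Measure Y} (hκ : Measurable[m] κ)
    {Z : Ω → Y} (hZ : Measurable[m0] Z)
    (h : ∀ G, MeasurableSet[m] G → ∀ C, MeasurableSet C →
      ∫⁻ ω in G, κ ω C ∂P = P (G ∩ Z ⁻¹' C))
    {f : Y → ℝ} (hf : Measurable f) (hint : Integrable (fun ω => f (Z ω)) P) :
    (fun ω => ∫ y, f y ∂(κ ω)) =ᵐ[P] P[fun ω => f (Z ω) | m] := by
  let K : ProbabilityTheory.Kernel Ω Y := ⟨κ, hκ.mono hm le_rfl⟩
  let K' : @ProbabilityTheory.Kernel Ω Y m _ := @ProbabilityTheory.Kernel.mk Ω Y m _ κ hκ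
  have hbind : ∀ G, MeasurableSet[m] G → (P.restrict G).map Z = (P.restrict G).bind κ := by
    intro G hG
    ext C hC
    rw [Measure.map_apply hZ hC, Measure.restrict_apply (hZ hC),
      Measure.bind_apply hC (hκ.mono hm le_rfl).aemeasurable, h G hG C hC, inter_comm]
  have hcomp : ∀ G, (P.restrict G).bind κ
      = (K.comp (ProbabilityTheory.Kernel.const Unit (P.restrict G))) () := by
    intro G
    rw [ProbabilityTheory.Kernel.comp_apply]
    rfl
  have hfi : ∀ G, MeasurableSet[m] G →
      Integrable f ((K.comp (ProbabilityTheory.Kernel.const Unit (P.restrict G))) ()) := by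
    intro G hG
    rw [← hcomp, ← hbind G hG, integrable_map_measure hf.aestronglyMeasurable hZ.aemeasurable]
    exact hint.mono_measure Measure.restrict_le_self
  refine ae_eq_condExp_of_forall_setIntegral_eq hm hint (fun G hG _ => ?_) (fun G hG _ => ?_) ?_
  · exact (hfi G hG).integral_comp
  · have h1 := ProbabilityTheory.Kernel.integral_comp (hfi G hG)
    rw [← hcomp, ← hbind G hG, integral_map hZ.aemeasurable hf.aestronglyMeasurable] at h1
    exact h1.symm
  · exact (@StronglyMeasurable.integral_kernel Ω Y m _ K' ℝ _ _ f
      hf.stronglyMeasurable).aestronglyMeasurable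

/-- Right-continuous conditional distributions are unique up to indistinguishability. -/
lemma ae_eq_of_forall_ae_eq_of_rightContinuous [MeasurableSpace.CountablyGenerated Y]
    {P : Measure Ω} {κ η : ℝ → Ω → Measure Y}
    (hκ : ∀ t, 0 ≤ t → ∀ ω, IsProbabilityMeasure (κ t ω))
    (hη : ∀ t, 0 ≤ t → ∀ ω, IsProbabilityMeasure (η t ω))
    (hκc : ∀ᵐ ω ∂P, ∀ B, MeasurableSet B → ∀ t, 0 ≤ t →
      ContinuousWithinAt (fun s => κ s ω B) (Ici t) t)
    (hηc : ∀ᵐ ω ∂P, ∀ B, MeasurableSet B → ∀ t, 0 ≤ t →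
      ContinuousWithinAt (fun s => η s ω B) (Ici t) t)
    (h : ∀ t, 0 ≤ t → ∀ B, MeasurableSet B → ∀ᵐ ω ∂P, κ t ω B = η t ω B) :
    ∀ᵐ ω ∂P, ∀ t, 0 ≤ t → κ t ω = η t ω := by
  let S := generateSetAlgebra (MeasurableSpace.countableGeneratingSet Y)
  have hSc : S.Countable :=
    countable_generateSetAlgebra MeasurableSpace.countable_countableGeneratingSet
  have hgen : MeasurableSpace.generateFrom S = ‹MeasurableSpace Y› := by
    rw [generateFrom_generateSetAlgebra_eq, MeasurableSpace.generateFrom_countableGeneratingSet]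
  have hSm : ∀ B ∈ S, MeasurableSet B := fun B hB =>
    hgen.le B (MeasurableSpace.measurableSet_generateFrom hB)
  have h1 : ∀ᵐ ω ∂P, ∀ B ∈ S, ∀ q : ℚ, (0 : ℝ) ≤ q → κ q ω B = η q ω B := by
    rw [ae_ball_iff hSc]
    intro B hB
    rw [ae_all_iff]
    intro q
    by_cases hq : (0 : ℝ) ≤ q
    · filter_upwards [h q hq B (hSm B hB)] with ω hω _ using hω
    · exact ae_of_all _ fun ω h => (hq h).elim
  filter_upwards [h1, hκc, hηc] with ω h1 hκc hηc t ht
  have := hκ t ht ω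
  have := hη t ht ω
  refine MeasureTheory.ext_of_generate_finite S hgen.symm
    (fun s hs t ht _ => isSetAlgebra_generateSetAlgebra.inter_mem hs ht) ?_ (by simp)
  · intro B hB
    have hκ' := (hκc B (hSm B hB) t ht).tendsto.mono_left (nhdsWithin_mono t Ioi_subset_Ici_self)
    have hη' := (hηc B (hSm B hB) t ht).tendsto.mono_left (nhdsWithin_mono t Ioi_subset_Ici_self)
    have hfreq : ∃ᶠ s in 𝓝[>] t, κ s ω B = η s ω B := by
      rw [frequently_iff]
      intro U hU
      obtain ⟨b, hb, hbU⟩ := mem_nhdsGT_iff_exists_Ioo_subset.1 hU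
      obtain ⟨q, hq1, hq2⟩ := exists_rat_btwn (show t < b from hb)
      exact ⟨q, hbU ⟨hq1, hq2⟩, h1 B hB q (ht.trans hq1.le)⟩
    obtain ⟨s, hs, hse⟩ := (frequently_iff_seq_forall.1 hfreq)
    exact tendsto_nhds_unique (hκ'.comp hs)
      ((hη'.comp hs).congr fun n => (hse n).symm)

end RegularConditional

/-! ### The filter -/

namespace MotherQuakeRates

open ClusterHistory

variable {E : Type*} [MeasurableSpace E] {ν : Measure E} (R : MotherQuakeRates E ν)

/-- The normalizing constant of the filter. -/
noncomputable def filterMass (y : ℕ → E × ℝ) (n : ℕ) (t : ℝ) : ℝ≥0 :=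
  ∑ κ ∈ kindStrings n, R.weight y κ * R.survival y κ t

open Classical in
/-- The conditional distribution of the cluster history at time `t` given the observations
`y 1, …, y n` up to `t`. -/
noncomputable def filterMeasure (y : ℕ → E × ℝ) (n : ℕ) (t : ℝ) : Measure (ClusterHistory E) :=
  if R.filterMass y n t = 0 then Measure.dirac [] else
    (R.filterMass y n t)⁻¹ •
      ∑ κ ∈ kindStrings n, (R.weight y κ * R.survival y κ t) • Measure.dirac (ofKinds y κ)

lemma filterMeasure_apply {y : ℕ → E × ℝ} {n : ℕ} {t : ℝ} (h : R.filterMass y n t ≠ 0)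
    {C : Set (ClusterHistory E)} (hC : MeasurableSet C) :
    R.filterMeasure y n t C = (((R.filterMass y n t)⁻¹ * ∑ κ ∈ kindStrings n,
      R.weight y κ * R.survival y κ t * C.indicator 1 (ofKinds y κ) : ℝ≥0) : ℝ≥0∞) := by
  rw [filterMeasure, if_neg h]
  simp only [Measure.smul_apply, Measure.coe_finsetSum, Finset.sum_apply, Measure.dirac_apply' _ hC,
    ENNReal.smul_def, smul_eq_mul]
  push_cast
  congr 1

lemma isProbabilityMeasure_filterMeasure (y : ℕ → E × ℝ) (n : ℕ) (t : ℝ) :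
    IsProbabilityMeasure (R.filterMeasure y n t) := by
  by_cases h : R.filterMass y n t = 0
  · rw [filterMeasure, if_pos h]
    infer_instance
  · refine ⟨?_⟩
    rw [R.filterMeasure_apply h MeasurableSet.univ]
    have : ∑ κ ∈ kindStrings n, R.weight y κ * R.survival y κ t
        * (univ : Set (ClusterHistory E)).indicator 1 (ofKinds y κ) = R.filterMass y n t := by
      simp [filterMass]
    rw [this, inv_mul_cancel₀ h, ENNReal.coe_one]

lemma integrable_filterMeasure [MeasurableSingletonClass E] (y : ℕ → E × ℝ) (n : ℕ) (t : ℝ)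
    (f : ClusterHistory E → ℝ) : Integrable f (R.filterMeasure y n t) := by
  unfold filterMeasure
  split_ifs
  · exact integrable_dirac (by simp)
  · refine Integrable.smul_measure_nnreal ?_
    refine integrable_finsetSum_measure.2 fun κ _ => ?_
    exact (integrable_dirac (by simp)).smul_measure_nnreal

lemma integral_filterMeasure [MeasurableSingletonClass E] {y : ℕ → E × ℝ} {n : ℕ} {t : ℝ}
    (h : R.filterMass y n t ≠ 0) (f : ClusterHistory E → ℝ) :
    ∫ l, f l ∂(R.filterMeasure y n t) = (∑ κ ∈ kindStrings n,
      (R.weight y κ : ℝ) * R.survival y κ t * f (ofKinds y κ)) / R.filterMass y n t := by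
  rw [filterMeasure, if_neg h, integral_smul_nnreal_measure, integral_finsetSum_measure]
  · simp only [integral_smul_nnreal_measure, integral_dirac, NNReal.smul_def, smul_eq_mul]
    push_cast
    rw [div_eq_inv_mul]
  · exact fun κ _ => (integrable_dirac (by simp)).smul_measure_nnreal

lemma measurable_filterMass [SFinite ν] (n : ℕ) (t : ℝ) :
    Measurable fun y => R.filterMass y n t :=
  Finset.measurable_sum _ fun κ _ => (R.measurable_weight κ).mul
    ((R.measurable_survival κ).comp (f := fun y => (y, t)) (by fun_prop))

lemma measurable_filterMeasure [SFinite ν] (n : ℕ) (t : ℝ) :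
    Measurable fun y => R.filterMeasure y n t := by
  classical
  refine Measure.measurable_of_measurable_coe _ fun C hC => ?_
  have heq : (fun y => R.filterMeasure y n t C) = fun y => if R.filterMass y n t = 0
      then Measure.dirac [] C else (((R.filterMass y n t)⁻¹ * ∑ κ ∈ kindStrings n,
      R.weight y κ * R.survival y κ t * C.indicator 1 (ofKinds y κ) : ℝ≥0) : ℝ≥0∞) := by
    funext y
    split_ifs with h
    · rw [filterMeasure, if_pos h]
    · exact R.filterMeasure_apply h hC
  rw [heq]
  refine Measurable.ite (R.measurable_filterMass n t (measurableSet_singleton 0))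
    measurable_const (Measurable.coe_nnreal_ennreal ?_)
  refine (R.measurable_filterMass n t).inv.mul (Finset.measurable_sum _ fun κ _ => ?_)
  refine ((R.measurable_weight κ).mul
    ((R.measurable_survival κ).comp (f := fun y => (y, t)) (by fun_prop))).mul ?_
  exact (measurable_one.indicator hC).comp (measurable_ofKinds κ)

lemma filterMeasure_congr {n : ℕ} {y y' : ℕ → E × ℝ} (h : AgreeUpTo n y y') (t : ℝ) :
    R.filterMeasure y n t = R.filterMeasure y' n t := by
  have hmass : R.filterMass y n t = R.filterMass y' n t :=
    Finset.sum_congr rfl fun κ hκ => by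
      rw [mem_kindStrings] at hκ
      subst hκ
      rw [R.weight_congr h, R.survival_congr h]
  unfold filterMeasure
  rw [hmass]
  congr 2
  refine Finset.sum_congr rfl fun κ hκ => ?_
  rw [mem_kindStrings] at hκ
  subst hκ
  rw [R.weight_congr h, R.survival_congr h, ofKinds_congr h]

lemma filterMass_ne_zero {y : ℕ → E × ℝ} {n : ℕ} {κ : List QuakeKind} (hκ : κ ∈ kindStrings n)
    (h : R.weight y κ ≠ 0) (t : ℝ) : R.filterMass y n t ≠ 0 := by
  intro h0
  have := (Finset.sum_eq_zero_iff.1 h0) κ hκ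
  exact mul_ne_zero h (R.survival_pos y κ t).ne' this

lemma intervalIntegrable_totalRate [SFinite ν] {y : ℕ → E × ℝ} {κ : List QuakeKind}
    (hy : IncreasingUpTo κ.length y) {t : ℝ} (ht : (y κ.length).2 ≤ t) :
    IntervalIntegrable (fun s => (R.totalRate y κ s).toReal) volume (y κ.length).2 t := by
  rw [intervalIntegrable_iff_integrableOn_Ioc_of_le ht]
  exact integrable_toReal_of_lintegral_ne_top ((R.measurable_totalRate κ).comp
    (f := fun s => (y, s)) (by fun_prop)).aemeasurable (R.cumRate_ne_top hy t)

lemma toReal_cumRate [SFinite ν] {y : ℕ → E × ℝ} {κ : List QuakeKind}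
    (hy : IncreasingUpTo κ.length y) {t : ℝ} (ht : (y κ.length).2 ≤ t) :
    (R.cumRate y κ t).toReal = ∫ s in (y κ.length).2..t, (R.totalRate y κ s).toReal := by
  have hm : Measurable (R.totalRate y κ) :=
    (R.measurable_totalRate κ).comp (f := fun s => (y, s)) (by fun_prop)
  rw [intervalIntegral.integral_of_le ht, integral_toReal hm.aemeasurable]
  · rfl
  · exact ae_lt_top hm (R.cumRate_ne_top hy t)

lemma continuousOn_survival [SFinite ν] {y : ℕ → E × ℝ} {κ : List QuakeKind}
    (hy : IncreasingUpTo κ.length y) : ContinuousOn (R.survival y κ) (Ici (y κ.length).2) := by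
  intro t ht
  have hsub : Icc (y κ.length).2 (t + 1) ∈ 𝓝[Ici (y κ.length).2] t := by
    rw [← Ici_inter_Iic]
    exact inter_mem_nhdsWithin _ (Iic_mem_nhds (by linarith))
  refine ContinuousWithinAt.mono_of_mem_nhdsWithin ?_ hsub
  have hle : (y κ.length).2 ≤ t + 1 := by have : (y κ.length).2 ≤ t := ht; linarith
  have hc := intervalIntegral.continuousOn_primitive_interval'
    (R.intervalIntegrable_totalRate hy hle) left_mem_uIcc
  rw [uIcc_of_le hle] at hc
  have hc' : ContinuousOn (fun s => (R.cumRate y κ s).toReal) (Icc (y κ.length).2 (t + 1)) :=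
    hc.congr fun s hs => R.toReal_cumRate hy hs.1
  have ht' : t ∈ Icc (y κ.length).2 (t + 1) := ⟨ht, by linarith⟩
  exact (continuous_real_toNNReal.comp Real.continuous_exp).continuousAt.comp_continuousWithinAt
    (hc' t ht').neg

lemma continuousOn_filterMeasure [SFinite ν] {y : ℕ → E × ℝ} {n : ℕ} (hy : IncreasingUpTo n y)
    (hmass : ∀ t, R.filterMass y n t ≠ 0) {C : Set (ClusterHistory E)} (hC : MeasurableSet C) :
    ContinuousOn (fun t => R.filterMeasure y n t C) (Ici (y n).2) := by
  have hs : ∀ κ ∈ kindStrings n, ContinuousOn (R.survival y κ) (Ici (y n).2) := by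
    intro κ hκ
    rw [mem_kindStrings] at hκ
    subst hκ
    exact R.continuousOn_survival hy
  simp only [fun t => R.filterMeasure_apply (hmass t) hC]
  refine ENNReal.continuous_coe.comp_continuousOn (ContinuousOn.mul (ContinuousOn.inv₀ ?_
    fun t _ => hmass t) ?_)
  · exact continuousOn_finsetSum _ fun κ hκ => continuousOn_const.mul (hs κ hκ)
  · exact continuousOn_finsetSum _ fun κ hκ =>
      (continuousOn_const.mul (hs κ hκ)).mul continuousOn_const

end MotherQuakeRates

namespace QuakeProcess

open ClusterHistory

variable {E Ω : Type*} [MeasurableSpace E] [mΩ : MeasurableSpace Ω] (X : QuakeProcess E Ω)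

/-- Marks and times of the quakes up to time `t`. -/
noncomputable def stoppedPath (e₀ : E) (t : ℝ) (ω : Ω) (i : ℕ) : E × ℝ :=
  if 1 ≤ i ∧ X.T i ω ≤ (t : EReal) then X.path ω i else (e₀, 0)

/-- The number of quakes up to time `t`. -/
noncomputable def count (t : ℝ) (ω : Ω) : ℕ :=
  Set.ncard {n : ℕ | 1 ≤ n ∧ X.T n ω ≤ (t : EReal)}

lemma count_eq {n : ℕ} {ω : Ω} {t : ℝ} (h : X.T n ω ≤ t) (h' : t < X.T (n + 1) ω) :
    X.count t ω = n :=
  X.ncard_eq (p := fun a => a ≤ (t : EReal)) (fun _ _ hab hb => hab.trans hb) (Or.inr h)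
    (not_le.2 h')

lemma count_eq_iff {n : ℕ} {ω : Ω} {t : ℝ} (ht : 0 ≤ t) :
    X.count t ω = n ↔ X.T n ω ≤ t ∧ t < X.T (n + 1) ω := by
  refine ⟨fun h => ?_, fun h => X.count_eq h.1 h.2⟩
  obtain ⟨m, hm, hm'⟩ := X.exists_T_le_lt ω ht
  rw [X.count_eq hm hm'] at h
  exact h ▸ ⟨hm, hm'⟩

lemma stoppedPath_eq (e₀ : E) {n : ℕ} {ω : Ω} {t : ℝ} (h : X.T n ω ≤ t)
    (h' : t < X.T (n + 1) ω) : X.stoppedPath e₀ t ω = X.pathUpTo e₀ n ω := by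
  funext i
  have : X.T i ω ≤ (t : EReal) ↔ i ≤ n := by
    refine ⟨fun hi => ?_, fun hi => (X.T_mono ω hi).trans h⟩
    by_contra hlt
    exact absurd (h'.trans_le ((X.T_mono ω (show n + 1 ≤ i by lia)).trans hi)) (lt_irrefl _)
  simp [stoppedPath, pathUpTo, this]

lemma measurableSet_T_le_obs (n : ℕ) (t : ℝ≥0) :
    MeasurableSet[X.obsFiltration t] {ω | X.T n ω ≤ ((t : ℝ) : EReal)} := by
  rcases Nat.eq_zero_or_pos n with rfl | hn
  · have : {ω | X.T 0 ω ≤ ((t : ℝ) : EReal)} = univ := by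
      ext ω
      simp only [X.T_zero, mem_ofPred_eq, mem_univ, iff_true]
      exact_mod_cast t.2
    rw [this]
    exact MeasurableSet.univ
  · have := measurableSet_pointFiltration (hT := X.measurable_T) (hX := X.measurable_mark) hn
      (le_refl t) MeasurableSet.univ
    convert this using 1
    · rfl
    · ext ω
      simp

lemma measurable_stoppedPath (e₀ : E) (t : ℝ≥0) :
    Measurable[X.obsFiltration t] (X.stoppedPath e₀ t) := by
  classical
  refine (@measurable_pi_iff _ _ _ (X.obsFiltration t) _ _).2 fun i => ?_
  by_cases hi : 1 ≤ i
  swap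
  · simp only [stoppedPath, hi, false_and, if_false]
    exact @measurable_const _ _ _ (X.obsFiltration t) _
  convert measurable_ite_point (mα := X.obsFiltration t) (D := {ω | X.T i ω ≤ ((t : ℝ) : EReal)})
    (m := fun ω => X.mark i ω) (τ := fun ω => X.T i ω) e₀ (X.measurableSet_T_le_obs i t)
    (fun A hA => ?_) (fun c => ?_) (fun ω => X.T_nonneg i ω)
    (fun ω hω => (hω.trans_lt (EReal.coe_lt_top _)).ne) using 1
  · funext ω
    by_cases hx : X.T i ω ≤ ((t : ℝ) : EReal) <;> simp [stoppedPath, path, hi, hx]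
  · exact measurableSet_pointFiltration (hT := X.measurable_T) (hX := X.measurable_mark) hi
      (le_refl t) hA
  · have := measurableSet_pointFiltration (hT := X.measurable_T) (hX := X.measurable_mark) hi
      (min_le_left t c) MeasurableSet.univ
    convert this using 1
    · rfl
    · ext ω
      rcases le_total t c with h | h
      · simp only [min_eq_left h, mem_inter_iff, mem_ofPred_eq, mem_univ, and_true,
          and_iff_left_iff_imp]
        exact fun h1 => h1.trans (by exact_mod_cast h)
      · simp only [min_eq_right h, mem_inter_iff, mem_ofPred_eq, mem_univ, and_true,
          and_iff_right_iff_imp]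
        exact fun h1 => h1.trans (by exact_mod_cast h)

lemma measurable_count (t : ℝ≥0) : Measurable[X.obsFiltration t] (X.count t) := by
  refine @measurable_to_countable' _ _ _ _ (X.obsFiltration t) _ fun n => ?_
  have : X.count t ⁻¹' {n} = {ω | X.T n ω ≤ ((t : ℝ) : EReal)}
      ∩ {ω | X.T (n + 1) ω ≤ ((t : ℝ) : EReal)}ᶜ := by
    ext ω
    simp [X.count_eq_iff t.coe_nonneg]
  rw [this]
  exact (X.measurableSet_T_le_obs n t).inter (X.measurableSet_T_le_obs (n + 1) t).compl

/-- Between two quakes, an observable event is determined by the previous quakes. -/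
lemma exists_measurableSet_path (e₀ : E) (t : ℝ≥0) (n : ℕ) {G : Set Ω}
    (hG : MeasurableSet[X.obsFiltration t] G) :
    ∃ B : Set (ℕ → E × ℝ), MeasurableSet B ∧ ∀ ω, X.T n ω ≤ ((t : ℝ) : EReal) →
      ((t : ℝ) : EReal) < X.T (n + 1) ω → (ω ∈ G ↔ X.pathUpTo e₀ n ω ∈ B) := by
  induction G, hG using MeasurableSpace.generateFrom_induction with
  | hC G hG =>
    obtain ⟨m, s, A, hm, hs, hA, rfl⟩ := hG
    by_cases hmn : m ≤ n
    · refine ⟨{y | (y m).2 ≤ s ∧ (y m).1 ∈ A}, ?_, fun ω h h' => ?_⟩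
      · have h1 : Measurable fun y : ℕ → E × ℝ => (y m).2 := by fun_prop
        have h2 : Measurable fun y : ℕ → E × ℝ => (y m).1 := by fun_prop
        exact (measurableSet_le h1 measurable_const).inter (h2 hA)
      · have htop : X.T m ω ≠ ⊤ :=
          (((X.T_mono ω hmn).trans h).trans_lt (EReal.coe_lt_top _)).ne
        have : X.T m ω ≤ ((s : ℝ) : EReal) ↔ (X.T m ω).toReal ≤ s := by
          conv_lhs => rw [← X.coe_toReal_T htop]
          exact EReal.coe_le_coe_iff
        simp [pathUpTo, path, hm, hmn, this]
    · refine ⟨∅, MeasurableSet.empty, fun ω h h' => ?_⟩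
      simp only [mem_ofPred_eq, mem_empty_iff_false, iff_false, not_and]
      intro h1
      have h2 : X.T (n + 1) ω ≤ X.T m ω := X.T_mono ω (by lia)
      have h3 : ((s : ℝ) : EReal) ≤ ((t : ℝ) : EReal) := by exact_mod_cast hs
      exact absurd (h'.trans_le (h2.trans (h1.trans h3))) (lt_irrefl _)
  | empty => exact ⟨∅, MeasurableSet.empty, fun ω _ _ => by simp⟩
  | compl G _ ih =>
    obtain ⟨B, hB, h⟩ := ih
    exact ⟨Bᶜ, hB.compl, fun ω h1 h2 => by simp [h ω h1 h2]⟩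
  | iUnion G _ ih =>
    choose B hB h using ih
    exact ⟨⋃ i, B i, MeasurableSet.iUnion hB, fun ω h1 h2 => by simp [h _ ω h1 h2]⟩

variable {ν : Measure E} (R : MotherQuakeRates E ν)

/-- The filter, as an explicit function of the observations. -/
noncomputable def filter (e₀ : E) (t : ℝ) (ω : Ω) : Measure (ClusterHistory E) :=
  R.filterMeasure (X.stoppedPath e₀ t ω) (X.count t ω) t

lemma filter_eq (e₀ : E) {n : ℕ} {ω : Ω} {t : ℝ} (h : X.T n ω ≤ t) (h' : t < X.T (n + 1) ω) :
    X.filter R e₀ t ω = R.filterMeasure (X.path ω) n t := by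
  rw [filter, X.count_eq h h', X.stoppedPath_eq e₀ h h']
  exact R.filterMeasure_congr (X.agreeUpTo_pathUpTo e₀ n ω) t

lemma measurable_filter [SFinite ν] (e₀ : E) (t : ℝ≥0) :
    Measurable[X.obsFiltration t] (X.filter R e₀ t) := by
  exact measurable_comp_countable (mα := X.obsFiltration t) (g := fun n y => R.filterMeasure y n t)
    (fun n => R.measurable_filterMeasure n t) (X.measurable_count t) (X.measurable_stoppedPath e₀ t)

lemma measurable_hist (t : ℝ) : Measurable (X.hist t) := by
  have hc : Measurable (X.count t) := by
    rcases le_or_gt 0 t with ht | ht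
    · exact (X.measurable_count ⟨t, ht⟩).mono ((X.obsFiltration).le _) le_rfl
    · have : ∀ ω, X.count t ω = 0 := by
        intro ω
        have : {n : ℕ | 1 ≤ n ∧ X.T n ω ≤ (t : EReal)} = ∅ := by
          ext n
          simp only [mem_ofPred_eq, mem_empty_iff_false, iff_false, not_and, not_le]
          exact fun _ => lt_of_lt_of_le (by exact_mod_cast ht) (X.T_nonneg n ω)
        rw [count, this, Set.ncard_empty]
      rw [show X.count t = fun _ => 0 from funext this]
      exact measurable_const
  exact measurable_comp_countable (g := fun n ω => X.clusterHist ω n) X.measurable_clusterHist hc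
    measurable_id

end QuakeProcess

namespace IsMotherQuakeModel

open ClusterHistory MotherQuakeRates

variable {E Ω : Type*} [MeasurableSpace E] [MeasurableSpace Ω] {ν : Measure E} [SFinite ν]
  {R : MotherQuakeRates E ν} {P : Measure Ω} [IsProbabilityMeasure P] {X : QuakeProcess E Ω}

lemma ae_filterMass_ne_zero (hX : IsMotherQuakeModel R P X) :
    ∀ᵐ ω ∂P, ∀ n, X.T n ω ≠ ⊤ → ∀ t, R.filterMass (X.path ω) n t ≠ 0 := by
  filter_upwards [hX.ae_weight_ne_zero] with ω hω n hn t
  exact R.filterMass_ne_zero (X.kinds_mem ω n) (hω n hn) t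

lemma setLIntegral_filter (hX : IsMotherQuakeModel R P X) (e₀ : E) (t : ℝ≥0) {G : Set Ω}
    (hG : MeasurableSet[X.obsFiltration t] G) {C : Set (ClusterHistory E)} (hC : MeasurableSet C) :
    ∫⁻ ω in G, X.filter R e₀ t ω C ∂P = P (G ∩ X.hist t ⁻¹' C) := by
  have hG' : MeasurableSet G := X.obsFiltration.le t G hG
  have hhist : MeasurableSet (X.hist t ⁻¹' C) := X.measurable_hist t hC
  let S : ℕ → Set Ω := fun n => {ω | X.T n ω ≤ ((t : ℝ) : EReal) ∧ ((t : ℝ) : EReal) < X.T (n + 1) ω}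
  have hSm : ∀ n, MeasurableSet (S n) := fun n => measurableSet_T_le_lt X n t
  have hSu : ⋃ n, S n = univ :=
    eq_univ_of_forall fun ω => mem_iUnion.2 (X.exists_T_le_lt ω t.coe_nonneg)
  have hSd : Pairwise (Function.onFun Disjoint S) := by
    intro m n hmn
    refine Set.disjoint_left.2 fun ω hm hn => hmn ?_
    exact X.T_index_unique hm.1 hm.2 hn.1 hn.2
  have hsplit : ∀ f : Ω → ℝ≥0∞, ∫⁻ ω, f ω ∂P = ∑' n, ∫⁻ ω in S n, f ω ∂P := by
    intro f
    rw [← setLIntegral_univ, ← hSu, lintegral_iUnion hSm hSd]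
  rw [← lintegral_indicator hG', ← lintegral_indicator_one (hG'.inter hhist), hsplit, hsplit]
  refine tsum_congr fun n => ?_
  obtain ⟨B, hB, hBG⟩ := X.exists_measurableSet_path e₀ t n hG
  let a : List QuakeKind → (ℕ → E × ℝ) → ℝ≥0∞ := fun κ y =>
    C.indicator 1 (ofKinds y κ) * (B.indicator 1 y * (R.filterMass y n t : ℝ≥0∞)⁻¹)
  have ha : ∀ κ, Measurable (a κ) := fun κ =>
    ((measurable_one.indicator hC).comp (measurable_ofKinds κ)).mul
      ((measurable_one.indicator hB).mul (R.measurable_filterMass n t).coe_nnreal_ennreal.inv)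
  have h := hX.lintegral_mul_bayes_survival e₀ n t ha (b := fun _ _ => 1) fun _ => measurable_const
  have hmass : ∀ᵐ ω ∂P.restrict (S n), R.filterMass (X.pathUpTo e₀ n ω) n t ≠ 0 := by
    rw [ae_restrict_iff' (hSm n)]
    filter_upwards [hX.ae_weight_ne_zero] with ω hω hS
    refine R.filterMass_ne_zero (X.kinds_mem ω n) ?_ t
    rw [R.weight_congr (y' := X.path ω) (by simpa using X.agreeUpTo_pathUpTo e₀ n ω)]
    exact hω n (hS.1.trans_lt (EReal.coe_lt_top _)).ne
  have hbayes : ∀ y, R.bayes n y (fun κ y => R.survival y κ t * 1) = (R.filterMass y n t : ℝ≥0∞) := by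
    intro y
    simp [bayes, filterMass]
  rw [eq_comm]
  refine Eq.trans ?_ (h.trans ?_)
  · refine lintegral_congr_ae ?_
    filter_upwards [hmass, ae_restrict_mem (hSm n)] with ω hm hS
    have hm' : (R.filterMass (X.pathUpTo e₀ n ω) n t : ℝ≥0∞) ≠ 0 := by exact_mod_cast hm
    rw [hbayes, mul_assoc, mul_assoc, ENNReal.inv_mul_cancel hm' ENNReal.coe_ne_top, mul_one]
    have h1 : (ω ∈ G ↔ X.pathUpTo e₀ n ω ∈ B) := hBG ω hS.1 hS.2
    have h2 : X.hist t ω = ofKinds (X.pathUpTo e₀ n ω) (X.kinds ω n) := by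
      rw [X.hist_eq hS.1 hS.2, X.clusterHist_eq_pathUpTo e₀]
    by_cases hGω : ω ∈ G
    · by_cases hCω : X.hist t ω ∈ C
      · have hB' := h1.1 hGω
        simp [hGω, hCω, ← h2, hB']
      · simp [hCω, ← h2]
    · have hB' : X.pathUpTo e₀ n ω ∉ B := fun h => hGω (h1.2 h)
      rw [indicator_of_notMem fun h => hGω h.1]
      simp [indicator_of_notMem hB']
  · refine lintegral_congr_ae ?_
    filter_upwards [hmass, ae_restrict_mem (hSm n)] with ω hm hS
    have h1 : (ω ∈ G ↔ X.pathUpTo e₀ n ω ∈ B) := hBG ω hS.1 hS.2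
    have hf : X.filter R e₀ t ω = R.filterMeasure (X.pathUpTo e₀ n ω) n t := by
      rw [QuakeProcess.filter, X.count_eq hS.1 hS.2, X.stoppedPath_eq e₀ hS.1 hS.2]
    by_cases hGω : ω ∈ G
    · rw [indicator_of_mem hGω, hf, R.filterMeasure_apply hm hC, one_mul]
      simp only [bayes, a, indicator_of_mem (h1.1 hGω)]
      push_cast
      rw [Finset.mul_sum, ENNReal.coe_inv hm]
      refine Finset.sum_congr rfl fun κ _ => ?_
      by_cases hκ : ofKinds (X.pathUpTo e₀ n ω) κ ∈ C
      · simp [hκ]; ring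
      · simp [hκ]
    · have hB' : X.pathUpTo e₀ n ω ∉ B := fun h => hGω (h1.2 h)
      rw [indicator_of_notMem hGω]
      simp [bayes, a, indicator_of_notMem hB']

theorem isMotherQuakeFilter_filter (hX : IsMotherQuakeModel R P X) (e₀ : E) :
    IsMotherQuakeFilter P X (X.filter R e₀) where
  isProbabilityMeasure _ _ _ := R.isProbabilityMeasure_filterMeasure _ _ _
  adapted t := X.measurable_filter R e₀ t
  condExp_eq t f hf hint :=
    integral_ae_eq_condExp_of_setLIntegral (X.obsFiltration.le t) (X.measurable_filter R e₀ t)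
      (X.measurable_hist t) (fun _ hG _ hC => hX.setLIntegral_filter e₀ t hG hC) hf hint
  right_continuous := by
    filter_upwards [hX.ae_filterMass_ne_zero] with ω hω B hB t ht
    obtain ⟨n, hn, hn'⟩ := X.exists_T_le_lt ω ht
    have htop : X.T n ω ≠ ⊤ := (hn.trans_lt (EReal.coe_lt_top t)).ne
    have hc := R.continuousOn_filterMeasure (X.increasingUpTo_path htop) (hω n htop) hB
    have hle : (X.path ω n).2 ≤ t := by
      rw [← X.coe_toReal_T htop] at hn
      exact_mod_cast hn
    refine ((hc t hle).mono (Ici_subset_Ici.2 hle)).congr_of_eventuallyEq ?_ ?_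
    · have hev : ∀ᶠ s : ℝ in 𝓝 t, (s : EReal) < X.T (n + 1) ω :=
        continuous_coe_real_ereal.continuousAt.eventually_lt_const hn'
      filter_upwards [mem_nhdsWithin_of_mem_nhds hev, self_mem_nhdsWithin] with s hs hts
      rw [X.filter_eq R e₀ (hn.trans (by exact_mod_cast hts)) hs]
    · rw [X.filter_eq R e₀ hn hn']

/-- The filter is unique. -/
theorem ae_filter_eq [StandardBorelSpace E] (hX : IsMotherQuakeModel R P X) (e₀ : E)
    {π : ℝ → Ω → Measure (ClusterHistory E)} (hπ : IsMotherQuakeFilter P X π) :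
    ∀ᵐ ω ∂P, ∀ t, 0 ≤ t → π t ω = X.filter R e₀ t ω := by
  have hF := hX.isMotherQuakeFilter_filter e₀
  refine ae_eq_of_forall_ae_eq_of_rightContinuous hπ.isProbabilityMeasure hF.isProbabilityMeasure
    hπ.right_continuous hF.right_continuous fun t ht B hB => ?_
  have hm : Measurable (B.indicator (1 : ClusterHistory E → ℝ)) := measurable_one.indicator hB
  have hint : Integrable (fun ω => B.indicator (1 : ClusterHistory E → ℝ) (X.hist t ω)) P :=
    (integrable_const (1 : ℝ)).mono' (hm.comp (X.measurable_hist t)).aestronglyMeasurable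
      (ae_of_all _ fun ω => by by_cases h : X.hist t ω ∈ B <;> simp [h])
  have h1 := hπ.condExp_eq ⟨t, ht⟩ _ hm hint
  have h2 := hF.condExp_eq ⟨t, ht⟩ _ hm hint
  filter_upwards [h1.trans h2.symm] with ω hω
  have := hπ.isProbabilityMeasure t ht ω
  have := hF.isProbabilityMeasure t ht ω
  change ∫ l, _ ∂π t ω = ∫ l, _ ∂X.filter R e₀ t ω at hω
  rw [integral_indicator_one hB, integral_indicator_one hB] at hω
  exact (measureReal_eq_measureReal_iff).1 hω

end IsMotherQuakeModel

/-! ### The evolution between two observations -/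

section Ratio

variable {ι : Type*}

lemma HasDerivWithinAt.ratio (I : Finset ι) {x : ι → ℝ → ℝ} {g : ι → ℝ} {A : ℝ} {c p : ι → ℝ}
    {t : ℝ} {S : Set ℝ} (hx : ∀ i ∈ I, HasDerivWithinAt (x i) (-g i * x i t) S t)
    (hB : 1 + ∑ i ∈ I, p i * (x i t - 1) ≠ 0) :
    HasDerivWithinAt
      (fun s => (A + ∑ i ∈ I, c i * (x i s - 1)) / (1 + ∑ i ∈ I, p i * (x i s - 1)))
      (-∑ i ∈ I, c i * x i t / (1 + ∑ i ∈ I, p i * (x i t - 1)) * g i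
        + (A + ∑ i ∈ I, c i * (x i t - 1)) / (1 + ∑ i ∈ I, p i * (x i t - 1))
          * ∑ i ∈ I, p i * x i t / (1 + ∑ i ∈ I, p i * (x i t - 1)) * g i) S t := by
  have hs : ∀ c : ι → ℝ, HasDerivWithinAt (fun s => ∑ i ∈ I, c i * (x i s - 1))
      (∑ i ∈ I, c i * (-g i * x i t)) S t := fun c =>
    HasDerivWithinAt.fun_sum fun i hi => ((hx i hi).sub_const 1).const_mul (c i)
  refine (((hs c).const_add A).div ((hs p).const_add 1) hB).congr_deriv ?_
  set B := 1 + ∑ i ∈ I, p i * (x i t - 1) with hBdef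
  have h1 : ∀ c : ι → ℝ, ∑ i ∈ I, c i * x i t / B * g i = -(∑ i ∈ I, c i * (-g i * x i t)) / B := by
    intro c
    rw [← Finset.sum_neg_distrib, Finset.sum_div]
    exact Finset.sum_congr rfl fun i _ => by ring
  rw [h1, h1]
  field_simp
  ring

lemma AbsolutelyContinuousOnInterval.ratio (I : Finset ι) {x : ι → ℝ → ℝ} {A a b : ℝ}
    {c p : ι → ℝ} (hx : ∀ i ∈ I, AbsolutelyContinuousOnInterval (x i) a b)
    (hB : ∀ t ∈ uIcc a b, 0 < 1 + ∑ i ∈ I, p i * (x i t - 1)) :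
    AbsolutelyContinuousOnInterval
      (fun s => (A + ∑ i ∈ I, c i * (x i s - 1)) / (1 + ∑ i ∈ I, p i * (x i s - 1))) a b := by
  have hconst : ∀ C : ℝ, AbsolutelyContinuousOnInterval (fun _ => C) a b := fun C =>
    (LipschitzWith.const C).lipschitzOnWith.absolutelyContinuousOnInterval
  have hs : ∀ (A : ℝ) (c : ι → ℝ),
      AbsolutelyContinuousOnInterval (fun s => A + ∑ i ∈ I, c i * (x i s - 1)) a b := by
    intro A c
    classical
    clear hB
    induction I using Finset.induction_on with
    | empty => simpa using hconst A
    | insert i I hi ih =>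
      simp only [Finset.sum_insert hi]
      have h1 := ((hx i (Finset.mem_insert_self i I)).sub (hconst 1)).const_mul (c i)
      have heq : (fun s => A + (c i * (x i s - 1) + ∑ j ∈ I, c j * (x j s - 1)))
          = (fun s => c i * (x i s - 1)) + fun s => A + ∑ j ∈ I, c j * (x j s - 1) := by
        funext s
        simp only [Pi.add_apply]
        ring
      rw [heq]
      exact AbsolutelyContinuousOnInterval.add h1
        (ih fun j hj => hx j (Finset.mem_insert_of_mem hj))
  simp only [div_eq_mul_inv]
  exact (hs A c).mul ((hs 1 p).inv hB)

end Ratio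

/-- Grönwall: the linear integral equation has only the trivial solution. -/
lemma eq_zero_of_eq_integral_mul {W g : ℝ → ℝ} {r t : ℝ} (hrt : r ≤ t)
    (hg : IntervalIntegrable g volume r t) (hWg : IntervalIntegrable (fun s => W s * g s) volume r t)
    (hW : ∀ s ∈ Icc r t, W s = ∫ x in r..s, W x * g x) : W t = 0 := by
  have h1 := hWg.absolutelyContinuousOnInterval_intervalIntegral left_mem_uIcc
  have h2 := hg.absolutelyContinuousOnInterval_intervalIntegral left_mem_uIcc
  have hac := h1.mul (h2.const_mul (-1)).exp
  obtain ⟨C, hC⟩ := hac.const_of_ae_hasDerivAt_zero (by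
    filter_upwards [hWg.ae_hasDerivAt_integral, hg.ae_hasDerivAt_integral] with x hx hx' hxm
    have d1 := hx hxm r left_mem_uIcc
    have d2 := ((hx' hxm r left_mem_uIcc).const_mul (-1)).exp
    refine (d1.mul d2).congr_deriv ?_
    rw [uIcc_of_le hrt] at hxm
    rw [← hW x hxm]
    ring)
  have hr := hC r left_mem_uIcc
  have ht := hC t right_mem_uIcc
  simp only [intervalIntegral.integral_same, zero_mul, Pi.mul_apply] at hr
  rw [← hr] at ht
  simp only [Pi.mul_apply] at ht
  rw [hW t ⟨hrt, le_rfl⟩]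
  exact (mul_eq_zero.1 ht).resolve_right (Real.exp_ne_zero _)

namespace ClusterHistory

variable {E : Type*}

lemma theta_apply [DecidableEq (Option (E × ℝ))] (y : E × ℝ) (l : ClusterHistory E) :
    theta y l = if mother l = some y then 1 else 0 := by
  unfold theta
  by_cases h : mother l = some y <;> simp [h]

lemma theta_mul_alpha (y : E × ℝ) (l : ClusterHistory E) : theta y l * alpha l = theta y l := by
  classical
  rw [theta_apply]
  split_ifs with h
  · have := isSome_mother l
    rw [h] at this
    simp [alpha, ← this]
  · simp

lemma theta_mul_theta_self (y : E × ℝ) (l : ClusterHistory E) :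
    theta y l * theta y l = theta y l := by
  classical
  rw [theta_apply]
  split_ifs <;> simp

lemma theta_mul_theta_of_ne {y z : E × ℝ} (h : y ≠ z) (l : ClusterHistory E) :
    theta y l * theta z l = 0 := by
  classical
  simp only [theta_apply]
  split_ifs with h1 h2
  · rw [h1] at h2
    exact absurd (Option.some_injective _ h2) h
  all_goals simp

end ClusterHistory

namespace MotherQuakeRates

open ClusterHistory

variable {E : Type*} [MeasurableSpace E] {ν : Measure E} (R : MotherQuakeRates E ν)

/-- The solution of the differential equation started from the functional `Φ`. -/
noncomputable def flow (y : ℕ → E × ℝ) (k : ℕ) (r : ℝ) (Φ : (ClusterHistory E → ℝ) → ℝ) (t : ℝ)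
    (f : ClusterHistory E → ℝ) : ℝ :=
  (Φ f + ∑ i ∈ Finset.Icc 1 k,
      Φ (fun l => theta (y i) l * alpha l * f l) * (R.decay (y i) r t - 1))
    / (1 + ∑ i ∈ Finset.Icc 1 k, Φ (fun l => theta (y i) l * alpha l) * (R.decay (y i) r t - 1))

lemma flow_theta_mul {y : ℕ → E × ℝ} {k : ℕ} {r : ℝ} {Φ : (ClusterHistory E → ℝ) → ℝ}
    (hΦ : Φ (fun _ => 0) = 0) (hy : ∀ i ∈ Finset.Icc 1 k, ∀ j ∈ Finset.Icc 1 k, i ≠ j → y i ≠ y j)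
    (t : ℝ) (f : ClusterHistory E → ℝ) {i : ℕ} (hi : i ∈ Finset.Icc 1 k) :
    R.flow y k r Φ t (fun l => theta (y i) l * alpha l * f l)
      = Φ (fun l => theta (y i) l * alpha l * f l) * R.decay (y i) r t
        / (1 + ∑ i ∈ Finset.Icc 1 k,
            Φ (fun l => theta (y i) l * alpha l) * (R.decay (y i) r t - 1)) := by
  unfold flow
  congr 1
  rw [Finset.sum_eq_single_of_mem i hi]
  · have : (fun l => theta (y i) l * alpha l * (theta (y i) l * alpha l * f l))
        = fun l => theta (y i) l * alpha l * f l := by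
      funext l
      rw [theta_mul_alpha, ← mul_assoc, theta_mul_theta_self]
    rw [this]
    ring
  · intro j hj hji
    have : (fun l => theta (y j) l * alpha l * (theta (y i) l * alpha l * f l)) = fun _ => 0 := by
      funext l
      rw [theta_mul_alpha, theta_mul_alpha, ← mul_assoc,
        theta_mul_theta_of_ne (hy j hj i hi hji), zero_mul]
    rw [this, hΦ, zero_mul]

lemma hasDerivWithinAt_decay {y : E × ℝ} {r t : ℝ} {S : Set ℝ}
    (h : HasDerivWithinAt (fun u => ∫ s in r..u, (R.a y s - R.epsTotal s))
      (R.a y t - R.epsTotal t) S t) :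
    HasDerivWithinAt (R.decay y r) (-(R.a y t - R.epsTotal t) * R.decay y r t) S t := by
  refine h.neg.exp.congr_deriv ?_
  simp only [decay, Pi.neg_apply]
  ring

theorem evolutionEquations_of_eq_flow {y : ℕ → E × ℝ} {k : ℕ} {r : ℝ} {r' : EReal}
    {V : ℝ → (ClusterHistory E → ℝ) → ℝ} (hr : (r : EReal) < r') (hV0 : V r (fun _ => 0) = 0)
    (hy : ∀ i ∈ Finset.Icc 1 k, ∀ j ∈ Finset.Icc 1 k, i ≠ j → y i ≠ y j)
    (hV : ∀ t : ℝ, r ≤ t → (t : EReal) < r' → ∀ f, V t f = R.flow y k r (V r) t f)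
    (hpos : ∀ t : ℝ, r ≤ t → 0 < 1 + ∑ i ∈ Finset.Icc 1 k,
      V r (fun l => theta (y i) l * alpha l) * (R.decay (y i) r t - 1))
    (hint : ∀ t : ℝ, r ≤ t → ∀ i ∈ Finset.Icc 1 k,
      IntervalIntegrable (fun s => R.a (y i) s - R.epsTotal s) volume r t)
    (hma : ∀ i ∈ Finset.Icc 1 k, Measurable (R.a (y i))) (hmε : Measurable R.epsTotal)
    (f : ClusterHistory E → ℝ) : R.EvolutionEquations y k r r' V f := by
  have hcl : ∀ t : ℝ, r ≤ t → (t : EReal) < r' → ∀ f : ClusterHistory E → ℝ,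
      ∀ i ∈ Finset.Icc 1 k, V t (fun l => theta (y i) l * alpha l * f l)
      = V r (fun l => theta (y i) l * alpha l * f l) * R.decay (y i) r t
        / (1 + ∑ i ∈ Finset.Icc 1 k,
            V r (fun l => theta (y i) l * alpha l) * (R.decay (y i) r t - 1)) := by
    intro t h h' f i hi
    rw [hV t h h', R.flow_theta_mul hV0 hy t f hi]
  have hcl1 : ∀ t : ℝ, r ≤ t → (t : EReal) < r' → ∀ i ∈ Finset.Icc 1 k,
      V t (fun l => theta (y i) l * alpha l)
      = V r (fun l => theta (y i) l * alpha l) * R.decay (y i) r t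
        / (1 + ∑ i ∈ Finset.Icc 1 k,
            V r (fun l => theta (y i) l * alpha l) * (R.decay (y i) r t - 1)) := by
    intro t h h' i hi
    simpa using hcl t h h' (fun _ => 1) i hi
  have hder : ∀ (t : ℝ) (S : Set ℝ), r ≤ t → (t : EReal) < r' →
      (∀ i ∈ Finset.Icc 1 k, HasDerivWithinAt (fun u => ∫ s in r..u, (R.a (y i) s - R.epsTotal s))
        (R.a (y i) t - R.epsTotal t) S t) →
      HasDerivWithinAt (fun s => R.flow y k r (V r) s f) (R.odeRhs y k (V t) f t) S t := by
    intro t S h h' hS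
    refine (HasDerivWithinAt.ratio (Finset.Icc 1 k) (A := V r f)
      (c := fun i => V r (fun l => theta (y i) l * alpha l * f l))
      (p := fun i => V r (fun l => theta (y i) l * alpha l))
      (g := fun i => R.a (y i) t - R.epsTotal t)
      (fun i hi => R.hasDerivWithinAt_decay (hS i hi)) (hpos t h).ne').congr_deriv ?_
    unfold odeRhs
    congr 1
    · congr 1
      exact Finset.sum_congr rfl fun i hi => by rw [hcl t h h' f i hi]
    · congr 1
      · exact (hV t h h' f).symm
      · exact Finset.sum_congr rfl fun i hi => by rw [hcl1 t h h' i hi]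
  have hev : ∀ t : ℝ, (t : EReal) < r' → ∀ᶠ s : ℝ in 𝓝 t, (s : EReal) < r' := fun t h' =>
    continuous_coe_real_ereal.continuousAt.eventually_lt_const h'
  have hae : ∀ t : ℝ, r ≤ t → ∀ᵐ x, x ∈ uIcc r t → ∀ i ∈ Finset.Icc 1 k,
      HasDerivAt (fun u => ∫ s in r..u, (R.a (y i) s - R.epsTotal s))
        (R.a (y i) x - R.epsTotal x) x := by
    intro t h
    have := (Finset.eventually_all (Finset.Icc 1 k)).2 fun i hi =>
      (hint t h i hi).ae_hasDerivAt_integral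
    filter_upwards [this] with x hx hxt i hi
    exact hx i hi hxt r left_mem_uIcc
  have hftc : ∀ t : ℝ, r ≤ t → (t : EReal) < r' →
      IntervalIntegrable (fun s => R.odeRhs y k (V s) f s) volume r t ∧
        ∫ s in r..t, R.odeRhs y k (V s) f s = R.flow y k r (V r) t f - R.flow y k r (V r) r f := by
    intro t h h'
    refine AbsolutelyContinuousOnInterval.integral_eq_sub_of_ae_hasDerivAt
      (f := fun s => R.flow y k r (V r) s f) ?_ ?_
    · refine AbsolutelyContinuousOnInterval.ratio _ (fun i hi => ?_) fun x hx => ?_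
      · have := ((hint t h i hi).absolutelyContinuousOnInterval_intervalIntegral
          left_mem_uIcc).neg.exp
        exact this
      · rw [uIcc_of_le h] at hx
        exact hpos x hx.1
    · filter_upwards [hae t h] with x hx hxt
      rw [uIcc_of_le h] at hxt
      have hx' : (x : EReal) < r' := lt_of_le_of_lt (by exact_mod_cast hxt.2) h'
      have := hder x univ hxt.1 hx' fun i hi => by
        rw [hasDerivWithinAt_univ]
        exact hx (by rwa [uIcc_of_le h]) i hi
      rwa [hasDerivWithinAt_univ] at this
  have hflow : ∀ t : ℝ, r ≤ t → (t : EReal) < r' → ∀ S : Set ℝ, (∀ᶠ s in 𝓝[S] t, r ≤ s) →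
      ∀ D, HasDerivWithinAt (fun s => R.flow y k r (V r) s f) D S t →
      HasDerivWithinAt (fun s => V s f) D S t := by
    intro t h h' S hS D hD
    refine hD.congr_of_eventuallyEq ?_ (hV t h h' f)
    filter_upwards [hS, mem_nhdsWithin_of_mem_nhds (hev t h')] with s hs hs'
    exact hV s hs hs' f
  refine ⟨fun t h h' i hi => ?_, fun t h h' => (hftc t h h').1, fun t h h' => ?_, ?_,
    fun t h h' hca hcε => ?_⟩
  · rw [hcl t h h' f i hi, b, mul_one_div]
    congr 1
    simp only [mul_sub, mul_one, Finset.sum_sub_distrib]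
    ring
  · rw [(hftc t h h').2, hV t h h', ← hV r le_rfl hr]
    ring
  · have : ∀ q : ℚ, ∀ᵐ t : ℝ, r < t → (t : EReal) < r' → t < q →
        HasDerivAt (fun s => V s f) (R.odeRhs y k (V t) f t) t := by
      intro q
      rcases le_total r q with hq | hq
      · filter_upwards [hae q hq] with t ht h h' htq
        have htm : t ∈ uIcc r q := by
          rw [uIcc_of_le hq]
          exact ⟨h.le, htq.le⟩
        rw [← hasDerivWithinAt_univ]
        refine hflow t h.le h' univ ?_ _ (hder t univ h.le h' fun i hi => ?_)
        · rw [nhdsWithin_univ]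
          filter_upwards [lt_mem_nhds h] with s hs using hs.le
        · rw [hasDerivWithinAt_univ]
          exact ht htm i hi
      · exact ae_of_all _ fun t h _ htq => absurd (h.trans htq) (not_lt.2 hq)
    filter_upwards [ae_all_iff.2 this] with t ht h h'
    obtain ⟨q, hq⟩ := exists_rat_gt t
    exact ht q h h' hq
  · refine hflow t h h' (Ici r) self_mem_nhdsWithin _ (hder t (Ici r) h h' fun i hi => ?_)
    have hc := (hca i hi).sub hcε
    have hm : StronglyMeasurable fun s => R.a (y i) s - R.epsTotal s :=
      ((hma i hi).sub hmε).stronglyMeasurable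
    rcases h.eq_or_lt with rfl | hlt
    · exact intervalIntegral.integral_hasDerivWithinAt_right (hint r le_rfl i hi)
        hm.stronglyMeasurableAtFilter (hc.mono Ioi_subset_Ici_self)
    · exact (intervalIntegral.integral_hasDerivAt_right (hint t h i hi)
        hm.stronglyMeasurableAtFilter (hc.continuousAt (Ici_mem_nhds hlt))).hasDerivWithinAt

end MotherQuakeRates

namespace MotherQuakeRates

open ClusterHistory

variable {E : Type*} [MeasurableSpace E] {ν : Measure E} (R : MotherQuakeRates E ν)

lemma a_eq_toReal (x : E × ℝ) (s : ℝ) : R.a x s = (∫⁻ u, (R.lam u s x : ℝ≥0∞) ∂ν).toReal := by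
  rw [a, integral_eq_lintegral_of_nonneg_ae (ae_of_all _ fun u => NNReal.coe_nonneg _)]
  · simp only [ENNReal.ofReal_coe_nnreal]
  · exact (R.measurable_lam.comp (f := fun u : E => (u, s, x))
      (by fun_prop)).coe_nnreal_real.aestronglyMeasurable

lemma epsTotal_eq_toReal (s : ℝ) : R.epsTotal s = (∫⁻ u, (R.ε u s : ℝ≥0∞) ∂ν).toReal := by
  rw [epsTotal, integral_eq_lintegral_of_nonneg_ae (ae_of_all _ fun u => NNReal.coe_nonneg _)]
  · simp only [ENNReal.ofReal_coe_nnreal]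
  · exact (R.measurable_ε.comp (f := fun u : E => (u, s))
      (by fun_prop)).coe_nnreal_real.aestronglyMeasurable

lemma survival_self (y : ℕ → E × ℝ) (κ : List QuakeKind) :
    R.survival y κ (y κ.length).2 = 1 := by
  simp [survival, cumRate]

variable [SFinite ν]

lemma measurable_a (x : E × ℝ) : Measurable (R.a x) := by
  rw [show R.a x = _ from funext (R.a_eq_toReal x)]
  exact (R.measurable_lintegral_lam x).ennreal_toReal

lemma measurable_epsTotal : Measurable R.epsTotal := by
  rw [show R.epsTotal = _ from funext R.epsTotal_eq_toReal]
  exact R.measurable_lintegral_ε.ennreal_toReal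

lemma intervalIntegrable_a {x : E × ℝ} (hx : 0 ≤ x.2) {r t : ℝ} (hr : x.2 ≤ r) (hrt : r ≤ t) :
    IntervalIntegrable (R.a x) volume r t := by
  rw [show R.a x = _ from funext (R.a_eq_toReal x), intervalIntegrable_iff_integrableOn_Ioc_of_le hrt]
  exact integrable_toReal_of_lintegral_ne_top (R.measurable_lintegral_lam x).aemeasurable
    (R.lintegral_lam_ne_top hx hr t)

lemma intervalIntegrable_epsTotal {r t : ℝ} (hr : 0 ≤ r) (hrt : r ≤ t) :
    IntervalIntegrable R.epsTotal volume r t := by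
  rw [show R.epsTotal = _ from funext R.epsTotal_eq_toReal,
    intervalIntegrable_iff_integrableOn_Ioc_of_le hrt]
  exact integrable_toReal_of_lintegral_ne_top R.measurable_lintegral_ε.aemeasurable
    (R.lintegral_ε_ne_top hr t)

lemma toReal_lintegral_lam {x : E × ℝ} (hx : 0 ≤ x.2) {r t : ℝ} (hr : x.2 ≤ r) (hrt : r ≤ t) :
    (∫⁻ s in Ioc r t, ∫⁻ u, (R.lam u s x : ℝ≥0∞) ∂ν).toReal = ∫ s in r..t, R.a x s := by
  rw [intervalIntegral.integral_of_le hrt, ← integral_toReal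
    (R.measurable_lintegral_lam x).aemeasurable
    (ae_lt_top (R.measurable_lintegral_lam x) (R.lintegral_lam_ne_top hx hr t))]
  simp only [a_eq_toReal]

lemma toReal_lintegral_ε {r t : ℝ} (hr : 0 ≤ r) (hrt : r ≤ t) :
    (∫⁻ s in Ioc r t, ∫⁻ u, (R.ε u s : ℝ≥0∞) ∂ν).toReal = ∫ s in r..t, R.epsTotal s := by
  rw [intervalIntegral.integral_of_le hrt, ← integral_toReal
    R.measurable_lintegral_ε.aemeasurable
    (ae_lt_top R.measurable_lintegral_ε (R.lintegral_ε_ne_top hr t))]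
  simp only [epsTotal_eq_toReal]

lemma survival_eq {y : ℕ → E × ℝ} {κ : List QuakeKind} (hy : IncreasingUpTo κ.length y) {t : ℝ}
    (ht : (y κ.length).2 ≤ t) :
    (R.survival y κ t : ℝ)
      = Real.exp (-(∫⁻ s in Ioc (y κ.length).2 t, ∫⁻ u, (R.γ u s : ℝ≥0∞) ∂ν).toReal
          - ∫ s in (y κ.length).2..t, R.epsTotal s)
        * match motherIdx κ with
          | some i => R.decay (y i) (y κ.length).2 t
          | none => 1 := by
  have hr : 0 ≤ (y κ.length).2 := hy.nonneg le_rfl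
  have hsum := R.cumRate_eq y κ t
  have hfin := R.cumRate_ne_top hy t
  rw [hsum, ENNReal.add_ne_top] at hfin
  rw [coe_survival, hsum, ENNReal.toReal_add hfin.1 hfin.2]
  simp only [clusterRate_ofKinds]
  cases h : motherIdx κ with
  | none =>
    simp only [mul_one]
    rw [R.toReal_lintegral_ε hr ht]
    congr 1
    ring
  | some i =>
    have hi := (Finset.mem_Icc.1 (motherIdx_mem h)).2
    have hi0 := hy.nonneg hi
    have hir := hy.le hi le_rfl
    simp only
    rw [R.toReal_lintegral_lam hi0 hir ht, decay, ← Real.exp_add,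
      intervalIntegral.integral_sub (R.intervalIntegrable_a hi0 hir ht)
        (R.intervalIntegrable_epsTotal hr ht)]
    congr 1
    ring

end MotherQuakeRates

namespace ClusterHistory

variable {E : Type*}

lemma IncreasingUpTo.ne {n i j : ℕ} {y : ℕ → E × ℝ} (h : IncreasingUpTo n y) (hi : i ≤ n)
    (hj : j ≤ n) (hij : i ≠ j) : y i ≠ y j := by
  intro heq
  rcases lt_or_gt_of_ne hij with hlt | hlt
  · exact (h.lt hlt hj).ne (by rw [heq])
  · exact (h.lt hlt hi).ne (by rw [heq])

open Classical in
lemma theta_ofKinds {y : ℕ → E × ℝ} {κ : List QuakeKind} {n : ℕ} (hy : IncreasingUpTo n y)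
    (hκ : κ.length ≤ n) {i : ℕ} (hi : i ≤ n) :
    theta (y i) (ofKinds y κ) = if motherIdx κ = some i then 1 else 0 := by
  rw [theta_apply, mother_ofKinds]
  congr 1
  cases h : motherIdx κ with
  | none => simp
  | some j =>
    have hj := (Finset.mem_Icc.1 (motherIdx_mem h)).2.trans hκ
    simp only [Option.map_some, Option.some.injEq, eq_iff_iff]
    exact ⟨fun heq => by_contra fun hne => hy.ne hj hi hne heq, fun heq => by rw [heq]⟩

lemma sum_theta_ofKinds {y : ℕ → E × ℝ} {κ : List QuakeKind} (hy : IncreasingUpTo κ.length y)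
    (c : ℕ → ℝ) :
    ∑ i ∈ Finset.Icc 1 κ.length, theta (y i) (ofKinds y κ) * c i
      = match motherIdx κ with
        | some i => c i
        | none => 0 := by
  classical
  have : ∀ i ∈ Finset.Icc 1 κ.length, theta (y i) (ofKinds y κ) * c i
      = if motherIdx κ = some i then c i else 0 := by
    intro i hi
    rw [theta_ofKinds hy le_rfl (Finset.mem_Icc.1 hi).2]
    split_ifs <;> simp
  rw [Finset.sum_congr rfl this]
  cases h : motherIdx κ with
  | none => simp
  | some j =>
    simp only [Option.some.injEq, Finset.sum_ite_eq]
    rw [if_pos (motherIdx_mem h)]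

end ClusterHistory

namespace MotherQuakeRates

open ClusterHistory

variable {E : Type*} [MeasurableSpace E] {ν : Measure E} (R : MotherQuakeRates E ν)
  [MeasurableSingletonClass E]

lemma integral_filterMeasure_congr {y : ℕ → E × ℝ} {n : ℕ} {t : ℝ} (h : R.filterMass y n t ≠ 0)
    {f g : ClusterHistory E → ℝ} (hfg : ∀ κ ∈ kindStrings n, f (ofKinds y κ) = g (ofKinds y κ)) :
    ∫ l, f l ∂(R.filterMeasure y n t) = ∫ l, g l ∂(R.filterMeasure y n t) := by
  rw [R.integral_filterMeasure h, R.integral_filterMeasure h]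
  congr 1
  exact Finset.sum_congr rfl fun κ hκ => by rw [hfg κ hκ]

variable [SFinite ν]

lemma integral_filterMeasure_mul {y : ℕ → E × ℝ} {n : ℕ} (hy : IncreasingUpTo n y)
    (h : ∀ t, R.filterMass y n t ≠ 0) {t : ℝ} (ht : (y n).2 ≤ t) (f : ClusterHistory E → ℝ) :
    (∑ κ ∈ kindStrings n, (R.weight y κ : ℝ) * R.survival y κ t * f (ofKinds y κ))
      = Real.exp (-(∫⁻ s in Ioc (y n).2 t, ∫⁻ u, (R.γ u s : ℝ≥0∞) ∂ν).toReal
          - ∫ s in (y n).2..t, R.epsTotal s) * R.filterMass y n (y n).2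
        * (∫ l, f l ∂(R.filterMeasure y n (y n).2) + ∑ i ∈ Finset.Icc 1 n,
          (∫ l, theta (y i) l * alpha l * f l ∂(R.filterMeasure y n (y n).2))
            * (R.decay (y i) (y n).2 t - 1)) := by
  set M := (R.filterMass y n (y n).2 : ℝ) with hM
  have hM0 : M ≠ 0 := by
    rw [hM]
    exact_mod_cast h _
  have hself : ∀ f : ClusterHistory E → ℝ, M * ∫ l, f l ∂(R.filterMeasure y n (y n).2)
      = ∑ κ ∈ kindStrings n, (R.weight y κ : ℝ) * f (ofKinds y κ) := by
    intro f
    rw [R.integral_filterMeasure (h _), mul_div_cancel₀ _ hM0]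
    refine Finset.sum_congr rfl fun κ hκ => ?_
    rw [mem_kindStrings] at hκ
    subst hκ
    rw [survival_self, NNReal.coe_one, mul_one]
  rw [mul_assoc, mul_add, Finset.mul_sum]
  simp only [← mul_assoc M, hself, theta_mul_alpha]
  simp only [Finset.sum_mul]
  rw [Finset.sum_comm, ← Finset.sum_add_distrib, Finset.mul_sum]
  refine Finset.sum_congr rfl fun κ hκ => ?_
  rw [mem_kindStrings] at hκ
  subst hκ
  have hs := sum_theta_ofKinds hy fun i => R.decay (y i) (y κ.length).2 t - 1
  have hs' : ∑ i ∈ Finset.Icc 1 κ.length, (R.weight y κ : ℝ)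
        * (theta (y i) (ofKinds y κ) * f (ofKinds y κ)) * (R.decay (y i) (y κ.length).2 t - 1)
      = (R.weight y κ : ℝ) * f (ofKinds y κ) * ∑ i ∈ Finset.Icc 1 κ.length,
        theta (y i) (ofKinds y κ) * (R.decay (y i) (y κ.length).2 t - 1) := by
    rw [Finset.mul_sum]
    exact Finset.sum_congr rfl fun i _ => by ring
  rw [hs', hs, R.survival_eq hy ht]
  cases motherIdx κ <;> simp only <;> ring

lemma filterMass_eq {y : ℕ → E × ℝ} {n : ℕ} (hy : IncreasingUpTo n y)
    (h : ∀ t, R.filterMass y n t ≠ 0) {t : ℝ} (ht : (y n).2 ≤ t) :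
    (R.filterMass y n t : ℝ)
      = Real.exp (-(∫⁻ s in Ioc (y n).2 t, ∫⁻ u, (R.γ u s : ℝ≥0∞) ∂ν).toReal
          - ∫ s in (y n).2..t, R.epsTotal s) * R.filterMass y n (y n).2
        * (1 + ∑ i ∈ Finset.Icc 1 n,
          (∫ l, theta (y i) l * alpha l ∂(R.filterMeasure y n (y n).2))
            * (R.decay (y i) (y n).2 t - 1)) := by
  have := R.isProbabilityMeasure_filterMeasure y n (y n).2
  have := R.integral_filterMeasure_mul hy h ht fun _ => 1
  simp only [mul_one, integral_const, probReal_univ, smul_eq_mul] at this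
  rw [← this, filterMass]
  push_cast
  rfl

/-- Between two observations the filter is the solution of the differential equation. -/
theorem integral_filterMeasure_eq_flow {y : ℕ → E × ℝ} {n : ℕ} (hy : IncreasingUpTo n y)
    (h : ∀ t, R.filterMass y n t ≠ 0) {t : ℝ} (ht : (y n).2 ≤ t) (f : ClusterHistory E → ℝ) :
    ∫ l, f l ∂(R.filterMeasure y n t)
      = R.flow y n (y n).2 (fun f => ∫ l, f l ∂(R.filterMeasure y n (y n).2)) t f := by
  have hM : (R.filterMass y n (y n).2 : ℝ) ≠ 0 := by exact_mod_cast h _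
  rw [R.integral_filterMeasure (h t), R.integral_filterMeasure_mul hy h ht,
    R.filterMass_eq hy h ht, mul_div_mul_left _ _ (mul_ne_zero (Real.exp_ne_zero _) hM)]
  rfl

theorem evolutionEquations_filterMeasure {y : ℕ → E × ℝ} {n : ℕ} (hy : IncreasingUpTo n y)
    (h : ∀ t, R.filterMass y n t ≠ 0) {r' : EReal} (hr : ((y n).2 : EReal) < r')
    {V : ℝ → (ClusterHistory E → ℝ) → ℝ}
    (hV : ∀ t : ℝ, (y n).2 ≤ t → (t : EReal) < r' → ∀ f, V t f = ∫ l, f l ∂(R.filterMeasure y n t))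
    (f : ClusterHistory E → ℝ) : R.EvolutionEquations y n (y n).2 r' V f := by
  have hVr : V (y n).2 = fun f => ∫ l, f l ∂(R.filterMeasure y n (y n).2) :=
    funext fun f => hV _ le_rfl hr f
  refine R.evolutionEquations_of_eq_flow hr ?_ ?_ ?_ ?_ ?_ (fun i _ => R.measurable_a (y i))
    R.measurable_epsTotal f
  · simp [hVr]
  · intro i hi j hj hij
    exact hy.ne (Finset.mem_Icc.1 hi).2 (Finset.mem_Icc.1 hj).2 hij
  · intro t ht ht' f
    rw [hV t ht ht', hVr, R.integral_filterMeasure_eq_flow hy h ht]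
  · intro t ht
    have hm := R.filterMass_eq hy h ht
    have hpos : (0 : ℝ) < R.filterMass y n t := by exact_mod_cast pos_of_ne_zero (h t)
    rw [hm] at hpos
    rw [hVr]
    exact pos_of_mul_pos_right hpos (by positivity)
  · intro t ht i hi
    have hi' := (Finset.mem_Icc.1 hi).2
    exact (R.intervalIntegrable_a (hy.nonneg hi') (hy.le hi' le_rfl) ht).sub
      (R.intervalIntegrable_epsTotal (hy.nonneg le_rfl) ht)

end MotherQuakeRates

/-! ### The update at an observation -/

namespace ClusterHistory

variable {E : Type*}

lemma theta_cons_true (x z : E × ℝ) (hxz : x ≠ z) (l : ClusterHistory E) :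
    theta z ((x.1, x.2, true) :: l) = theta z l := by
  classical
  rw [theta_apply, theta_apply, mother, if_pos rfl]
  have h := isSome_mother l
  cases hl : active l
  · rw [hl] at h
    rw [Option.isSome_eq_false_iff, Option.isNone_iff_eq_none] at h
    simp [h, hxz]
  · simp

lemma theta_cons_false (x z : E × ℝ) (l : ClusterHistory E) :
    theta z ((x.1, x.2, false) :: l) = 0 := by
  classical
  simp [theta_apply, mother]

lemma theta_cons_true_mul_alpha (x z : E × ℝ) (l : ClusterHistory E) :
    theta z ((x.1, x.2, true) :: l) * alpha l = theta z l := by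
  classical
  rw [← theta_mul_alpha, theta_apply, theta_apply, mother, if_pos rfl, alpha, alpha]
  have h := isSome_mother l
  cases hl : active l
  · rw [hl] at h
    rw [Option.isSome_eq_false_iff, Option.isNone_iff_eq_none] at h
    simp [h]
  · simp [active]

lemma alpha_cons_true (x : E × ℝ) (l : ClusterHistory E) :
    alpha ((x.1, x.2, true) :: l) = 1 := by
  simp [alpha, active]

lemma theta_self_cons_true (x : E × ℝ) (l : ClusterHistory E) :
    theta x ((x.1, x.2, true) :: l) * (1 - alpha l) = 1 - alpha l := by
  classical
  rw [theta_apply, mother, if_pos rfl, alpha]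
  cases active l <;> simp

end ClusterHistory

namespace MotherQuakeRates

open ClusterHistory

variable {E : Type*} [MeasurableSpace E] {ν : Measure E} (R : MotherQuakeRates E ν)

/-- The history `l` before a quake `x` turns `f` into this function after the quake, up to
normalization. -/
noncomputable def update (x : E × ℝ) (f : ClusterHistory E → ℝ) (l : ClusterHistory E) : ℝ :=
  R.γ x.1 x.2 * f l + R.clusterRate l x.1 x.2
    * (R.transition (active l) true * f ((x.1, x.2, true) :: l)
      + R.transition (active l) false * f ((x.1, x.2, false) :: l))

lemma sum_weight_succ (y : ℕ → E × ℝ) (n : ℕ) (f : ClusterHistory E → ℝ) :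
    ∑ κ ∈ kindStrings (n + 1), (R.weight y κ : ℝ) * f (ofKinds y κ)
      = ∑ κ ∈ kindStrings n, (R.weight y κ : ℝ) * R.survival y κ (y (n + 1)).2
          * R.update (y (n + 1)) f (ofKinds y κ) := by
  rw [sum_kindStrings_succ]
  refine Finset.sum_congr rfl fun κ hκ => ?_
  rw [mem_kindStrings] at hκ
  subst hκ
  rw [QuakeKind.sum_eq]
  simp only [weight, ofKinds, rate, update]
  push_cast
  ring

lemma update_ofKinds {y : ℕ → E × ℝ} {κ : List QuakeKind} (hy : IncreasingUpTo κ.length y)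
    (x : E × ℝ) (f : ClusterHistory E → ℝ) :
    R.update x f (ofKinds y κ) = (fun l => R.γ x.1 x.2 * f l
      + R.ε x.1 x.2 * (f ((x.1, x.2, true) :: l) * (1 - alpha l))
      + ∑ j ∈ Finset.Icc 1 κ.length, R.lam x.1 x.2 (y j)
        * ((R.p * f ((x.1, x.2, false) :: l) + (1 - R.p) * f ((x.1, x.2, true) :: l))
          * (theta (y j) l * alpha l))) (ofKinds y κ) := by
  set l := ofKinds y κ with hl
  have h := sum_theta_ofKinds hy fun j => (R.lam x.1 x.2 (y j) : ℝ)
    * (R.p * f ((x.1, x.2, false) :: l) + (1 - R.p) * f ((x.1, x.2, true) :: l))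
  simp only [theta_mul_alpha]
  rw [← hl] at h
  have h' : ∑ j ∈ Finset.Icc 1 κ.length, (R.lam x.1 x.2 (y j) : ℝ)
        * ((R.p * f ((x.1, x.2, false) :: l) + (1 - R.p) * f ((x.1, x.2, true) :: l))
          * theta (y j) l)
      = ∑ j ∈ Finset.Icc 1 κ.length, theta (y j) l * ((R.lam x.1 x.2 (y j) : ℝ)
        * (R.p * f ((x.1, x.2, false) :: l) + (1 - R.p) * f ((x.1, x.2, true) :: l))) :=
    Finset.sum_congr rfl fun j _ => by ring
  rw [h', h]
  unfold update
  have hact : active l = (motherIdx κ).isSome := active_ofKinds y κ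
  rw [hl, clusterRate_ofKinds, ← hl, alpha, hact]
  cases motherIdx κ with
  | none => simp [transition]
  | some i =>
    simp only [Option.isSome_some, transition, if_true, NNReal.coe_sub R.p_le_one, NNReal.coe_one]
    ring

variable [MeasurableSingletonClass E]

lemma integral_filterMeasure_succ {y : ℕ → E × ℝ} {n : ℕ}
    (h : R.filterMass y n (y (n + 1)).2 ≠ 0) (h' : R.filterMass y (n + 1) (y (n + 1)).2 ≠ 0)
    (f : ClusterHistory E → ℝ) :
    ∫ l, f l ∂(R.filterMeasure y (n + 1) (y (n + 1)).2)
      = (∫ l, R.update (y (n + 1)) f l ∂(R.filterMeasure y n (y (n + 1)).2))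
        / (R.filterMass y (n + 1) (y (n + 1)).2 / R.filterMass y n (y (n + 1)).2) := by
  rw [R.integral_filterMeasure h', R.integral_filterMeasure h, ← R.sum_weight_succ]
  have h0 : (R.filterMass y n (y (n + 1)).2 : ℝ) ≠ 0 := by exact_mod_cast h
  rw [div_div_div_cancel_right₀ h0]
  congr 1
  refine Finset.sum_congr rfl fun κ hκ => ?_
  rw [mem_kindStrings] at hκ
  rw [← hκ, survival_self, NNReal.coe_one, mul_one]

lemma integral_update {y : ℕ → E × ℝ} {n : ℕ} {t : ℝ} (hy : IncreasingUpTo n y)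
    (h : R.filterMass y n t ≠ 0) (x : E × ℝ) (f : ClusterHistory E → ℝ) :
    ∫ l, R.update x f l ∂(R.filterMeasure y n t)
      = (∫ l, f l ∂(R.filterMeasure y n t)) * R.γ x.1 x.2
        + (∫ l, f ((x.1, x.2, true) :: l) * (1 - alpha l) ∂(R.filterMeasure y n t)) * R.ε x.1 x.2
        + ∑ j ∈ Finset.Icc 1 n, R.lam x.1 x.2 (y j)
          * ∫ l, (R.p * f ((x.1, x.2, false) :: l) + (1 - R.p) * f ((x.1, x.2, true) :: l))
            * (theta (y j) l * alpha l) ∂(R.filterMeasure y n t) := by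
  have hi := R.integrable_filterMeasure y n t
  rw [R.integral_filterMeasure_congr (g := fun l => R.γ x.1 x.2 * f l
      + R.ε x.1 x.2 * (f ((x.1, x.2, true) :: l) * (1 - alpha l))
      + ∑ j ∈ Finset.Icc 1 n, R.lam x.1 x.2 (y j)
        * ((R.p * f ((x.1, x.2, false) :: l) + (1 - R.p) * f ((x.1, x.2, true) :: l))
          * (theta (y j) l * alpha l))) h fun κ hκ => by
    rw [mem_kindStrings] at hκ
    rw [← hκ] at hy ⊢
    exact R.update_ofKinds hy x f]
  rw [integral_add (hi _) (hi _), integral_add (hi _) (hi _), integral_finsetSum _ fun _ _ => hi _]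
  simp only [integral_const_mul]
  ring

theorem d_filterMeasure {y : ℕ → E × ℝ} {n : ℕ} (hy : IncreasingUpTo n y)
    (h : R.filterMass y n (y (n + 1)).2 ≠ 0) (h' : R.filterMass y (n + 1) (y (n + 1)).2 ≠ 0) :
    R.d y n (fun f => ∫ l, f l ∂(R.filterMeasure y n (y (n + 1)).2))
      = R.filterMass y (n + 1) (y (n + 1)).2 / R.filterMass y n (y (n + 1)).2 := by
  have := R.isProbabilityMeasure_filterMeasure y n (y (n + 1)).2
  have := R.isProbabilityMeasure_filterMeasure y (n + 1) (y (n + 1)).2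
  have hi := R.integrable_filterMeasure y n (y (n + 1)).2
  have h0 : (R.filterMass y n (y (n + 1)).2 : ℝ) ≠ 0 := by exact_mod_cast h
  have h0' : (R.filterMass y (n + 1) (y (n + 1)).2 : ℝ) ≠ 0 := by exact_mod_cast h'
  have h1 := R.integral_filterMeasure_succ h h' fun _ => 1
  rw [R.integral_update hy h] at h1
  simp only [integral_const, probReal_univ, smul_eq_mul, mul_one, one_mul, add_sub_cancel] at h1
  rw [eq_div_iff (div_ne_zero h0' h0), one_mul] at h1
  rw [h1, d]
  have hα : ∫ l, (1 - alpha l) ∂(R.filterMeasure y n (y (n + 1)).2)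
      = 1 - ∑ j ∈ Finset.Icc 1 n,
        ∫ l, theta (y j) l * alpha l ∂(R.filterMeasure y n (y (n + 1)).2) := by
    rw [R.integral_filterMeasure_congr
      (g := fun l => 1 - ∑ j ∈ Finset.Icc 1 n, theta (y j) l * alpha l) h, integral_sub (hi _) (hi _),
      integral_finsetSum _ fun _ _ => hi _]
    · simp
    · intro κ hκ
      rw [mem_kindStrings] at hκ
      rw [← hκ] at hy ⊢
      have hs := sum_theta_ofKinds hy fun _ => 1
      simp only [mul_one] at hs
      simp only [theta_mul_alpha, hs]
      rw [alpha, active_ofKinds]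
      cases motherIdx κ <;> simp
  rw [hα]
  simp only [sub_mul, Finset.sum_sub_distrib, ← Finset.mul_sum]
  ring

lemma continuousWithinAt_integral_filterMeasure [SFinite ν] {y : ℕ → E × ℝ} {n : ℕ} (hy : IncreasingUpTo n y)
    (h : ∀ t, R.filterMass y n t ≠ 0) (f : ClusterHistory E → ℝ) {t : ℝ} (ht : (y n).2 ≤ t) :
    ContinuousWithinAt (fun t => ∫ l, f l ∂(R.filterMeasure y n t)) (Ici (y n).2) t := by
  have hs : ∀ κ ∈ kindStrings n,
      ContinuousWithinAt (fun t => (R.survival y κ t : ℝ)) (Ici (y n).2) t := by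
    intro κ hκ
    rw [mem_kindStrings] at hκ
    rw [← hκ] at hy ht ⊢
    exact NNReal.continuous_coe.continuousAt.comp_continuousWithinAt
      (R.continuousOn_survival hy t ht)
  have hmass : ∀ t, (R.filterMass y n t : ℝ)
      = ∑ κ ∈ kindStrings n, (R.weight y κ : ℝ) * R.survival y κ t := fun t => by
    rw [filterMass]
    push_cast
    rfl
  have h0 : ∑ κ ∈ kindStrings n, (R.weight y κ : ℝ) * R.survival y κ t ≠ 0 := by
    rw [← hmass]
    exact_mod_cast h t
  simp only [fun t => R.integral_filterMeasure (h t) f, hmass]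
  refine ContinuousWithinAt.div ?_ ?_ h0
  · exact tendsto_finsetSum _ fun κ hκ =>
      (continuousWithinAt_const.mul (hs κ hκ)).mul continuousWithinAt_const
  · exact tendsto_finsetSum _ fun κ hκ => continuousWithinAt_const.mul (hs κ hκ)

theorem jumpEquations_filterMeasure {y : ℕ → E × ℝ} {n : ℕ} (hy : IncreasingUpTo (n + 1) y)
    (h : R.filterMass y n (y (n + 1)).2 ≠ 0) (h' : R.filterMass y (n + 1) (y (n + 1)).2 ≠ 0)
    (f : ClusterHistory E → ℝ) :
    R.JumpEquations y n (fun f => ∫ l, f l ∂(R.filterMeasure y n (y (n + 1)).2))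
      (fun f => ∫ l, f l ∂(R.filterMeasure y (n + 1) (y (n + 1)).2)) f := by
  have hyn := hy.mono n.le_succ
  have key : ∀ f : ClusterHistory E → ℝ, _ := fun f => R.integral_filterMeasure_succ h h' f
  simp only [← R.d_filterMeasure hyn h h', R.integral_update hyn h] at key
  refine ⟨fun i hi => ?_, ?_, ?_⟩
  · rw [key]
    congr 1
    have hi' := (Finset.mem_Icc.1 hi).2
    have hne : y (n + 1) ≠ y i := hy.ne le_rfl (by lia) (by lia)
    have h1 : ∀ l : ClusterHistory E, theta (y i) l * (1 - alpha l) = 0 := fun l => by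
      rw [mul_sub, mul_one, theta_mul_alpha, sub_self]
    have h2 : ∀ l : ClusterHistory E,
        theta (y i) l * f (((y (n + 1)).1, (y (n + 1)).2, true) :: l) * (1 - alpha l) = 0 :=
      fun l => by rw [mul_right_comm, h1, zero_mul]
    simp only [theta_mul_alpha, theta_cons_true _ _ hne, alpha_cons_true, mul_one,
      theta_cons_false, zero_mul, mul_zero, zero_add, h2, integral_zero, add_zero]
    rw [Finset.sum_eq_single_of_mem i hi]
    · have h3 : ∀ l : ClusterHistory E,
          (1 - (R.p : ℝ)) * (theta (y i) l * f (((y (n + 1)).1, (y (n + 1)).2, true) :: l))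
            * theta (y i) l
          = (1 - (R.p : ℝ)) * (f (((y (n + 1)).1, (y (n + 1)).2, true) :: l) * theta (y i) l) := by
        intro l
        conv_rhs => rw [← theta_mul_theta_self]
        ring
      simp only [h3, integral_const_mul]
      ring
    · intro j hj hji
      have h3 : ∀ l : ClusterHistory E,
          (1 - (R.p : ℝ)) * (theta (y i) l * f (((y (n + 1)).1, (y (n + 1)).2, true) :: l))
            * theta (y j) l = 0 := by
        intro l
        have := theta_mul_theta_of_ne
          (hy.ne (i := i) (j := j) (by lia) (by have := Finset.mem_Icc.1 hj; lia) hji.symm) l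
        linear_combination
          (1 - (R.p : ℝ)) * f (((y (n + 1)).1, (y (n + 1)).2, true) :: l) * this
      simp only [h3, integral_zero, mul_zero]
  · rw [key]
    congr 1
    have h1 : ∫ l, theta (y (n + 1)) l * f l ∂(R.filterMeasure y n (y (n + 1)).2) = 0 := by
      rw [R.integral_filterMeasure_congr (g := fun _ => 0) h, integral_zero]
      intro κ hκ
      rw [mem_kindStrings] at hκ
      rw [theta_ofKinds hy (by lia) le_rfl, if_neg, zero_mul]
      intro hm
      have := Finset.mem_Icc.1 (motherIdx_mem hm)
      lia
    have h2 : ∀ l : ClusterHistory E,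
        theta (y (n + 1)) (((y (n + 1)).1, (y (n + 1)).2, true) :: l)
          * f (((y (n + 1)).1, (y (n + 1)).2, true) :: l) * (1 - alpha l)
        = f (((y (n + 1)).1, (y (n + 1)).2, true) :: l) * (1 - alpha l) := fun l => by
      rw [mul_right_comm, theta_self_cons_true, mul_comm]
    have h3 : ∀ j ∈ Finset.Icc 1 n, ∀ l : ClusterHistory E,
        (1 - (R.p : ℝ)) * (theta (y (n + 1)) (((y (n + 1)).1, (y (n + 1)).2, true) :: l)
          * f (((y (n + 1)).1, (y (n + 1)).2, true) :: l)) * theta (y j) l = 0 := by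
      intro j hj l
      have := theta_mul_theta_of_ne
        (hy.ne (i := n + 1) (j := j) le_rfl (by have := Finset.mem_Icc.1 hj; lia)
          (by have := Finset.mem_Icc.1 hj; lia)) l
      rw [← theta_cons_true_mul_alpha (y (n + 1)), mul_assoc, mul_comm (alpha l),
        theta_mul_alpha] at this
      linear_combination
        (1 - (R.p : ℝ)) * f (((y (n + 1)).1, (y (n + 1)).2, true) :: l) * this
    simp only [theta_mul_alpha, h1, h2, theta_cons_false, zero_mul, mul_zero, zero_add]
    rw [Finset.sum_eq_zero, add_zero]
    intro j hj
    simp only [h3 j hj, integral_zero, mul_zero]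
  · rw [key]
    ring

end MotherQuakeRates

/-! ### The equations determine the filter -/

namespace MotherQuakeRates

open ClusterHistory

variable {E : Type*} [MeasurableSpace E] {ν : Measure E} {R : MotherQuakeRates E ν}

lemma EvolutionEquations.continuousOn {y : ℕ → E × ℝ} {k : ℕ} {r : ℝ} {r' : EReal}
    {V : ℝ → (ClusterHistory E → ℝ) → ℝ} {f : ClusterHistory E → ℝ}
    (h : R.EvolutionEquations y k r r' V f) {t : ℝ} (ht : r ≤ t) (ht' : (t : EReal) < r') :
    ContinuousOn (fun s => V s f) (Icc r t) := by
  have hc := intervalIntegral.continuousOn_primitive_interval' (h.ode_integrable t ht ht')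
    left_mem_uIcc
  rw [uIcc_of_le ht] at hc
  refine ((continuousOn_const (c := V r f)).add hc).congr fun s hs => ?_
  exact h.ode_integral s hs.1 (lt_of_le_of_lt (by exact_mod_cast hs.2) ht')

lemma EvolutionEquations.eq {y : ℕ → E × ℝ} {k : ℕ} {r : ℝ} {r' : EReal}
    {V V' : ℝ → (ClusterHistory E → ℝ) → ℝ} (h : ∀ f, R.EvolutionEquations y k r r' V f)
    (h' : ∀ f, R.EvolutionEquations y k r r' V' f) (hr : V r = V' r)
    {t : ℝ} (ht : r ≤ t) (ht' : (t : EReal) < r')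
    (hint : ∀ i ∈ Finset.Icc 1 k,
      IntervalIntegrable (fun s => R.a (y i) s - R.epsTotal s) volume r t)
    (f : ClusterHistory E → ℝ) : V t f = V' t f := by
  have hlt : ∀ s ∈ Icc r t, (s : EReal) < r' := fun s hs =>
    lt_of_le_of_lt (by exact_mod_cast hs.2) ht'
  have hcl : ∀ s ∈ Icc r t, ∀ f : ClusterHistory E → ℝ, ∀ i ∈ Finset.Icc 1 k,
      V s (fun l => theta (y i) l * alpha l * f l)
        = V' s (fun l => theta (y i) l * alpha l * f l) := by
    intro s hs f i hi
    rw [(h f).cluster_eq s hs.1 (hlt s hs) i hi, (h' f).cluster_eq s hs.1 (hlt s hs) i hi, hr]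
  have hcl1 : ∀ s ∈ Icc r t, ∀ i ∈ Finset.Icc 1 k,
      V s (fun l => theta (y i) l * alpha l) = V' s (fun l => theta (y i) l * alpha l) := by
    intro s hs i hi
    simpa using hcl s hs (fun _ => 1) i hi
  set g : ℝ → ℝ := fun s => ∑ i ∈ Finset.Icc 1 k,
    V s (fun l => theta (y i) l * alpha l) * (R.a (y i) s - R.epsTotal s) with hg
  have hgi : IntervalIntegrable g volume r t := by
    rw [hg, show (fun s => ∑ i ∈ Finset.Icc 1 k,
      V s (fun l => theta (y i) l * alpha l) * (R.a (y i) s - R.epsTotal s))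
      = ∑ i ∈ Finset.Icc 1 k, fun s =>
      V s (fun l => theta (y i) l * alpha l) * (R.a (y i) s - R.epsTotal s) by ext; simp]
    refine IntervalIntegrable.sum _ fun i hi => (hint i hi).continuousOn_mul ?_
    rw [uIcc_of_le ht]
    exact (h _).continuousOn ht ht'
  have hdiff : ∀ s ∈ Icc r t, R.odeRhs y k (V s) f s - R.odeRhs y k (V' s) f s
      = (V s f - V' s f) * g s := by
    intro s hs
    have h1 : ∑ i ∈ Finset.Icc 1 k,
        V' s (fun l => theta (y i) l * alpha l * f l) * (R.a (y i) s - R.epsTotal s)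
        = ∑ i ∈ Finset.Icc 1 k,
        V s (fun l => theta (y i) l * alpha l * f l) * (R.a (y i) s - R.epsTotal s) :=
      Finset.sum_congr rfl fun i hi => by rw [hcl s hs f i hi]
    have h2 : ∑ i ∈ Finset.Icc 1 k,
        V' s (fun l => theta (y i) l * alpha l) * (R.a (y i) s - R.epsTotal s) = g s :=
      Finset.sum_congr rfl fun i hi => by rw [hcl1 s hs i hi]
    rw [odeRhs, odeRhs, h1, h2]
    ring
  have hW := eq_zero_of_eq_integral_mul (W := fun s => V s f - V' s f) ht hgi ?_ ?_
  · exact sub_eq_zero.1 hW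
  · refine hgi.continuousOn_mul ?_
    rw [uIcc_of_le ht]
    exact ((h f).continuousOn ht ht').sub ((h' f).continuousOn ht ht')
  · intro s hs
    rw [(h f).ode_integral s hs.1 (hlt s hs), (h' f).ode_integral s hs.1 (hlt s hs), hr,
      add_sub_add_left_eq_sub, ← intervalIntegral.integral_sub
        ((h f).ode_integrable s hs.1 (hlt s hs)) ((h' f).ode_integrable s hs.1 (hlt s hs))]
    refine intervalIntegral.integral_congr fun x hx => ?_
    rw [uIcc_of_le hs.1] at hx
    exact hdiff x ⟨hx.1, hx.2.trans hs.2⟩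

end MotherQuakeRates

namespace QuakeProcess

open ClusterHistory MotherQuakeRates

variable {E Ω : Type*} [MeasurableSpace E] [mΩ : MeasurableSpace Ω] (X : QuakeProcess E Ω)
  {ν : Measure E} {R : MotherQuakeRates E ν} [SFinite ν]

theorem eq_of_filterEquations {ω : Ω} {V V' : ℝ → (ClusterHistory E → ℝ) → ℝ}
    (h : R.FilterEquations (fun k => X.T k ω) (fun k => X.mark k ω) V)
    (h' : R.FilterEquations (fun k => X.T k ω) (fun k => X.mark k ω) V')
    {t : ℝ} (ht : 0 ≤ t) (f : ClusterHistory E → ℝ) : V t f = V' t f := by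
  have hstep : ∀ (k : ℕ) (r : ℝ), X.T k ω = r → V r = V' r →
      ∀ t : ℝ, r ≤ t → (t : EReal) < X.T (k + 1) ω → V t = V' t := by
    intro k r hr hV t ht ht'
    funext f
    have hy := X.increasingUpTo_path (n := k) (ω := ω) (by rw [hr]; exact EReal.coe_ne_top r)
    have hyr : (X.path ω k).2 = r := by simp [path, hr]
    refine EvolutionEquations.eq (h.evolution k r hr) (h'.evolution k r hr) hV ht ht' ?_ f
    intro i hi
    have hi' := (Finset.mem_Icc.1 hi).2
    exact (R.intervalIntegrable_a (hy.nonneg hi') (hyr ▸ hy.le hi' le_rfl) ht).sub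
      (R.intervalIntegrable_epsTotal (hyr ▸ hy.nonneg le_rfl) ht)
  have hT : ∀ (k : ℕ) (r : ℝ), X.T k ω = r → V r = V' r := by
    intro k
    induction k with
    | zero =>
      intro r hr
      rw [X.T_zero] at hr
      have : r = 0 := by exact_mod_cast hr.symm
      subst this
      funext f
      rw [h.initial, h'.initial]
    | succ k ih =>
      intro r hr
      have hk : X.T k ω ≠ ⊤ := X.T_ne_top_of_le k.le_succ (by rw [hr]; exact EReal.coe_ne_top r)
      have hk' := X.coe_toReal_T hk
      have hlt : (X.T k ω).toReal < r := by
        have := X.T_lt k ω hk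
        rw [hr, ← hk'] at this
        exact_mod_cast this
      obtain ⟨Φ, hΦ, -, hJ⟩ := h.jump k r hr
      obtain ⟨Φ', hΦ', -, hJ'⟩ := h'.jump k r hr
      have hΦΦ : Φ = Φ' := by
        funext f
        refine tendsto_nhds_unique (hΦ f) ((hΦ' f).congr' ?_)
        filter_upwards [Ioo_mem_nhdsLT hlt] with s hs
        rw [hstep k _ hk'.symm (ih _ hk'.symm) s hs.1.le (by rw [hr]; exact_mod_cast hs.2)]
      funext f
      rw [(hJ f).total, (hJ' f).total, hΦΦ]
  obtain ⟨n, hn, hn'⟩ := X.exists_T_le_lt ω ht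
  have hne : X.T n ω ≠ ⊤ := (hn.trans_lt (EReal.coe_lt_top t)).ne
  have hne' := X.coe_toReal_T hne
  rw [hstep n _ hne'.symm (hT n _ hne'.symm) t (by rw [← hne'] at hn; exact_mod_cast hn) hn']

theorem filterEquations_filter [MeasurableSingletonClass E] (e₀ : E) {ω : Ω}
    (hω : ∀ n, X.T n ω ≠ ⊤ → ∀ t, R.filterMass (X.path ω) n t ≠ 0)
    {V : ℝ → (ClusterHistory E → ℝ) → ℝ}
    (hV : ∀ t, 0 ≤ t → ∀ f, V t f = ∫ l, f l ∂(X.filter R e₀ t ω)) :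
    R.FilterEquations (fun k => X.T k ω) (fun k => X.mark k ω) V := by
  have hVn : ∀ (n : ℕ) (r : ℝ), X.T n ω = r → ∀ t : ℝ, r ≤ t → (t : EReal) < X.T (n + 1) ω →
      ∀ f, V t f = ∫ l, f l ∂(R.filterMeasure (X.path ω) n t) := by
    intro n r hr t ht ht' f
    have hr0 : 0 ≤ r := by
      have := X.T_nonneg n ω
      rw [hr] at this
      exact_mod_cast this
    rw [hV t (hr0.trans ht), X.filter_eq R e₀ (by rw [hr]; exact_mod_cast ht) ht']
  have hlt : ∀ (n : ℕ) (r : ℝ), X.T n ω = r → (r : EReal) < X.T (n + 1) ω := fun n r hr => by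
    rw [← hr]
    exact X.T_lt n ω (by rw [hr]; exact EReal.coe_ne_top r)
  have htime : ∀ (n : ℕ) (r : ℝ), X.T n ω = r → (X.path ω n).2 = r := fun n r hr => by
    simp [path, hr]
  refine ⟨fun f => ?_, fun k r hr f => ?_, fun k r hr => ?_⟩
  · have h0 : X.T 0 ω = ((0 : ℝ) : EReal) := by rw [X.T_zero]; rfl
    rw [hVn 0 0 h0 0 le_rfl (hlt 0 0 h0),
      R.integral_filterMeasure (hω 0 (by rw [h0]; exact EReal.coe_ne_top 0) 0), filterMass,
      sum_kindStrings_zero, sum_kindStrings_zero]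
    have := (R.survival_pos (X.path ω) [] 0).ne'
    have : (R.survival (X.path ω) [] 0 : ℝ) ≠ 0 := by exact_mod_cast this
    simp only [weight, NNReal.coe_one, one_mul, ofKinds]
    field_simp
  · have hne : X.T k ω ≠ ⊤ := by rw [hr]; exact EReal.coe_ne_top r
    have hy := htime k r hr
    have := R.evolutionEquations_filterMeasure (X.increasingUpTo_path hne) (hω k hne)
      (r' := X.T (k + 1) ω) (V := V) (by rw [hy]; exact hlt k r hr)
      (fun t ht ht' f => hVn k r hr t (hy ▸ ht) ht' f) f
    rw [hy] at this
    exact this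
  · have hne : X.T (k + 1) ω ≠ ⊤ := by rw [hr]; exact EReal.coe_ne_top r
    have hne0 : X.T k ω ≠ ⊤ := X.T_ne_top_of_le k.le_succ hne
    have hy := X.increasingUpTo_path hne
    have hyr := htime (k + 1) r hr
    have hk := (X.coe_toReal_T hne0).symm
    have hkr : (X.path ω k).2 < r := hyr ▸ hy.lt k.lt_succ_self le_rfl
    have hm := hω k hne0 r
    have hm' := hω (k + 1) hne r
    have hd := R.d_filterMeasure (hy.mono k.le_succ) (hω k hne0 _) (hω (k + 1) hne _)
    have hJ := R.jumpEquations_filterMeasure hy (hω k hne0 _) (hω (k + 1) hne _)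
    rw [hyr] at hd hJ
    refine ⟨fun f => ∫ l, f l ∂(R.filterMeasure (X.path ω) k r), fun f => ?_, ?_, fun f => ?_⟩
    · have hc := R.continuousWithinAt_integral_filterMeasure (hy.mono k.le_succ) (hω k hne0) f
        hkr.le
      have hc' := hc.tendsto.mono_left (nhdsWithin_le_iff.2 (mem_of_superset
        (Ioo_mem_nhdsLT hkr) fun s hs => hs.1.le))
      refine hc'.congr' ?_
      filter_upwards [Ioo_mem_nhdsLT hkr] with s hs
      rw [hVn k _ hk s hs.1.le (by rw [hr]; exact_mod_cast hs.2)]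
    · refine lt_of_lt_of_eq ?_ hd.symm
      have h1 := pos_of_ne_zero hm
      have h2 := pos_of_ne_zero hm'
      exact div_pos (by exact_mod_cast h2) (by exact_mod_cast h1)
    · have hVr : V r = fun f => ∫ l, f l ∂(R.filterMeasure (X.path ω) (k + 1) r) :=
        funext fun f => hVn (k + 1) r hr r le_rfl (hlt (k + 1) r hr) f
      rw [hVr]
      exact hJ f

end QuakeProcess

theorem theorem3p2 {E Ω : Type*} [MeasurableSpace E] [StandardBorelSpace E] [MeasurableSpace Ω]
    (ν : Measure E) [SigmaFinite ν] (R : MotherQuakeRates E ν)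
    (P : Measure Ω) [IsProbabilityMeasure P]
    (X : QuakeProcess E Ω) (hX : IsMotherQuakeModel R P X) :
    (∃ π : ℝ → Ω → Measure (ClusterHistory E), IsMotherQuakeFilter P X π) ∧
    ∀ π : ℝ → Ω → Measure (ClusterHistory E), IsMotherQuakeFilter P X π →
      ∀ᵐ ω ∂P,
        (∀ t : ℝ, 0 ≤ t → ∀ f : ClusterHistory E → ℝ, Integrable f (π t ω)) ∧
        R.FilterEquations (fun k => X.T k ω) (fun k => X.mark k ω)
          (fun t f => ∫ l, f l ∂(π t ω)) ∧
        ∀ V : ℝ → (ClusterHistory E → ℝ) → ℝ,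
          R.FilterEquations (fun k => X.T k ω) (fun k => X.mark k ω) V →
          ∀ t : ℝ, 0 ≤ t → ∀ f : ClusterHistory E → ℝ, V t f = ∫ l, f l ∂(π t ω) := by
  obtain ⟨ω₀⟩ : Nonempty Ω := P.nonempty_of_neZero
  let e₀ := X.mark 0 ω₀
  refine ⟨⟨_, hX.isMotherQuakeFilter_filter e₀⟩, fun π hπ => ?_⟩
  filter_upwards [hX.ae_filter_eq e₀ hπ, hX.ae_filterMass_ne_zero] with ω hω hmass
  have hV : R.FilterEquations (fun k => X.T k ω) (fun k => X.mark k ω)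
      (fun t f => ∫ l, f l ∂(π t ω)) :=
    X.filterEquations_filter e₀ hmass fun t ht f => by rw [hω t ht]
  refine ⟨fun t ht f => ?_, hV, fun V hV' t ht f => X.eq_of_filterEquations hV' hV ht f⟩
  rw [hω t ht]
  exact R.integrable_filterMeasure _ _ _ f
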